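/- There exists a closed connected smooth Riemannian surface $X$, whose Gauss curvature is negative at some point, such that the Riemannian product $M=X\times\mathbb{R}$ contains a family $\{S_v\}_{0<v<\infty}$ of soap bubbles with the following properties: 1. for every $v>0$, the volume enclosed by $S_v$ is $v$; 2. there is a constant $h>0$ such that the mean curvature of $S_v$ is at least $h$ for every $v>0$; 3. for no $v>0$ is the projection $S_v\to X$ surjective; 4. there is $v_0>0$ such that $S_v$ is stable for every $v\ge v_0$. Here a soap bubble in $M$ is a compact smooth embedded hypersurface $S=\partial\Omega$ of constant mean curvature that is the boundary of a smooth, connected, relatively compact domain $\Omega\subset M$ (whose volume is the volume enclosed by $S$); the mean curvature is the sum of the principal curvatures with respect to the outer unit normal $\nu$ (so it is $d-1$ for the unit sphere of $\mathbb{R}^d$). The index form of $S$ is $$Q(u)=\int_S\bigl(|\nabla^S u|^2+P\,u^2\bigr)\,d\mathrm{area},\qquad P=-\mathrm{Ric}(\nu,\nu)-|II|^2,$$ where $\mathrm{Ric}$ is the Ricci tensor of $M$ and $II$ the second fundamental form of $S$. The bubble $S$ is stable if $Q(u)>0$ for every smooth function $u:S\to\mathbb{R}$ with $\int_S u\,d\mathrm{area}=0$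 that is not of the form $u=\langle\nu,\xi\rangle$ with $\xi$ a Killing vector field on $M$. -/

import Mathlib

set_option maxSynthPendingDepth 3

open scoped Manifold ContDiff Bundle
open MeasureTheory Set

noncomputable section

namespace SoapBubbles

/-! ### Riemannian geometry in coordinates

`E` is the model vector space and `G : E → E →L[ℝ] E →L[ℝ] ℝ` is the expression of a Riemannian
metric in a coordinate system: `G x v w` is the inner product of `v` and `w` at the point with
coordinates `x`. For a nondegenerate `G x`, `(G x).inverse` raises an index. -/

section Coordinates

variable {E : Type*} [NormedAddCommGroup E] [NormedSpace ℝ E]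

/-- The trilinear form `(v, w, z) ↦ D z v w`. -/
def rotate (D : E →L[ℝ] E →L[ℝ] E →L[ℝ] ℝ) : E →L[ℝ] E →L[ℝ] E →L[ℝ] ℝ :=
  ((ContinuousLinearMap.flipₗᵢ ℝ E E ℝ).toContinuousLinearEquiv :
      (E →L[ℝ] E →L[ℝ] ℝ) →L[ℝ] (E →L[ℝ] E →L[ℝ] ℝ)).comp D.flip

/-- The lowered Christoffel symbols
`K x v w z = (1/2) (∂_v G (w, z) + ∂_w G (v, z) - ∂_z G (v, w))`
(see `koszul_apply`). -/
def koszul (G : E → E →L[ℝ] E →L[ℝ] ℝ) (x : E) : E →L[ℝ] E →L[ℝ] E →L[ℝ] ℝ :=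
  let D : E →L[ℝ] E →L[ℝ] E →L[ℝ] ℝ := fderiv ℝ G x
  let K : E →L[ℝ] E →L[ℝ] E →L[ℝ] ℝ := D + D.flip - rotate D
  (2⁻¹ : ℝ) • K

theorem koszul_apply (G : E → E →L[ℝ] E →L[ℝ] ℝ) (x v w z : E) :
    koszul G x v w z =
      2⁻¹ * (fderiv ℝ G x v w z + fderiv ℝ G x w v z - fderiv ℝ G x z v w) := by
  simp [koszul, rotate]

/-- The Christoffel symbols of the Levi-Civita connection, `christoffel G x v w = Γ_x(v, w)`. -/
def christoffel (G : E → E →L[ℝ] E →L[ℝ] ℝ) (x : E) : E →L[ℝ] E →L[ℝ] E :=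
  (ContinuousLinearMap.compL ℝ E (E →L[ℝ] ℝ) E (G x).inverse).comp (koszul G x)

theorem christoffel_apply (G : E → E →L[ℝ] E →L[ℝ] ℝ) (x v w : E) :
    christoffel G x v w = (G x).inverse (koszul G x v w) := rfl

/-- For fixed `v`, `w`, the linear map `u ↦ R(u, v) w`, where
`R(u, v) w = ∇_u ∇_v w - ∇_v ∇_u w` (for constant coordinate fields) is the curvature tensor
(see `curvature_apply`). -/
def curvature (G : E → E →L[ℝ] E →L[ℝ] ℝ) (x v w : E) : E →L[ℝ] E :=
  ((fderiv ℝ (christoffel G) x).flip v).flip w - (fderiv ℝ (christoffel G) x v).flip w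
    + (christoffel G x).flip (christoffel G x v w)
    - (christoffel G x v).comp ((christoffel G x).flip w)

theorem curvature_apply (G : E → E →L[ℝ] E →L[ℝ] ℝ) (x u v w : E) :
    curvature G x v w u =
      fderiv ℝ (christoffel G) x u v w - fderiv ℝ (christoffel G) x v u w
        + christoffel G x u (christoffel G x v w)
        - christoffel G x v (christoffel G x u w) := by
  simp [curvature]

/-- The Ricci tensor `Ric(v, w) = trace (u ↦ R(u, v) w)`. -/
def ricci (G : E → E →L[ℝ] E →L[ℝ] ℝ) (x v w : E) : ℝ :=
  LinearMap.trace ℝ E (curvature G x v w : E →ₗ[ℝ] E)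

/-- The sectional curvature of the plane spanned by `u` and `v`. -/
def sectional (G : E → E →L[ℝ] E →L[ℝ] ℝ) (x u v : E) : ℝ :=
  G x (curvature G x v v u) u / (G x u u * G x v v - G x u v ^ 2)

/-- The gradient of a function `r`. -/
def grad (G : E → E →L[ℝ] E →L[ℝ] ℝ) (r : E → ℝ) (x : E) : E :=
  (G x).inverse (fderiv ℝ r x)

/-- The unit normal `∇r / |∇r|` of the level sets of `r`. -/
def normal (G : E → E →L[ℝ] E →L[ℝ] ℝ) (r : E → ℝ) (x : E) : E :=
  (Real.sqrt (G x (grad G r x) (grad G r x)))⁻¹ • grad G r x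

/-- The covariant derivative `v ↦ ∇_v ν` of the unit normal field `ν = normal G r`. Its restriction
to the vectors tangent to a level set of `r` is the shape operator `A`, so that
`II(v, w) = ⟨∇_v ν, w⟩` on that level set. -/
def shape (G : E → E →L[ℝ] E →L[ℝ] ℝ) (r : E → ℝ) (x : E) : E →L[ℝ] E :=
  fderiv ℝ (normal G r) x + (christoffel G x).flip (normal G r x)

/-- Orthogonal projection of tangent vectors to the tangent space of the level set of `r`. -/
def tangentialProj (G : E → E →L[ℝ] E →L[ℝ] ℝ) (r : E → ℝ) (x : E) : E →L[ℝ] E :=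
  ContinuousLinearMap.id ℝ E - (G x (normal G r x)).smulRight (normal G r x)

/-- The trace of the shape operator of the level set of `r` through `x`, extended by `0` to the
normal direction. This is the sum of the principal curvatures. -/
def traceShape (G : E → E →L[ℝ] E →L[ℝ] ℝ) (r : E → ℝ) (x : E) : ℝ :=
  LinearMap.trace ℝ E ((shape G r x).comp (tangentialProj G r x) : E →L[ℝ] E).toLinearMap

/-- `|II|² = trace (A²)`, the sum of the squares of the principal curvatures of the level set of `r`
through `x`. The shape operator `A` is extended by `0` to the normal direction. -/
def normSqShape (G : E → E →L[ℝ] E →L[ℝ] ℝ) (r : E → ℝ) (x : E) : ℝ :=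
  LinearMap.trace ℝ E
    (((shape G r x).comp (tangentialProj G r x)).comp
      ((shape G r x).comp (tangentialProj G r x)) : E →L[ℝ] E).toLinearMap

/-- `|∇^S u|²`, the squared norm of the component of `∇u` tangent to the level set `S` of `r`
through `x`. -/
def tangentialGradSq (G : E → E →L[ℝ] E →L[ℝ] ℝ) (r u : E → ℝ) (x : E) : ℝ :=
  G x (tangentialProj G r x (grad G u x)) (tangentialProj G r x (grad G u x))

/-- The Lie derivative `(L_ξ G)(v, w)` of the metric along a vector field `ξ`. -/
def lieDerivMetric (G : E → E →L[ℝ] E →L[ℝ] ℝ) (ξ : E → E) (x v w : E) : ℝ :=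
  fderiv ℝ G x (ξ x) v w + G x (fderiv ℝ ξ x v) w + G x v (fderiv ℝ ξ x w)

end Coordinates

/-! ### Riemannian manifolds -/

section Manifold

variable {E : Type*} [NormedAddCommGroup E] [NormedSpace ℝ E]
  {H : Type*} [TopologicalSpace H] {I : ModelWithCorners ℝ E H}
  {M : Type*} [TopologicalSpace M] [ChartedSpace H M] [IsManifold I ∞ M]

variable (I M) in
/-- A field of bilinear forms on the tangent spaces of `M`. All the definitions below are applied
to fields coming from smooth Riemannian metrics. -/
abbrev MetricField : Type _ := ∀ p : M, TangentSpace I p →L[ℝ] TangentSpace I p →L[ℝ] ℝ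

/-- The expression of the metric `g` in the preferred chart at `p`. -/
def coordMetric (g : MetricField I M) (p : M) (x : E) : E →L[ℝ] E →L[ℝ] ℝ :=
  let D : E →L[ℝ] E := mfderiv 𝓘(ℝ, E) I (extChartAt I p).symm x
  let B : E →L[ℝ] E →L[ℝ] ℝ := g ((extChartAt I p).symm x)
  B.bilinearComp D D

variable (I) in
/-- The expression of a function `u` in the preferred chart at `p`. -/
def coordFun (u : M → ℝ) (p : M) (x : E) : ℝ := u ((extChartAt I p).symm x)

/-- The expression of a vector field `ξ` in the preferred chart at `p`. -/
def coordField (ξ : ∀ p : M, TangentSpace I p) (p : M) (x : E) : E :=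
  mfderiv I 𝓘(ℝ, E) (extChartAt I p) ((extChartAt I p).symm x) (ξ ((extChartAt I p).symm x))

/-- `ξ` is a (smooth) Killing vector field: the Lie derivative of the metric along `ξ` is zero. -/
def IsKilling (g : MetricField I M) (ξ : ∀ p : M, TangentSpace I p) : Prop :=
  ContMDiff I I.tangent ∞ (fun p => (⟨p, ξ p⟩ : TangentBundle I M)) ∧
    ∀ (p : M) (v w : E),
      lieDerivMetric (coordMetric g p) (coordField ξ p) (extChartAt I p p) v w = 0

/-- `ψ`, defined on the open set `U ⊆ ℝ^k`, is a local parametrization of the `k`-dimensional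
embedded submanifold `N` of `M`: a smooth immersion that is a homeomorphism from `U` onto a
relatively open subset of `N`. -/
structure IsLocalParam (I : ModelWithCorners ℝ E H) (k : ℕ) (N : Set M)
    (U : Set (EuclideanSpace ℝ (Fin k))) (ψ : EuclideanSpace ℝ (Fin k) → M) : Prop where
  isOpen : IsOpen U
  contMDiffOn : ContMDiffOn (𝓡 k) I ∞ ψ U
  immersion : ∀ x ∈ U, Function.Injective (mfderiv (𝓡 k) I ψ x)
  isEmbedding : Topology.IsEmbedding (U.domRestrict ψ)
  image_eq : ∃ W : Set M, IsOpen W ∧ ψ '' U = N ∩ W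

/-- The matrix `⟨∂_i ψ, ∂_j ψ⟩` of the metric in the parametrization `ψ`. -/
def gram (g : MetricField I M) {k : ℕ} (ψ : EuclideanSpace ℝ (Fin k) → M)
    (x : EuclideanSpace ℝ (Fin k)) : Matrix (Fin k) (Fin k) ℝ :=
  Matrix.of fun i j =>
    g (ψ x) (mfderiv (𝓡 k) I ψ x (EuclideanSpace.single i (1 : ℝ)))
      (mfderiv (𝓡 k) I ψ x (EuclideanSpace.single j (1 : ℝ)))

/-- `μ` is the `k`-dimensional Riemannian measure of the `k`-dimensional embedded submanifold `N` of
`M` (for `N = univ`, the Riemannian volume of `M`): it is concentrated on `N`, and around each point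
of `N` it is given by `√det(⟨∂_i ψ, ∂_j ψ⟩) dx` in a local parametrization `ψ`. By the change of
variables formula the local expression does not depend on the parametrization, so there is exactly
one such measure when `M` is second countable. -/
def IsRiemannianMeasure [MeasurableSpace M] (g : MetricField I M) (k : ℕ) (N : Set M)
    (μ : Measure M) : Prop :=
  μ Nᶜ = 0 ∧ ∀ p ∈ N, ∃ (U : Set (EuclideanSpace ℝ (Fin k))) (ψ : EuclideanSpace ℝ (Fin k) → M),
    IsLocalParam I k N U ψ ∧ p ∈ ψ '' U ∧
      μ.restrict (ψ '' U) = ((volume.restrict U).withDensity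
        fun x => ENNReal.ofReal (Real.sqrt (gram g ψ x).det)).map ψ

/-- A (compact) soap bubble in the Riemannian manifold `(M, g)`: the boundary of a smooth domain,
with constant mean curvature. The domain is an open connected set with compact closure,
described as `{ρ < 0}` with a smooth function `ρ` whose differential does not vanish at
the boundary points; so the boundary is a smooth embedded hypersurface, with outer unit normal
`∇ρ / |∇ρ|`. The mean curvature is the sum of the principal curvatures with respect to the outer
normal (it is `d - 1` for the unit sphere of `ℝ^d`). -/
structure SoapBubble (g : MetricField I M) where
  /-- the domain enclosed by the bubble -/
  domain : Set M
  /-- a defining function of the domain -/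
  rho : M → ℝ
  /-- the mean curvature -/
  meanCurv : ℝ
  isConnected : IsConnected domain
  isCompact_closure : IsCompact (closure domain)
  contMDiff_rho : ContMDiff I 𝓘(ℝ, ℝ) ∞ rho
  domain_eq : domain = {p | rho p < 0}
  regular : ∀ p ∈ frontier domain, mfderiv I 𝓘(ℝ, ℝ) rho p ≠ 0
  meanCurv_eq : ∀ p ∈ frontier domain,
    traceShape (coordMetric g p) (coordFun I rho p) (extChartAt I p p) = meanCurv

namespace SoapBubble

variable {g : MetricField I M} (S : SoapBubble g)

/-- The hypersurface itself. -/
def surface : Set M := frontier S.domain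

/-- The enclosed volume is `v`, where `d` is the dimension of `M`. -/
def Encloses [MeasurableSpace M] (d : ℕ) (v : ℝ) : Prop :=
  ∃ μ : Measure M, IsRiemannianMeasure g d univ μ ∧ μ S.domain = ENNReal.ofReal v

/-- The coordinates, in the preferred chart at `p`, of the outer unit normal `ν` at `p`. -/
def normalAt (p : M) : E := normal (coordMetric g p) (coordFun I S.rho p) (extChartAt I p p)

/-- `P = -Ric(ν, ν) - |II|²`. -/
def potential (p : M) : ℝ :=
  -ricci (coordMetric g p) (extChartAt I p p) (S.normalAt p) (S.normalAt p)
    - normSqShape (coordMetric g p) (coordFun I S.rho p) (extChartAt I p p)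

/-- The index form `Q(u) = ∫_S (|∇^S u|² + P u²)`, where `μ` is the area measure of `S`. -/
def indexForm [MeasurableSpace M] (μ : Measure M) (u : M → ℝ) : ℝ :=
  ∫ p, (tangentialGradSq (coordMetric g p) (coordFun I S.rho p) (coordFun I u p) (extChartAt I p p)
    + S.potential p * u p ^ 2) ∂μ

/-- `u = ⟨ν, ξ⟩` on `S` for some Killing vector field `ξ` on `M`. -/
def IsKillingFunction (u : M → ℝ) : Prop :=
  ∃ ξ : ∀ p : M, TangentSpace I p, IsKilling g ξ ∧ ∀ p ∈ S.surface,
    u p = coordMetric g p (extChartAt I p p) (S.normalAt p) (coordField ξ p (extChartAt I p p))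

/-- `S` (a hypersurface of dimension `m`) is stable: the index form is positive on all smooth
functions on `S` with zero average, except those of the form `⟨ν, ξ⟩` with `ξ` a Killing field
on `M`. Smooth functions on the closed embedded hypersurface `S` are the restrictions of smooth
functions on `M`. -/
def IsStable [MeasurableSpace M] (m : ℕ) : Prop :=
  ∃ μ : Measure M, IsRiemannianMeasure g m S.surface μ ∧
    ∀ u : M → ℝ, ContMDiff I 𝓘(ℝ, ℝ) ∞ u → ∫ p, u p ∂μ = 0 → ¬ S.IsKillingFunction u →
      0 < S.indexForm μ u

end SoapBubble

end Manifold

/-- The Gauss curvature at `p` of a surface with Riemannian metric `g`. -/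
def gaussCurvature {X : Type*} [TopologicalSpace X] [ChartedSpace (EuclideanSpace ℝ (Fin 2)) X]
    (g : MetricField (𝓡 2) X) (p : X) : ℝ :=
  sectional (coordMetric g p) (extChartAt (𝓡 2) p p)
    (EuclideanSpace.single 0 (1 : ℝ)) (EuclideanSpace.single 1 (1 : ℝ))

/-- The product metric `g + dy²` on `X × ℝ`. -/
def productMetric {E : Type*} [NormedAddCommGroup E] [NormedSpace ℝ E]
    {H : Type*} [TopologicalSpace H] {I : ModelWithCorners ℝ E H}
    {X : Type*} [TopologicalSpace X] [ChartedSpace H X] (g : MetricField I X) :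
    MetricField (I.prod 𝓘(ℝ, ℝ)) (X × ℝ) := fun p =>
  let B : E →L[ℝ] E →L[ℝ] ℝ := g p.1
  (B.bilinearComp (ContinuousLinearMap.fst ℝ E ℝ) (ContinuousLinearMap.fst ℝ E ℝ) +
    (ContinuousLinearMap.mul ℝ ℝ).bilinearComp (ContinuousLinearMap.snd ℝ E ℝ)
      (ContinuousLinearMap.snd ℝ E ℝ) : E × ℝ →L[ℝ] E × ℝ →L[ℝ] ℝ)

end SoapBubbles

end

noncomputable section

namespace TorusBubble

open Topology Filter SoapBubbles

/-! The surface is the torus ℝ²/(2πℤ × ℤ) with the metric dr² + φ(r)² dθ², where φ = 1/(1 + cos r)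
as long as cos r ≥ -1/2. The bubbles are the hypersurfaces {cos r = c cosh y} with 0 < c < 1. Put s
= √(1 - c²) and C = cos r. The generating curve in the (r, y)-plane has unit normal (sin r, c sinh
y)/s and curvature C/s. The choice of φ gives φ'/φ = sin r/(1 + cos r), so the curvature in the θ
direction is (1 - C)/s, and the mean curvature is the constant 1/s > 1 (`shape_comp_tangentialProj`,
`traceShape_levelFun`). Since C > 0 on every bubble, the shape of φ near r = π plays no role, and
the circle r = π is missed by the projection. The enclosed volume is continuous and nonincreasing in
c, vanishes at c = 1 and is unbounded as c → 0, so every volume occurs (`exists_enclosed_eq`).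

For stability, the generating curve is parametrized by the angle τ of its normal: sin r = s cos τ, c
sinh y = s sin τ. With κ = 1/(1 + C) the area element is (sκ/C) dτ dθ, and the index form is s⁻¹
times the double integral of Cκ u_τ² + (1 - C - C²)(κ/C) u² + s²(1 + C)/C u_θ². Up to a constant
factor, C is the normal speed of the family as c varies, so the Jacobi operator sends it to a
constant. Writing u = Cη therefore turns the part without u_θ into ∫ (C³κ η_τ² - c²κ η²) dτ
(`curveForm_eq`), and the constraint becomes that κη has integral zero.

For functions of τ alone, stability is thus a weighted Poincaré inequality, `poincare_circle`, with
equality only for Cη = β sin τ, the normal component of a vertical translation. The reflection r ↦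
-r splits η into an odd part, satisfying Dirichlet conditions on half of the curve, and an even part
with mean zero, which is replaced by the primitive of κη to get Dirichlet conditions again. Both
cases are Hardy inequalities with an explicit solution of a Riccati equation (`hardy_riccati`,
`riccati_dirichlet`, `riccati_neumann`).

For general u, the mean M(θ) = ∫ κη dτ need not vanish for each θ, which costs a multiple of M(θ)².
But M averages to zero over θ, so this loss is at most c² ∬ (κ/C²) u_θ² (`sq_mean_le`), and for c ≤
1/2 the term s²(1 + C)/C u_θ² strictly exceeds it (`sq_lt_sinC_sq_mul`). Hence a nonpositive index
form forces u_θ = 0 and u = β sin τ. Large volumes force c ≤ 1/2. -/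

instance : Fact (0 < 2 * Real.pi) := ⟨Real.two_pi_pos⟩

/-! ### The torus as a quotient of the plane, with charts that differ by translations. -/

/-- The coordinate plane. -/
abbrev Plane := EuclideanSpace ℝ (Fin 2)

/-- The torus `ℝ² / (2πℤ × ℤ)`. -/
abbrev Torus := AddCircle (2 * Real.pi) × AddCircle (1 : ℝ)

/-- The coordinates of a point of the plane. -/
def coords : Plane ≃ₜ ℝ × ℝ :=
  (EuclideanSpace.equiv (Fin 2) ℝ).toHomeomorph.trans (Homeomorph.finTwoArrow)

/-- The covering map from the plane to the torus. -/
def proj (x : Plane) : Torus := (↑(x 0), ↑(x 1))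

theorem continuous_proj : Continuous proj := by
  have h0 : Continuous fun x : Plane => x 0 := by fun_prop
  have h1 : Continuous fun x : Plane => x 1 := by fun_prop
  exact ((AddCircle.continuous_mk' _).comp h0).prodMk ((AddCircle.continuous_mk' _).comp h1)

theorem proj_add (x y : Plane) : proj (x + y) = proj x + proj y := by
  simp [proj]

theorem proj_sub (x y : Plane) : proj (x - y) = proj x - proj y := by
  simp [proj]

theorem proj_surjective : Function.Surjective proj := by
  rintro ⟨p, q⟩
  obtain ⟨a, rfl⟩ := QuotientAddGroup.mk_surjective p
  obtain ⟨b, rfl⟩ := QuotientAddGroup.mk_surjective q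
  exact ⟨!₂[a, b], rfl⟩

/-- The restriction of the covering map to the open box with lower left corner `a`. -/
def box (a : ℝ × ℝ) : OpenPartialHomeomorph Plane Torus :=
  coords.toOpenPartialHomeomorph.trans
    ((AddCircle.openPartialHomeomorphCoe (2 * Real.pi) a.1).prod
      (AddCircle.openPartialHomeomorphCoe (1 : ℝ) a.2))

theorem coe_box (a : ℝ × ℝ) : ⇑(box a) = proj := rfl

theorem mem_box_source {a : ℝ × ℝ} {x : Plane} : x ∈ (box a).source ↔
    x 0 ∈ Ioo a.1 (a.1 + 2 * Real.pi) ∧ x 1 ∈ Ioo a.2 (a.2 + 1) := by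
  simp [box, coords]

/-- On the target of a box, the inverse of the covering map is locally a translation. -/
theorem exists_box_symm_proj_eq_add {a : ℝ × ℝ} {x : Plane} (hx : proj x ∈ (box a).target) :
    ∃ k : Plane, ∀ᶠ x' in 𝓝 x, (box a).symm (proj x') = x' + k := by
  set y := (box a).symm (proj x) with hy
  have hys : y ∈ (box a).source := (box a).map_target hx
  have hpy : proj y = proj x := (box a).right_inv hx
  refine ⟨y - x, ?_⟩
  -- The difference y - x is a period of the covering map, so near x translation by it stays over
  -- the same point and lands in the box, where the covering map is injective.
  have hc : Tendsto (fun x' : Plane => x' + (y - x)) (𝓝 x) (𝓝 y) := by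
    have : Continuous fun x' : Plane => x' + (y - x) := by fun_prop
    simpa using this.tendsto x
  filter_upwards [hc.eventually ((box a).open_source.mem_nhds hys)] with x' hx'
  have h1 : proj (x' + (y - x)) = proj x' := by
    rw [proj_add, proj_sub, hpy, sub_self, add_zero]
  rw [← h1]
  exact (box a).left_inv hx'

/-- A lift of a point of the torus to the plane. -/
def lift (p : Torus) : Plane := Function.surjInv proj_surjective p

theorem proj_lift (p : Torus) : proj (lift p) = p := Function.surjInv_eq _ p

/-- The corner of the box centred at the lift of `p`. -/
def corner (p : Torus) : ℝ × ℝ := (lift p 0 - Real.pi, lift p 1 - 1 / 2)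

theorem lift_mem_box (p : Torus) : lift p ∈ (box (corner p)).source := by
  rw [mem_box_source]
  have := Real.pi_pos
  constructor <;> constructor <;> simp [corner] <;> linarith

theorem mem_box_target (p : Torus) : p ∈ (box (corner p)).target := by
  have := (box (corner p)).map_source (lift_mem_box p)
  rwa [coe_box, proj_lift] at this

instance : ChartedSpace Plane Torus where
  atlas := range fun a => (box a).symm
  chartAt p := (box (corner p)).symm
  mem_chart_source p := mem_box_target p
  chart_mem_atlas _ := ⟨_, rfl⟩

instance : IsManifold (𝓡 2) ∞ Torus := by
  apply isManifold_of_contDiffOn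
  rintro _ _ ⟨a, rfl⟩ ⟨b, rfl⟩
  intro x hx
  simp only [modelWithCornersSelf_coe_symm, preimage_id_eq, id, OpenPartialHomeomorph.symm_symm,
    modelWithCornersSelf_coe, range_id, inter_univ, OpenPartialHomeomorph.trans_source,
    OpenPartialHomeomorph.symm_source, mem_inter_iff, mem_preimage, coe_box] at hx
  obtain ⟨k, hk⟩ := exists_box_symm_proj_eq_add hx.2
  have hs : ContDiffAt ℝ ∞ (fun x' : Plane => x' + k) x := by fun_prop
  exact (hs.congr_of_eventuallyEq hk).contDiffWithinAt

/-- Read in a chart, the covering map is locally a translation. -/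
theorem hasMFDerivAt_proj (x : Plane) :
    HasMFDerivAt 𝓘(ℝ, Plane) (𝓡 2) proj x (ContinuousLinearMap.id ℝ Plane) := by
  refine ⟨continuous_proj.continuousAt, ?_⟩
  obtain ⟨k, hk⟩ := exists_box_symm_proj_eq_add (mem_box_target (proj x))
  have : HasFDerivAt (fun x' : Plane => x' + k) (ContinuousLinearMap.id ℝ Plane) x :=
    (hasFDerivAt_id x).add_const k
  exact (this.congr_of_eventuallyEq hk).hasFDerivWithinAt

theorem contMDiff_proj : ContMDiff 𝓘(ℝ, Plane) (𝓡 2) ∞ proj := by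
  intro x
  rw [contMDiffAt_iff]
  refine ⟨continuous_proj.continuousAt, ?_⟩
  obtain ⟨k, hk⟩ := exists_box_symm_proj_eq_add (mem_box_target (proj x))
  have hs : ContDiffAt ℝ ∞ (fun x' : Plane => x' + k) x := by fun_prop
  exact (hs.congr_of_eventuallyEq hk).contDiffWithinAt

/-- All inverse charts are the same total function, so coordinate expressions at different base
points are literally equal. Every later computation can thus be done once, on the covering space. -/
theorem extChartAt_symm_eq (p : Torus) : ⇑(extChartAt (𝓡 2) p).symm = proj := rfl

theorem proj_extChartAt (p : Torus) : proj (extChartAt (𝓡 2) p p) = p :=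
  (extChartAt (𝓡 2) p).left_inv (mem_extChartAt_source p)

/-! ### Charts of the product with the line. -/

/-- The model with corners of `Torus × ℝ`. -/
abbrev J := (𝓡 2).prod 𝓘(ℝ, ℝ)

/-- The covering map onto `Torus × ℝ`. -/
def projM (x : Plane × ℝ) : Torus × ℝ := (proj x.1, x.2)

theorem projM_surjective : Function.Surjective projM := by
  rintro ⟨p, y⟩
  exact ⟨(lift p, y), by simp [projM, proj_lift]⟩

theorem continuous_projM : Continuous projM :=
  (continuous_proj.comp continuous_fst).prodMk continuous_snd

theorem hasMFDerivAt_projM (x : Plane × ℝ) :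
    HasMFDerivAt 𝓘(ℝ, Plane × ℝ) J projM x (ContinuousLinearMap.id ℝ (Plane × ℝ)) := by
  refine ⟨continuous_projM.continuousAt, ?_⟩
  obtain ⟨k, hk⟩ := exists_box_symm_proj_eq_add (mem_box_target (proj x.1))
  have : HasFDerivAt (fun x' : Plane × ℝ => (x'.1 + k, x'.2)) (ContinuousLinearMap.id ℝ (Plane × ℝ)) x := by
    simpa [Prod.mk_add_mk, Prod.add_def] using (hasFDerivAt_id x).add_const (k, (0 : ℝ))
  refine (this.congr_of_eventuallyEq ?_).hasFDerivWithinAt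
  filter_upwards [continuous_fst.continuousAt.eventually hk] with x' hx'
  exact Prod.ext hx' rfl

theorem contMDiff_projM : ContMDiff 𝓘(ℝ, Plane × ℝ) J ∞ projM := by
  have h1 : ContMDiff 𝓘(ℝ, Plane × ℝ) 𝓘(ℝ, Plane) ∞ (Prod.fst : Plane × ℝ → Plane) :=
    contDiff_fst.contMDiff
  have h2 : ContMDiff 𝓘(ℝ, Plane × ℝ) 𝓘(ℝ, ℝ) ∞ (Prod.snd : Plane × ℝ → ℝ) :=
    contDiff_snd.contMDiff
  exact (contMDiff_proj.comp h1).prodMk h2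

theorem extChartAt_symm_eq_projM (p : Torus × ℝ) : ⇑(extChartAt J p).symm = projM := by
  rw [extChartAt_prod]; rfl

theorem projM_extChartAt (p : Torus × ℝ) : projM (extChartAt J p p) = p := by
  rw [← extChartAt_symm_eq_projM p]
  exact (extChartAt J p).left_inv (mem_extChartAt_source p)

/-- A map from `Torus × ℝ` is smooth if its composition with the covering map is. -/
theorem contMDiff_of_comp_projM {E' H' N : Type*} [NormedAddCommGroup E'] [NormedSpace ℝ E']
    [TopologicalSpace H'] {I' : ModelWithCorners ℝ E' H'} [TopologicalSpace N] [ChartedSpace H' N]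
    {f : Torus × ℝ → N} (hf : ContMDiff 𝓘(ℝ, Plane × ℝ) I' ∞ (f ∘ projM)) :
    ContMDiff J I' ∞ f := by
  intro p
  have h1 : ContMDiffAt J 𝓘(ℝ, Plane × ℝ) ∞ (extChartAt J p) p := contMDiffAt_extChartAt
  have h2 := (hf (extChartAt J p p)).comp p h1
  refine h2.congr_of_eventuallyEq ?_
  filter_upwards [extChartAt_source_mem_nhds (I := J) p] with q hq
  have := (extChartAt J p).left_inv hq
  rw [extChartAt_symm_eq_projM] at this
  exact congrArg f this.symm

/-- A map from the torus is smooth if its composition with the covering map is. -/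
theorem contMDiff_of_comp_proj {E' H' N : Type*} [NormedAddCommGroup E'] [NormedSpace ℝ E']
    [TopologicalSpace H'] {I' : ModelWithCorners ℝ E' H'} [TopologicalSpace N] [ChartedSpace H' N]
    {f : Torus → N} (hf : ContMDiff 𝓘(ℝ, Plane) I' ∞ (f ∘ proj)) :
    ContMDiff (𝓡 2) I' ∞ f := by
  intro p
  have h1 : ContMDiffAt (𝓡 2) 𝓘(ℝ, Plane) ∞ (extChartAt (𝓡 2) p) p := contMDiffAt_extChartAt
  have h2 := (hf (extChartAt (𝓡 2) p p)).comp p h1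
  refine h2.congr_of_eventuallyEq ?_
  filter_upwards [extChartAt_source_mem_nhds (I := 𝓡 2) p] with q hq
  have := (extChartAt (𝓡 2) p).left_inv hq
  rw [extChartAt_symm_eq] at this
  exact congrArg f this.symm

theorem mfderiv_extChartAt_symm (p : Torus × ℝ) (x : Plane × ℝ) :
    mfderiv 𝓘(ℝ, Plane × ℝ) J (extChartAt J p).symm x = ContinuousLinearMap.id ℝ (Plane × ℝ) := by
  rw [extChartAt_symm_eq_projM]
  exact (hasMFDerivAt_projM x).mfderiv

/-- The chart composed with the covering map is the identity near points of the chart target; the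
derivative of the covering map is the identity, so that of the chart is too. -/
theorem mfderiv_extChartAt_proj (p : Torus × ℝ) {x : Plane × ℝ} (hx : x ∈ (extChartAt J p).target) :
    mfderiv J 𝓘(ℝ, Plane × ℝ) (extChartAt J p) (projM x) = ContinuousLinearMap.id ℝ (Plane × ℝ) := by
  have hs : projM x ∈ (extChartAt J p).source := by
    rw [← extChartAt_symm_eq_projM p]; exact (extChartAt J p).map_target hx
  have h1 : MDifferentiableAt J 𝓘(ℝ, Plane × ℝ) (extChartAt J p) (projM x) :=
    mdifferentiableAt_extChartAt (by simpa using hs)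
  have h2 := HasMFDerivAt.comp x h1.hasMFDerivAt (hasMFDerivAt_projM x)
  have h3 : HasMFDerivAt 𝓘(ℝ, Plane × ℝ) 𝓘(ℝ, Plane × ℝ) (extChartAt J p ∘ projM) x
      (ContinuousLinearMap.id ℝ (Plane × ℝ)) := by
    refine (hasMFDerivAt_id x).congr_of_eventuallyEq ?_
    filter_upwards [(isOpen_extChartAt_target p).mem_nhds hx] with y hy
    have := (extChartAt J p).right_inv hy
    rw [extChartAt_symm_eq_projM] at this
    simpa using this
  exact (ContinuousLinearMap.comp_id _).symm.trans (h2.mfderiv.symm.trans h3.mfderiv)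

/-! ### The warping function. -/

/-- The profile of the warping function, as a function of the cosine of the first coordinate. It is
`1 / (1 + t)` for `t ≥ -1/2`, and it is smooth and positive everywhere. -/
def profile (t : ℝ) : ℝ := (1 + t * Real.smoothTransition (4 * t + 3))⁻¹

/-- Below t = -3/4 the cutoff vanishes and the denominator is 1; above it, the cutoff lies in [0, 1]
and the denominator is at least 1/4. -/
theorem profile_denom_pos (t : ℝ) : 0 < 1 + t * Real.smoothTransition (4 * t + 3) := by
  have h0 := Real.smoothTransition.nonneg (4 * t + 3)
  have h1 := Real.smoothTransition.le_one (4 * t + 3)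
  rcases le_or_gt t (-3 / 4) with h | h
  · rw [Real.smoothTransition.zero_of_nonpos (by linarith)]; norm_num
  · nlinarith

theorem profile_pos (t : ℝ) : 0 < profile t := inv_pos.2 (profile_denom_pos t)

theorem profile_eq {t : ℝ} (ht : -1 / 2 ≤ t) : profile t = (1 + t)⁻¹ := by
  rw [profile, Real.smoothTransition.one_of_one_le (by linarith), mul_one]

theorem contDiff_profile : ContDiff ℝ ∞ profile := by
  unfold profile
  refine ContDiff.inv ?_ fun t => (profile_denom_pos t).ne'
  have h : ContDiff ℝ ∞ fun t : ℝ => Real.smoothTransition (4 * t + 3) :=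
    Real.smoothTransition.contDiff.comp (by fun_prop)
  fun_prop

/-- The square of the warping function at height `r`. -/
def warp (r : ℝ) : ℝ := profile (Real.cos r) ^ 2

theorem warp_pos (r : ℝ) : 0 < warp r := pow_pos (profile_pos _) 2

theorem contDiff_warp : ContDiff ℝ ∞ warp :=
  (contDiff_profile.comp Real.contDiff_cos).pow 2

theorem warp_periodic : Function.Periodic warp (2 * Real.pi) := fun r => by
  simp [warp, Real.cos_add_two_pi]

/-! ### The Riemannian metric of the torus. -/

/-- The square of a linear form. -/
def sqForm {E : Type*} [NormedAddCommGroup E] [NormedSpace ℝ E] (α : E →L[ℝ] ℝ) :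
    E →L[ℝ] E →L[ℝ] ℝ := α.smulRight α

@[simp] theorem sqForm_apply {E : Type*} [NormedAddCommGroup E] [NormedSpace ℝ E] (α : E →L[ℝ] ℝ)
    (v w : E) : sqForm α v w = α v * α w := by
  simp [sqForm]

/-- The bilinear form `dr² + a dθ²` on the plane. -/
def planeForm (a : ℝ) : Plane →L[ℝ] Plane →L[ℝ] ℝ :=
  sqForm (EuclideanSpace.proj (0 : Fin 2)) + a • sqForm (EuclideanSpace.proj (1 : Fin 2))

@[simp] theorem planeForm_apply (a : ℝ) (v w : Plane) :
    planeForm a v w = v 0 * w 0 + a * (v 1 * w 1) := by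
  simp [planeForm]

/-- The warping function on the torus. -/
def warpT (p : Torus) : ℝ := warp_periodic.lift p.1

@[simp] theorem warpT_proj (x : Plane) : warpT (proj x) = warp (x 0) := rfl

theorem warpT_pos (p : Torus) : 0 < warpT p := by
  obtain ⟨x, rfl⟩ := proj_surjective p
  exact warp_pos _

theorem contMDiff_warpT : ContMDiff (𝓡 2) 𝓘(ℝ, ℝ) ∞ warpT := by
  apply contMDiff_of_comp_proj
  have : ContDiff ℝ ∞ fun x : Plane => warp (x 0) := contDiff_warp.comp (by fun_prop)
  exact this.contMDiff

/-- Transition maps are translations, so the tangent bundle is trivialized globally and the metric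
needs no change of frame. -/
theorem tangentCoordChange_torus {p q : Torus} (hq : q ∈ (chartAt Plane p).source) :
    (tangentBundleCore (𝓡 2) Torus).coordChange (achart Plane p) (achart Plane q) q =
      ContinuousLinearMap.id ℝ Plane := by
  rw [tangentBundleCore_coordChange_achart]
  have hq' : q ∈ (extChartAt (𝓡 2) p).source := by rwa [extChartAt_source]
  have h1 : proj (extChartAt (𝓡 2) p q) = q := (extChartAt (𝓡 2) p).left_inv hq'
  obtain ⟨k, hk⟩ := exists_box_symm_proj_eq_add (a := corner q)
    (x := extChartAt (𝓡 2) p q) (by rw [h1]; exact mem_box_target q)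
  have h : HasFDerivAt (fun x' : Plane => x' + k) (ContinuousLinearMap.id ℝ Plane)
    (extChartAt (𝓡 2) p q) := (hasFDerivAt_id _).add_const k
  have h2 := (h.congr_of_eventuallyEq hk).hasFDerivWithinAt (s := range (𝓡 2))
  exact h2.fderivWithin ((𝓡 2).uniqueDiffOn _ (mem_range_self _))

theorem symm_trivializationAt_torus {p q : Torus} (hq : q ∈ (chartAt Plane p).source) (v : Plane) :
    (trivializationAt Plane (TangentSpace (𝓡 2)) p).symm q v = v := by
  have := TangentBundle.symmL_trivializationAt_eq_core (I := 𝓡 2) hq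
  have h2 := DFunLike.congr_fun this v
  rw [tangentCoordChange_torus hq, Bundle.Trivialization.symmL_apply _ hq] at h2
  exact h2

theorem planeForm_comm (a : ℝ) (v w : Plane) : planeForm a v w = planeForm a w v := by
  simp; ring

theorem planeForm_self_pos {a : ℝ} (ha : 0 < a) {v : Plane} (hv : v ≠ 0) :
    0 < planeForm a v v := by
  have : v 0 ≠ 0 ∨ v 1 ≠ 0 := by
    by_contra! h
    apply hv
    ext i
    fin_cases i
    · exact h.1
    · exact h.2
  rw [planeForm_apply]
  rcases this with h | h
  · have := mul_self_pos.2 h; have := mul_nonneg ha.le (mul_self_nonneg (v 1)); linarith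
  · have := mul_pos ha (mul_self_pos.2 h); have := mul_self_nonneg (v 0); linarith

theorem isVonNBounded_planeForm {a : ℝ} (ha : 0 < a) :
    Bornology.IsVonNBounded ℝ {v : Plane | planeForm a v v < 1} := by
  rw [NormedSpace.isVonNBounded_iff]
  refine (Metric.isBounded_closedBall (x := (0 : Plane)) (r := 1 + a⁻¹)).subset ?_
  intro v hv
  simp only [planeForm_apply, mem_ofPred_eq] at hv
  have hi : 0 < a⁻¹ := inv_pos.2 ha
  rw [mem_closedBall_zero_iff, EuclideanSpace.norm_eq, Real.sqrt_le_left (by positivity)]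
  simp only [Fin.sum_univ_two, Real.norm_eq_abs, sq_abs]
  have h0 : a * a⁻¹ = 1 := mul_inv_cancel₀ ha.ne'
  have h1 : v 0 ^ 2 ≤ 1 := by nlinarith [mul_nonneg ha.le (mul_self_nonneg (v 1))]
  have h2 : v 1 ^ 2 ≤ a⁻¹ := by
    rw [← mul_le_mul_iff_right₀ ha, h0]; nlinarith [mul_self_nonneg (v 0)]
  nlinarith

/-- The metric tensor `dr² + φ(r)² dθ²` of the torus. -/
def metricT (p : Torus) : TangentSpace (𝓡 2) p →L[ℝ] TangentSpace (𝓡 2) p →L[ℝ] ℝ :=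
  planeForm (warpT p)

theorem inCoordinates_metricT {p q : Torus} (hq : q ∈ (chartAt Plane p).source) (v w : Plane) :
    ContinuousLinearMap.inCoordinates Plane (TangentSpace (𝓡 2)) (Plane →L[ℝ] ℝ)
      (fun x : Torus => TangentSpace (𝓡 2) x →L[ℝ] ℝ) p q p q (metricT q) v w =
    planeForm (warpT q) v w := by
  have h := inCoordinates_apply_eq₂ (F₁ := Plane) (F₂ := Plane) (F₃ := ℝ)
    (E₁ := (TangentSpace (𝓡 2) : Torus → Type)) (E₂ := (TangentSpace (𝓡 2) : Torus → Type))
    (E₃ := Bundle.Trivial Torus ℝ) (ϕ := metricT q) (v := v) (w := w) (x₀ := p) (x := q)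
    hq hq (by simp)
  rw [symm_trivializationAt_torus hq, symm_trivializationAt_torus hq] at h
  refine h.trans ?_
  simp
  rfl

/-- The Riemannian metric `dr² + φ(r)² dθ²` of the torus. -/
def metric : Bundle.ContMDiffRiemannianMetric (𝓡 2) ∞ Plane
    (fun p : Torus => TangentSpace (𝓡 2) p) where
  inner := metricT
  symm p v w := planeForm_comm _ _ _
  pos p v hv := planeForm_self_pos (warpT_pos p) hv
  isVonNBounded p := isVonNBounded_planeForm (warpT_pos p)
  contMDiff := by
    intro p
    refine (Bundle.contMDiffAt_section (s := metricT) p).2 ?_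
    have h : ContMDiffAt (𝓡 2) 𝓘(ℝ, Plane →L[ℝ] Plane →L[ℝ] ℝ) ∞
        (fun q => planeForm (warpT q)) p := by
      have h1 : ContDiff ℝ ∞ planeForm := by unfold planeForm; fun_prop
      exact (h1.contMDiff.comp contMDiff_warpT) p
    refine h.congr_of_eventuallyEq ?_
    filter_upwards [(chartAt Plane p).open_source.mem_nhds (mem_chart_source Plane p)] with q hq
    ext v w
    rw [hom_trivializationAt_apply]
    exact inCoordinates_metricT hq v w

/-! ### Curvature of warped metrics in coordinates -/

section Warped

variable {E : Type*} [NormedAddCommGroup E] [NormedSpace ℝ E]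

/-- The tensor `(v, w) ↦ α v * β w • e`. -/
def tensor (α β : E →L[ℝ] ℝ) (e : E) : E →L[ℝ] E →L[ℝ] E := α.smulRight (β.smulRight e)

@[simp] theorem tensor_apply (α β : E →L[ℝ] ℝ) (e v w : E) :
    tensor α β e v w = (α v * β w) • e := by
  simp [tensor, mul_smul]

variable {G : E → E →L[ℝ] E →L[ℝ] ℝ} {B : E →L[ℝ] E →L[ℝ] ℝ} {a : ℝ → ℝ}
  {α₀ α₁ : E →L[ℝ] ℝ} {e₀ e₁ : E}

theorem hasFDerivAt_warped (hG : ∀ x, G x = B + a (α₀ x) • sqForm α₁) {x : E} {a' : ℝ}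
    (ha : HasDerivAt a a' (α₀ x)) :
    HasFDerivAt G (α₀.smulRight (a' • sqForm α₁)) x := by
  have h1 : HasFDerivAt (fun y => a (α₀ y)) (a' • α₀) x := ha.comp_hasFDerivAt x α₀.hasFDerivAt
  have h2 := (h1.smul_const (sqForm α₁)).const_add B
  have h3 : G = fun y => B + a (α₀ y) • sqForm α₁ := funext hG
  rw [h3]
  have h4 : α₀.smulRight (a' • sqForm α₁) = (a' • α₀).smulRight (sqForm α₁) := by
    ext u v w
    simp; ring
  rw [h4]
  exact h2

/-- With a = φ² these are the usual symbols of a warped product: Γ(e₁, e₁) = -φφ' e₀ and Γ(e₀, e₁) =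
(φ'/φ) e₁. Stating them for an abstract E serves both the surface and its product with ℝ. -/
theorem christoffel_warped (hG : ∀ x, G x = B + a (α₀ x) • sqForm α₁)
    (hinv : ∀ x, (G x).IsInvertible) (ha : Differentiable ℝ a) (hpos : ∀ r, 0 < a r)
    (h0 : B e₀ = α₀) (h1 : B e₁ = 0) (h10 : α₁ e₀ = 0) (h11 : α₁ e₁ = 1) (x : E) :
    christoffel G x = (-(deriv a (α₀ x) / 2)) • tensor α₁ α₁ e₀ +
      (deriv a (α₀ x) / (2 * a (α₀ x))) • (tensor α₀ α₁ e₁ + tensor α₁ α₀ e₁) := by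
  ext v w
  rw [christoffel_apply]
  -- Lowering the index of the claimed symbols avoids computing the inverse of the metric.
  have hx : koszul G x v w = G x ((-(deriv a (α₀ x) / 2)) • tensor α₁ α₁ e₀ v w +
      (deriv a (α₀ x) / (2 * a (α₀ x))) • (tensor α₀ α₁ e₁ v w + tensor α₁ α₀ e₁ v w)) := by
    ext z
    have hp := (hpos (α₀ x)).ne'
    rw [koszul_apply, (hasFDerivAt_warped hG (ha _).hasDerivAt).fderiv, hG]
    simp [h0, h1, h10, h11]
    field_simp
    ring
  rw [hx]
  obtain ⟨e, he⟩ := hinv x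
  rw [← he]
  simp

theorem fderiv_christoffel_warped (hG : ∀ x, G x = B + a (α₀ x) • sqForm α₁)
    (hinv : ∀ x, (G x).IsInvertible) (ha : Differentiable ℝ a) (hpos : ∀ r, 0 < a r)
    (h0 : B e₀ = α₀) (h1 : B e₁ = 0) (h10 : α₁ e₀ = 0) (h11 : α₁ e₁ = 1) {x : E} {f₀' f₁' : ℝ}
    (hf0 : HasDerivAt (fun r => -(deriv a r / 2)) f₀' (α₀ x))
    (hf1 : HasDerivAt (fun r => deriv a r / (2 * a r)) f₁' (α₀ x)) :
    fderiv ℝ (christoffel G) x = α₀.smulRight (f₀' • tensor α₁ α₁ e₀ +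
      f₁' • (tensor α₀ α₁ e₁ + tensor α₁ α₀ e₁)) := by
  have h2 : HasFDerivAt (fun y => -(deriv a (α₀ y) / 2)) (f₀' • α₀) x :=
    hf0.comp_hasFDerivAt x α₀.hasFDerivAt
  have h3 : HasFDerivAt (fun y => deriv a (α₀ y) / (2 * a (α₀ y))) (f₁' • α₀) x :=
    hf1.comp_hasFDerivAt x α₀.hasFDerivAt
  rw [funext (christoffel_warped hG hinv ha hpos h0 h1 h10 h11)]
  have h4 := (h2.smul_const (tensor α₁ α₁ e₀)).add
    (h3.smul_const (tensor α₀ α₁ e₁ + tensor α₁ α₀ e₁))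
  refine HasFDerivAt.fderiv ?_
  have h5 : α₀.smulRight (f₀' • tensor α₁ α₁ e₀ + f₁' • (tensor α₀ α₁ e₁ + tensor α₁ α₀ e₁)) =
      (f₀' • α₀).smulRight (tensor α₁ α₁ e₀) +
        (f₁' • α₀).smulRight (tensor α₀ α₁ e₁ + tensor α₁ α₀ e₁) := by
    ext u v w
    simp [smul_smul]
    module
  rw [h5]
  exact h4

/-- With a = φ², the factor f₁' + (a'/2a)² is (φ'/φ)' + (φ'/φ)² = φ''/φ. The rank one form makes its
trace, the Ricci curvature, immediate. -/
theorem curvature_warped_orthogonal (hG : ∀ x, G x = B + a (α₀ x) • sqForm α₁)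
    (hinv : ∀ x, (G x).IsInvertible) (ha : Differentiable ℝ a) (hpos : ∀ r, 0 < a r)
    (h0 : B e₀ = α₀) (h1 : B e₁ = 0) (h10 : α₁ e₀ = 0) (h11 : α₁ e₁ = 1) {x : E} {f₀' f₁' : ℝ}
    (hf0 : HasDerivAt (fun r => -(deriv a r / 2)) f₀' (α₀ x))
    (hf1 : HasDerivAt (fun r => deriv a r / (2 * a r)) f₁' (α₀ x)) {v : E} (hv : α₁ v = 0) :
    curvature G x v v =
      α₁.smulRight ((-(f₁' + (deriv a (α₀ x) / (2 * a (α₀ x))) ^ 2) * α₀ v ^ 2) • e₁) := by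
  ext u
  rw [curvature_apply, fderiv_christoffel_warped hG hinv ha hpos h0 h1 h10 h11 hf0 hf1,
    christoffel_warped hG hinv ha hpos h0 h1 h10 h11]
  simp [hv, h11, smul_smul]
  module

/-- With a = φ², the coefficient is -(φ'² + φφ'') + φ'² = -φφ''; this is what the Gauss curvature
needs. -/
theorem curvature_warped_horizontal (hG : ∀ x, G x = B + a (α₀ x) • sqForm α₁)
    (hinv : ∀ x, (G x).IsInvertible) (ha : Differentiable ℝ a) (hpos : ∀ r, 0 < a r)
    (h0 : B e₀ = α₀) (h1 : B e₁ = 0) (h00 : α₀ e₀ = 1) (h01 : α₀ e₁ = 0) (h10 : α₁ e₀ = 0)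
    (h11 : α₁ e₁ = 1) {x : E} {f₀' f₁' : ℝ}
    (hf0 : HasDerivAt (fun r => -(deriv a r / 2)) f₀' (α₀ x))
    (hf1 : HasDerivAt (fun r => deriv a r / (2 * a r)) f₁' (α₀ x)) :
    curvature G x e₁ e₁ e₀ = (f₀' + deriv a (α₀ x) ^ 2 / (4 * a (α₀ x))) • e₀ := by
  rw [curvature_apply, fderiv_christoffel_warped hG hinv ha hpos h0 h1 h10 h11 hf0 hf1,
    christoffel_warped hG hinv ha hpos h0 h1 h10 h11]
  have hp := (hpos (α₀ x)).ne'
  simp [h11, h10, h01, h00, smul_smul, ← add_smul]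
  congr 1
  field_simp
  ring

theorem trace_smulRight [FiniteDimensional ℝ E] (α : E →L[ℝ] ℝ) (e : E) :
    LinearMap.trace ℝ E (α.smulRight e).toLinearMap = α e := by
  exact LinearMap.trace_smulRight _ _

end Warped

/-! ### The product metric in coordinates -/

/-- The coordinate space of `Torus × ℝ`. -/
abbrev Space := Plane × ℝ

/-- The coordinate forms of (r, θ, y), with `t` standing for θ, followed by the dual basis. -/
def dr : Space →L[ℝ] ℝ := (EuclideanSpace.proj (0 : Fin 2)).comp (ContinuousLinearMap.fst ℝ Plane ℝ)

def dt : Space →L[ℝ] ℝ := (EuclideanSpace.proj (1 : Fin 2)).comp (ContinuousLinearMap.fst ℝ Plane ℝ)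

def dy : Space →L[ℝ] ℝ := ContinuousLinearMap.snd ℝ Plane ℝ

def vr : Space := (EuclideanSpace.single 0 1, 0)

def vt : Space := (EuclideanSpace.single 1 1, 0)

def vy : Space := (0, 1)

theorem dr_apply (x : Space) : dr x = x.1 0 := rfl
theorem dt_apply (x : Space) : dt x = x.1 1 := rfl
theorem dy_apply (x : Space) : dy x = x.2 := rfl

@[simp] theorem dr_vr : dr vr = 1 := by simp [dr, vr]
@[simp] theorem dr_vt : dr vt = 0 := by simp [dr, vt]
@[simp] theorem dr_vy : dr vy = 0 := by simp [dr, vy]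
@[simp] theorem dt_vr : dt vr = 0 := by simp [dt, vr]
@[simp] theorem dt_vt : dt vt = 1 := by simp [dt, vt]
@[simp] theorem dt_vy : dt vy = 0 := by simp [dt, vy]
@[simp] theorem dy_vr : dy vr = 0 := by simp [dy, vr]
@[simp] theorem dy_vt : dy vt = 0 := by simp [dy, vt]
@[simp] theorem dy_vy : dy vy = 1 := by simp [dy, vy]

theorem space_eq_sum (v : Space) : v = dr v • vr + dt v • vt + dy v • vy := by
  refine Prod.ext ?_ ?_
  · ext i
    fin_cases i <;> simp [dr, dt, dy, vr, vt, vy]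
  · simp [dr, dt, dy, vr, vt, vy]

theorem space_ext {v w : Space} (h0 : dr v = dr w) (h1 : dt v = dt w) (h2 : dy v = dy w) :
    v = w := by
  rw [space_eq_sum v, space_eq_sum w, h0, h1, h2]

theorem form_eq_sum (β : Space →L[ℝ] ℝ) (v : Space) :
    β v = dr v * β vr + dt v * β vt + dy v * β vy := by
  conv_lhs => rw [space_eq_sum v]
  simp

/-- The bilinear form `dr² + dy² + a dθ²`. -/
def spaceForm (a : ℝ) : Space →L[ℝ] Space →L[ℝ] ℝ := sqForm dr + sqForm dy + a • sqForm dt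

@[simp] theorem spaceForm_apply (a : ℝ) (v w : Space) :
    spaceForm a v w = dr v * dr w + dy v * dy w + a * (dt v * dt w) := by
  simp [spaceForm]

/-- The inverse of `spaceForm a`. -/
def raise (a : ℝ) : (Space →L[ℝ] ℝ) →L[ℝ] Space :=
  (ContinuousLinearMap.apply ℝ ℝ vr).smulRight vr +
    a⁻¹ • (ContinuousLinearMap.apply ℝ ℝ vt).smulRight vt +
    (ContinuousLinearMap.apply ℝ ℝ vy).smulRight vy

theorem raise_apply (a : ℝ) (β : Space →L[ℝ] ℝ) :
    raise a β = β vr • vr + (a⁻¹ * β vt) • vt + β vy • vy := by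
  simp [raise, smul_smul]

/-- `spaceForm a` as an isomorphism. -/
def spaceEquiv {a : ℝ} (ha : a ≠ 0) : Space ≃L[ℝ] (Space →L[ℝ] ℝ) :=
  ContinuousLinearEquiv.equivOfInverse (spaceForm a) (raise a)
    (fun v => by rw [raise_apply]; apply space_ext <;> simp [ha])
    (fun β => by
      refine ContinuousLinearMap.ext fun v => ?_
      rw [form_eq_sum β v, raise_apply]
      simp
      field_simp)

theorem isInvertible_spaceForm {a : ℝ} (ha : a ≠ 0) : (spaceForm a).IsInvertible :=
  ⟨spaceEquiv ha, rfl⟩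

theorem inverse_spaceForm {a : ℝ} (ha : a ≠ 0) : (spaceForm a).inverse = raise a :=
  ContinuousLinearMap.inverse_equiv (spaceEquiv ha)

/-- The product metric in the coordinates given by the covering map. -/
def spaceMetric (x : Space) : Space →L[ℝ] Space →L[ℝ] ℝ := spaceForm (warp (dr x))

theorem coordMetric_productMetric (p : Torus × ℝ) :
    coordMetric (productMetric metric.inner) p = spaceMetric := by
  funext x
  unfold coordMetric
  rw [mfderiv_extChartAt_symm, extChartAt_symm_eq_projM]
  refine ContinuousLinearMap.ext fun v => ContinuousLinearMap.ext fun w => ?_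
  have : planeForm (warp (dr x)) v.1 w.1 + v.2 * w.2 = spaceMetric x v w := by
    simp [spaceMetric, dr_apply, dt_apply, dy_apply]
    ring
  exact this

theorem coordFun_eq (u : Torus × ℝ → ℝ) (p : Torus × ℝ) : coordFun J u p = u ∘ projM := by
  funext x
  unfold coordFun
  rw [extChartAt_symm_eq_projM]
  rfl

/-- The metric of the torus in the coordinates given by the covering map. -/
def planeMetric (x : Plane) : Plane →L[ℝ] Plane →L[ℝ] ℝ := planeForm (warp (x 0))

theorem coordMetric_metric (p : Torus) : coordMetric metric.inner p = planeMetric := by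
  funext x
  unfold coordMetric
  rw [extChartAt_symm_eq, (hasMFDerivAt_proj x).mfderiv]
  rfl

/-- The inverse of `planeForm a`. -/
def planeEquiv {a : ℝ} (ha : a ≠ 0) : Plane ≃L[ℝ] (Plane →L[ℝ] ℝ) :=
  ContinuousLinearEquiv.equivOfInverse (planeForm a)
    ((ContinuousLinearMap.apply ℝ ℝ (EuclideanSpace.single (0 : Fin 2) (1 : ℝ))).smulRight
        (EuclideanSpace.single 0 1) +
      a⁻¹ • (ContinuousLinearMap.apply ℝ ℝ (EuclideanSpace.single (1 : Fin 2) (1 : ℝ))).smulRight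
        (EuclideanSpace.single 1 1))
    (fun v => by ext i; fin_cases i <;> simp [ha])
    (fun β => by
      refine ContinuousLinearMap.ext fun v => ?_
      have hv : v = v 0 • EuclideanSpace.single 0 1 + v 1 • EuclideanSpace.single 1 1 := by
        ext i; fin_cases i <;> simp
      conv_rhs => rw [hv]
      simp
      field_simp)

/-! ### The warping function near the bubbles -/

theorem warp_eventuallyEq {r : ℝ} (hr : 0 < Real.cos r) :
    warp =ᶠ[𝓝 r] fun r => ((1 + Real.cos r) ^ 2)⁻¹ := by
  filter_upwards [Real.continuous_cos.continuousAt.eventually (lt_mem_nhds hr)] with z hz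
  rw [warp, profile_eq (by linarith), inv_pow]

theorem warp_eq {r : ℝ} (hr : 0 < Real.cos r) : warp r = ((1 + Real.cos r) ^ 2)⁻¹ :=
  (warp_eventuallyEq hr).eq_of_nhds

theorem hasDerivAt_warp {r : ℝ} (hr : 0 < Real.cos r) :
    HasDerivAt warp (2 * Real.sin r / (1 + Real.cos r) ^ 3) r := by
  refine HasDerivAt.congr_of_eventuallyEq ?_ (warp_eventuallyEq hr)
  have h1 : (1 + Real.cos r) ≠ 0 := by linarith
  have h := (((Real.hasDerivAt_cos r).const_add 1).pow 2).inv (pow_ne_zero 2 h1)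
  refine h.congr_deriv ?_
  field_simp
  simp
  ring

theorem deriv_warp_eventuallyEq {r : ℝ} (hr : 0 < Real.cos r) :
    deriv warp =ᶠ[𝓝 r] fun r => 2 * Real.sin r / (1 + Real.cos r) ^ 3 := by
  filter_upwards [Real.continuous_cos.continuousAt.eventually (lt_mem_nhds hr)] with z hz
  exact (hasDerivAt_warp hz).deriv

/-- The logarithmic derivative of the warping function is `sin r / (1 + cos r)`. -/
theorem logDeriv_warp {r : ℝ} (hr : 0 < Real.cos r) :
    deriv warp r / (2 * warp r) = Real.sin r / (1 + Real.cos r) := by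
  have h1 : (1 + Real.cos r) ≠ 0 := by linarith
  rw [(hasDerivAt_warp hr).deriv, warp_eq hr]
  field_simp

theorem hasDerivAt_logDeriv_warp {r : ℝ} (hr : 0 < Real.cos r) :
    HasDerivAt (fun r => deriv warp r / (2 * warp r)) (1 + Real.cos r)⁻¹ r := by
  have he : (fun r => deriv warp r / (2 * warp r)) =ᶠ[𝓝 r]
      fun r => Real.sin r / (1 + Real.cos r) := by
    filter_upwards [Real.continuous_cos.continuousAt.eventually (lt_mem_nhds hr)] with z hz
    exact logDeriv_warp hz
  refine HasDerivAt.congr_of_eventuallyEq ?_ he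
  have h1 : (1 + Real.cos r) ≠ 0 := by linarith
  have h := (Real.hasDerivAt_sin r).div ((Real.hasDerivAt_cos r).const_add 1) h1
  refine h.congr_deriv ?_
  field_simp
  nlinarith [Real.sin_sq_add_cos_sq r]

theorem hasDerivAt_neg_half_deriv_warp {r : ℝ} (hr : 0 < Real.cos r) :
    ∃ f', HasDerivAt (fun r => -(deriv warp r / 2)) f' r ∧ (Real.cos r = 1 → f' = -(1 / 8)) := by
  have he : (fun r => -(deriv warp r / 2)) =ᶠ[𝓝 r]
      fun r => -(2 * Real.sin r / (1 + Real.cos r) ^ 3 / 2) := by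
    filter_upwards [deriv_warp_eventuallyEq hr] with z hz
    rw [hz]
  have h1 : (1 + Real.cos r) ≠ 0 := by linarith
  have h := ((((Real.hasDerivAt_sin r).const_mul 2).div
    (((Real.hasDerivAt_cos r).const_add 1).pow 3) (pow_ne_zero 3 h1)).div_const 2).neg
  refine ⟨_, h.congr_of_eventuallyEq he, ?_⟩
  intro h2
  have h3 : Real.sin r = 0 := by nlinarith [Real.sin_sq_add_cos_sq r]
  rw [h2, h3]
  simp [h2]
  norm_num

theorem differentiable_warp : Differentiable ℝ warp := contDiff_warp.differentiable (by simp)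

theorem isInvertible_planeMetric (x : Plane) : (planeMetric x).IsInvertible :=
  ⟨planeEquiv (warp_pos _).ne', rfl⟩

/-- The Gauss curvature of the torus is negative on the circle `r = 0`. -/
theorem gaussCurvature_metric_neg : ∃ p, gaussCurvature metric.inner p < 0 := by
  refine ⟨proj 0, ?_⟩
  unfold gaussCurvature
  rw [coordMetric_metric]
  have hx := proj_extChartAt (proj 0)
  set x := extChartAt (𝓡 2) (proj 0) (proj 0)
  -- The chart at the image of 0 sends it to some lift, not necessarily 0, so the first coordinate
  -- is known only modulo 2π.
  have hc : Real.cos (x 0) = 1 := by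
    have h1 : ((x 0 : ℝ) : Real.Angle) = ((0 : ℝ) : Real.Angle) := congrArg Prod.fst hx
    have h2 := congrArg Real.Angle.cos h1
    simpa using h2
  have hr : 0 < Real.cos (x 0) := by rw [hc]; norm_num
  have hs : Real.sin (x 0) = 0 := by nlinarith [Real.sin_sq_add_cos_sq (x 0)]
  obtain ⟨f₀, hf0, hf0'⟩ := hasDerivAt_neg_half_deriv_warp hr
  have hf1 := hasDerivAt_logDeriv_warp hr
  have hcurv := curvature_warped_horizontal (G := planeMetric) (B := sqForm (EuclideanSpace.proj 0))
    (a := warp) (α₀ := EuclideanSpace.proj 0) (α₁ := EuclideanSpace.proj 1)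
    (e₀ := EuclideanSpace.single 0 1) (e₁ := EuclideanSpace.single 1 1) (x := x)
    (fun _ => rfl) isInvertible_planeMetric differentiable_warp warp_pos
    (by ext; simp) (by ext; simp) (by simp) (by simp) (by simp) (by simp) hf0 hf1
  rw [sectional, hcurv]
  have hd : deriv warp (x 0) = 0 := by rw [(hasDerivAt_warp hr).deriv, hs]; simp
  have hw : 0 < warp (x 0) := warp_pos _
  have hd' : deriv warp ((EuclideanSpace.proj (0 : Fin 2) : Plane →L[ℝ] ℝ) x) = 0 := hd
  have hpos : 0 < ((planeMetric x) (EuclideanSpace.single 0 1)) (EuclideanSpace.single 0 1) *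
      ((planeMetric x) (EuclideanSpace.single 1 1)) (EuclideanSpace.single 1 1) -
      ((planeMetric x) (EuclideanSpace.single 0 1)) (EuclideanSpace.single 1 1) ^ 2 := by
    simp [planeMetric, hw]
  refine div_neg_of_neg_of_pos ?_ hpos
  rw [hd', hf0' hc]
  simp [planeMetric]

/-! ### The extrinsic geometry of the level set `cos r = c cosh y` -/

/-- The function `c cosh y - cos r`, in coordinates. -/
def levelFun (c : ℝ) (x : Space) : ℝ := c * Real.cosh (dy x) - Real.cos (dr x)

theorem hasFDerivAt_levelFun (c : ℝ) (x : Space) :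
    HasFDerivAt (levelFun c) (Real.sin (dr x) • dr + (c * Real.sinh (dy x)) • dy) x := by
  have h1 : HasFDerivAt (fun x => Real.cosh (dy x)) (Real.sinh (dy x) • dy) x :=
    (Real.hasDerivAt_cosh _).comp_hasFDerivAt x dy.hasFDerivAt
  have h2 : HasFDerivAt (fun x => Real.cos (dr x)) (-Real.sin (dr x) • dr) x :=
    (Real.hasDerivAt_cos _).comp_hasFDerivAt x dr.hasFDerivAt
  refine ((h1.const_mul c).sub h2).congr_fderiv ?_
  ext v <;> simp <;> ring

theorem contDiff_levelFun (c : ℝ) : ContDiff ℝ ∞ (levelFun c) := by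
  have h1 : ContDiff ℝ ∞ fun x : Space => Real.cosh (dy x) :=
    Real.contDiff_cosh.comp dy.contDiff
  have h2 : ContDiff ℝ ∞ fun x : Space => Real.cos (dr x) := Real.contDiff_cos.comp dr.contDiff
  exact (contDiff_const.mul h1).sub h2

theorem inverse_spaceMetric (x : Space) : (spaceMetric x).inverse = raise (warp (dr x)) :=
  inverse_spaceForm (warp_pos _).ne'

theorem isInvertible_spaceMetric (x : Space) : (spaceMetric x).IsInvertible :=
  isInvertible_spaceForm (warp_pos _).ne'

theorem grad_levelFun (c : ℝ) (x : Space) :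
    grad spaceMetric (levelFun c) x = Real.sin (dr x) • vr + (c * Real.sinh (dy x)) • vy := by
  rw [grad, inverse_spaceMetric, (hasFDerivAt_levelFun c x).fderiv, raise_apply]
  simp

/-- The squared norm of the gradient of `levelFun c`. -/
def gradSq (c : ℝ) (x : Space) : ℝ := Real.sin (dr x) ^ 2 + (c * Real.sinh (dy x)) ^ 2

theorem normal_levelFun (c : ℝ) (x : Space) :
    normal spaceMetric (levelFun c) x =
      (Real.sqrt (gradSq c x))⁻¹ • (Real.sin (dr x) • vr + (c * Real.sinh (dy x)) • vy) := by
  rw [normal, grad_levelFun]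
  congr 3
  simp [spaceMetric, gradSq]
  ring

theorem hasFDerivAt_gradSq (c : ℝ) (x : Space) :
    HasFDerivAt (gradSq c) ((2 * Real.sin (dr x) * Real.cos (dr x)) • dr +
      (2 * (c * Real.sinh (dy x)) * (c * Real.cosh (dy x))) • dy) x := by
  have h1 : HasFDerivAt (fun x => Real.sinh (dy x)) (Real.cosh (dy x) • dy) x :=
    (Real.hasDerivAt_sinh _).comp_hasFDerivAt x dy.hasFDerivAt
  have h2 : HasFDerivAt (fun x => Real.sin (dr x)) (Real.cos (dr x) • dr) x :=
    (Real.hasDerivAt_sin _).comp_hasFDerivAt x dr.hasFDerivAt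
  refine ((h2.pow 2).add ((h1.const_mul c).pow 2)).congr_fderiv ?_
  ext v <;> simp <;> ring

section Point

variable {c s : ℝ} {x : Space}

/-- The gradient has constant length s along the level set: 1 - cos² r + c² cosh² y - c² = 1 - c².
-/
theorem gradSq_eq (hsc : s ^ 2 = 1 - c ^ 2)
    (hx : c * Real.cosh (dy x) = Real.cos (dr x)) : gradSq c x = s ^ 2 := by
  rw [gradSq, hsc, mul_pow, Real.sinh_sq, Real.sin_sq, ← hx]
  ring

theorem normal_eq (hs : 0 < s) (hsc : s ^ 2 = 1 - c ^ 2)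
    (hx : c * Real.cosh (dy x) = Real.cos (dr x)) :
     normal spaceMetric (levelFun c) x =
    (Real.sin (dr x) / s) • vr + (c * Real.sinh (dy x) / s) • vy := by
  rw [normal_levelFun, gradSq_eq hsc hx, Real.sqrt_sq hs.le, smul_add, smul_smul, smul_smul]
  congr 2 <;> ring

/-- In the (r, y)-plane the Hessian of `levelFun c` is diag(cos r, c cosh y), which on the level set
is cos r times the identity. Normalizing the gradient, of length s, projects this to (cos r/s) T ⊗
T, where T is the unit tangent of the level curve. -/
theorem fderiv_normal_eq (hs : 0 < s) (hsc : s ^ 2 = 1 - c ^ 2)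
    (hx : c * Real.cosh (dy x) = Real.cos (dr x)) :
     fderiv ℝ (normal spaceMetric (levelFun c)) x =
    (Real.cos (dr x) / s) • ((-(c * Real.sinh (dy x) / s)) • dr + (Real.sin (dr x) / s) • dy).smulRight
      ((-(c * Real.sinh (dy x) / s)) • vr + (Real.sin (dr x) / s) • vy) := by
  have hg := gradSq_eq hsc hx
  have h1 : HasFDerivAt (fun x => Real.sinh (dy x)) (Real.cosh (dy x) • dy) x :=
    (Real.hasDerivAt_sinh _).comp_hasFDerivAt x dy.hasFDerivAt
  have h2 : HasFDerivAt (fun x => Real.sin (dr x)) (Real.cos (dr x) • dr) x :=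
    (Real.hasDerivAt_sin _).comp_hasFDerivAt x dr.hasFDerivAt
  have h3 := (h2.smul_const vr).add ((h1.const_mul c).smul_const vy)
  have hd : HasDerivAt (fun t => (Real.sqrt t)⁻¹) (-(2 * s)⁻¹ / s ^ 2) (gradSq c x) := by
    have h := (Real.hasDerivAt_sqrt (x := gradSq c x) (by rw [hg]; positivity)).inv
      (by rw [hg, Real.sqrt_sq hs.le]; exact hs.ne')
    rw [hg, Real.sqrt_sq hs.le] at h
    rw [hg]
    refine h.congr_deriv ?_
    ring
  have h4 : HasFDerivAt (fun x => (Real.sqrt (gradSq c x))⁻¹) _ x :=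
    hd.comp_hasFDerivAt x (hasFDerivAt_gradSq c x)
  have h5 := h4.smul h3
  have h6 : normal spaceMetric (levelFun c) = fun x => (Real.sqrt (gradSq c x))⁻¹ •
      (Real.sin (dr x) • vr + (c * Real.sinh (dy x)) • vy) := funext (normal_levelFun c)
  rw [h6]
  -- The unit length of the normal, in the form used to eliminate sin² r.
  have hq : Real.sin (dr x) ^ 2 = s ^ 2 - (c * Real.sinh (dy x)) ^ 2 := by
    rw [← hg, gradSq]; ring
  refine (h5.congr_fderiv ?_).fderiv
  refine ContinuousLinearMap.ext fun v => ?_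
  simp only [hg, Real.sqrt_sq hs.le, hx]
  set S := Real.sin (dr x)
  set T := c * Real.sinh (dy x)
  apply space_ext <;> simp [hx, ← mul_assoc] <;> field_simp
  · linear_combination (-Real.cos (dr x) * dr v) * hq
  · linear_combination (-Real.cos (dr x) * dy v) * hq
/-- The tangent vector `-n_y ∂_r + n_r ∂_y` of the level curve, up to normalization. -/
def tangentVec (a b : ℝ) : Space := (-b) • vr + a • vy

/-- The linear form dual to `tangentVec`. -/
def tangentForm (a b : ℝ) : Space →L[ℝ] ℝ := (-b) • dr + a • dy

theorem christoffel_spaceMetric (x : Space) :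
    christoffel spaceMetric x = (-(deriv warp (dr x) / 2)) • tensor dt dt vr +
      (deriv warp (dr x) / (2 * warp (dr x))) • (tensor dr dt vt + tensor dt dr vt) :=
  christoffel_warped (B := sqForm dr + sqForm dy) (fun _ => rfl) isInvertible_spaceMetric
    differentiable_warp warp_pos (by ext <;> simp) (by ext <;> simp) (by simp) (by simp) x

theorem sq_add_sq_eq_one (hs : 0 < s) (hsc : s ^ 2 = 1 - c ^ 2)
    (hx : c * Real.cosh (dy x) = Real.cos (dr x)) :
    (Real.sin (dr x) / s) ^ 2 + (c * Real.sinh (dy x) / s) ^ 2 = 1 := by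
  have h := gradSq_eq hsc hx
  rw [gradSq] at h
  rw [div_pow, div_pow, ← add_div, h, div_self (by positivity)]

/-- The derivative of the normal gives the curvature cos r/s of the generating curve. The
Christoffel term gives ν_r φ'/φ = sin² r/(s(1 + cos r)) = (1 - cos r)/s in the θ direction; this
identity is the reason for the choice of φ. -/
theorem shape_comp_tangentialProj (hs : 0 < s) (hsc : s ^ 2 = 1 - c ^ 2)
    (hx : c * Real.cosh (dy x) = Real.cos (dr x)) (hr : 0 < Real.cos (dr x)) {n₀ n₂ : ℝ}
    (hn0 : Real.sin (dr x) / s = n₀) (hn2 : c * Real.sinh (dy x) / s = n₂) :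
    (shape spaceMetric (levelFun c) x).comp (tangentialProj spaceMetric (levelFun c) x) =
      (Real.cos (dr x) / s) • (tangentForm n₀ n₂).smulRight (tangentVec n₀ n₂) +
      ((1 - Real.cos (dr x)) / s) • dt.smulRight vt := by
  have h1 := sq_add_sq_eq_one hs hsc hx
  have hl : deriv warp (dr x) / (2 * warp (dr x)) * n₀ = (1 - Real.cos (dr x)) / s := by
    have h3 : 1 + Real.cos (dr x) ≠ 0 := by linarith
    rw [logDeriv_warp hr, ← hn0]
    field_simp
    rw [Real.sin_sq]
    ring
  rw [shape, fderiv_normal_eq hs hsc hx, christoffel_spaceMetric, tangentialProj,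
    normal_eq hs hsc hx]
  rw [← hl]
  rw [hn0, hn2] at *
  refine ContinuousLinearMap.ext fun v => ?_
  apply space_ext
  · simp [spaceMetric, tangentForm, tangentVec]
    exact Or.inr (Or.inl (by ring))
  · simp [spaceMetric, tangentForm, tangentVec]
    ring
  · simp [spaceMetric, tangentForm, tangentVec]
    exact Or.inr (Or.inl (by ring))

theorem traceShape_levelFun (hs : 0 < s) (hsc : s ^ 2 = 1 - c ^ 2)
    (hx : c * Real.cosh (dy x) = Real.cos (dr x)) (hr : 0 < Real.cos (dr x)) :
    traceShape spaceMetric (levelFun c) x = 1 / s := by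
  have h1 := sq_add_sq_eq_one hs hsc hx
  rw [traceShape, shape_comp_tangentialProj hs hsc hx hr rfl rfl]
  rw [ContinuousLinearMap.toLinearMap_add, ContinuousLinearMap.toLinearMap_smul,
    ContinuousLinearMap.toLinearMap_smul, map_add, map_smul, map_smul, trace_smulRight,
    trace_smulRight]
  simp [tangentForm, tangentVec]
  linear_combination (Real.cos (dr x) / s) * h1

theorem normSqShape_levelFun (hs : 0 < s) (hsc : s ^ 2 = 1 - c ^ 2)
    (hx : c * Real.cosh (dy x) = Real.cos (dr x)) (hr : 0 < Real.cos (dr x)) :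
    normSqShape spaceMetric (levelFun c) x =
      (Real.cos (dr x) / s) ^ 2 + ((1 - Real.cos (dr x)) / s) ^ 2 := by
  have h1 := sq_add_sq_eq_one hs hsc hx
  set n₀ := Real.sin (dr x) / s with hn0
  set n₂ := c * Real.sinh (dy x) / s with hn2
  have h2 : tangentForm n₀ n₂ (tangentVec n₀ n₂) = 1 := by
    simp [tangentForm, tangentVec]; linarith
  have h3 : tangentForm n₀ n₂ vt = 0 := by simp [tangentForm]
  have h4 : dt (tangentVec n₀ n₂) = 0 := by simp [tangentVec]
  rw [normSqShape, shape_comp_tangentialProj hs hsc hx hr hn0.symm hn2.symm]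
  have h5 : ((Real.cos (dr x) / s) • (tangentForm n₀ n₂).smulRight (tangentVec n₀ n₂) +
      ((1 - Real.cos (dr x)) / s) • dt.smulRight vt).comp
      ((Real.cos (dr x) / s) • (tangentForm n₀ n₂).smulRight (tangentVec n₀ n₂) +
      ((1 - Real.cos (dr x)) / s) • dt.smulRight vt) =
      ((Real.cos (dr x) / s) ^ 2) • (tangentForm n₀ n₂).smulRight (tangentVec n₀ n₂) +
      (((1 - Real.cos (dr x)) / s) ^ 2) • dt.smulRight vt := by
    refine ContinuousLinearMap.ext fun v => ?_
    simp [h2, h3, h4, smul_smul]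
    module
  rw [h5, ContinuousLinearMap.toLinearMap_add, ContinuousLinearMap.toLinearMap_smul,
    ContinuousLinearMap.toLinearMap_smul, map_add, map_smul, map_smul, trace_smulRight,
    trace_smulRight, h2]
  simp

/-- The product is flat in the (r, y)-directions, so only the plane spanned by ν and ∂_θ
contributes, with -(φ''/φ) ν_r². -/
theorem ricci_normal (hs : 0 < s) (hsc : s ^ 2 = 1 - c ^ 2)
    (hx : c * Real.cosh (dy x) = Real.cos (dr x)) (hr : 0 < Real.cos (dr x)) :
    ricci spaceMetric x (normal spaceMetric (levelFun c) x) (normal spaceMetric (levelFun c) x) =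
      -((1 + Real.cos (dr x))⁻¹ + (Real.sin (dr x) / (1 + Real.cos (dr x))) ^ 2) *
        (Real.sin (dr x) / s) ^ 2 := by
  obtain ⟨f₀, hf0, -⟩ := hasDerivAt_neg_half_deriv_warp hr
  have hf1 := hasDerivAt_logDeriv_warp hr
  have hv : dt (normal spaceMetric (levelFun c) x) = 0 := by simp [normal_eq hs hsc hx]
  rw [ricci, curvature_warped_orthogonal (G := spaceMetric) (B := sqForm dr + sqForm dy)
    (fun _ => rfl) isInvertible_spaceMetric
    differentiable_warp warp_pos (e₀ := vr) (e₁ := vt) (by ext <;> simp) (by ext <;> simp) (by simp)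
    (by simp) hf0 hf1 hv, trace_smulRight, logDeriv_warp hr, normal_eq hs hsc hx]
  simp

/-- The potential of the Jacobi operator. -/
theorem potential_levelFun (hs : 0 < s) (hsc : s ^ 2 = 1 - c ^ 2)
    (hx : c * Real.cosh (dy x) = Real.cos (dr x)) (hr : 0 < Real.cos (dr x)) :
    -ricci spaceMetric x (normal spaceMetric (levelFun c) x) (normal spaceMetric (levelFun c) x)
      - normSqShape spaceMetric (levelFun c) x =
      (1 - Real.cos (dr x) - Real.cos (dr x) ^ 2) / s ^ 2 := by
  rw [ricci_normal hs hsc hx hr, normSqShape_levelFun hs hsc hx hr]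
  have h3 : 1 + Real.cos (dr x) ≠ 0 := by linarith
  have h4 := Real.sin_sq (dr x)
  field_simp
  set C := Real.cos (dr x)
  rw [h4]
  ring

/-- The level set has an orthogonal tangent frame consisting of the unit tangent of the generating
curve and ∂_θ; the factor (1 + cos r)² is 1/φ². -/
theorem tangentialGradSq_levelFun (hs : 0 < s) (hsc : s ^ 2 = 1 - c ^ 2)
    (hx : c * Real.cosh (dy x) = Real.cos (dr x)) (hr : 0 < Real.cos (dr x)) (u : Space → ℝ) :
    tangentialGradSq spaceMetric (levelFun c) u x =
      (fderiv ℝ u x (tangentVec (Real.sin (dr x) / s) (c * Real.sinh (dy x) / s))) ^ 2 +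
      (1 + Real.cos (dr x)) ^ 2 * (fderiv ℝ u x vt) ^ 2 := by
  have h1 := sq_add_sq_eq_one hs hsc hx
  rw [tangentialGradSq, grad, inverse_spaceMetric, raise_apply, tangentialProj,
    normal_eq hs hsc hx]
  set n₀ := Real.sin (dr x) / s with hn0
  set n₂ := c * Real.sinh (dy x) / s with hn2
  have h3 : 1 + Real.cos (dr x) ≠ 0 := by linarith
  have hw := warp_eq hr
  simp only [spaceMetric, tangentVec, hw, inv_inv]
  simp
  set D := fderiv ℝ u x
  rw [inv_mul_cancel_left₀ (pow_ne_zero 2 h3)]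
  linear_combination (-(D vr ^ 2 + D vy ^ 2) + (n₀ * D vr + n₂ * D vy) ^ 2) * h1

end Point

/-! ### The bubbles -/

/-- The cosine of the first coordinate on the torus. -/
def cosT (p : Torus) : ℝ := Real.cos_periodic.lift p.1

@[simp] theorem cosT_proj (x : Plane) : cosT (proj x) = Real.cos (x 0) := rfl

theorem continuous_cosT : Continuous cosT := by
  have : Continuous (Real.cos_periodic.lift : AddCircle (2 * Real.pi) → ℝ) :=
    continuous_coinduced_dom.mpr Real.continuous_cos
  exact this.comp continuous_fst

/-- The defining function `c cosh y - cos r` on `Torus × ℝ`. -/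
def level (c : ℝ) (q : Torus × ℝ) : ℝ := c * Real.cosh q.2 - cosT q.1

theorem level_projM (c : ℝ) (x : Space) : level c (projM x) = levelFun c x := rfl

theorem level_comp_projM (c : ℝ) : level c ∘ projM = levelFun c := rfl

theorem continuous_level (c : ℝ) : Continuous (level c) :=
  (continuous_const.mul (Real.continuous_cosh.comp continuous_snd)).sub
    (continuous_cosT.comp continuous_fst)

theorem contMDiff_level (c : ℝ) : ContMDiff J 𝓘(ℝ, ℝ) ∞ (level c) :=
  contMDiff_of_comp_projM (contDiff_levelFun c).contMDiff

/-- Every point of the torus has a lift with first coordinate in `[-π, π]`. -/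
theorem exists_lift_mem_Icc (q : Torus × ℝ) :
    ∃ x : Space, projM x = q ∧ dr x ∈ Icc (-Real.pi) Real.pi := by
  obtain ⟨x, rfl⟩ := projM_surjective q
  refine ⟨(!₂[toIocMod Real.two_pi_pos (-Real.pi) (dr x), dt x], dy x), ?_, ?_⟩
  · refine Prod.ext (Prod.ext ?_ rfl) rfl
    change ((toIocMod Real.two_pi_pos (-Real.pi) (dr x) : ℝ) : AddCircle (2 * Real.pi)) = (dr x : ℝ)
    exact (Real.Angle.coe_toIocMod (dr x) (-Real.pi))
  · have h := toIocMod_mem_Ioc Real.two_pi_pos (-Real.pi) (dr x)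
    change toIocMod Real.two_pi_pos (-Real.pi) (dr x) ∈ _
    exact ⟨h.1.le, by linarith [h.2]⟩

theorem abs_lt_of_cos_pos {r : ℝ} (hr : r ∈ Icc (-Real.pi) Real.pi) (h : 0 < Real.cos r) :
    |r| < Real.pi / 2 := by
  by_contra! h2
  have h3 : Real.cos |r| ≤ 0 := Real.cos_nonpos_of_pi_div_two_le_of_le h2
    (by have := abs_le.2 hr; linarith [Real.pi_pos])
  rw [Real.cos_abs] at h3
  linarith

/-- The function `cos r - c cosh y` increases towards the circle `r = y = 0`. -/
theorem levelFun_smul_le {c t : ℝ} (hc : 0 ≤ c) (ht : t ∈ Icc (0 : ℝ) 1) {x : Space}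
    (hx : |dr x| ≤ Real.pi / 2) : levelFun c (t • x) ≤ levelFun c x := by
  have h1 : Real.cosh (dy (t • x)) ≤ Real.cosh (dy x) := by
    rw [Real.cosh_le_cosh, map_smul, smul_eq_mul, abs_mul, abs_of_nonneg ht.1]
    exact mul_le_of_le_one_left (abs_nonneg _) ht.2
  have h2 : Real.cos (dr x) ≤ Real.cos (dr (t • x)) := by
    rw [← Real.cos_abs (dr x), ← Real.cos_abs (dr (t • x))]
    apply Real.cos_le_cos_of_nonneg_of_le_pi (abs_nonneg _) (by linarith [Real.pi_pos])
    rw [map_smul, smul_eq_mul, abs_mul, abs_of_nonneg ht.1]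
    exact mul_le_of_le_one_left (abs_nonneg _) ht.2
  unfold levelFun
  have := mul_le_mul_of_nonneg_left h1 hc
  linarith

/-- On the level set at least one of r, y is nonzero because c < 1, so shrinking towards 0 strictly
increases cos r or strictly decreases cosh y. -/
theorem levelFun_smul_lt {c t : ℝ} (hc : 0 < c) (hc1 : c < 1) (ht : t ∈ Ico (0 : ℝ) 1) {x : Space}
    (hx : |dr x| ≤ Real.pi / 2) (h0 : levelFun c x = 0) : levelFun c (t • x) < 0 := by
  by_cases hy : dy x = 0
  · have hr : dr x ≠ 0 := by
      intro hr
      simp [levelFun, hy, hr] at h0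
      linarith
    have h1 : dy (t • x) = 0 := by simp [hy]
    rw [← h0, levelFun, levelFun, h1, hy, ← Real.cos_abs (dr x), ← Real.cos_abs (dr (t • x))]
    apply sub_lt_sub_left
    apply Real.cos_lt_cos_of_nonneg_of_le_pi (abs_nonneg _) (by linarith [Real.pi_pos])
    rw [map_smul, smul_eq_mul, abs_mul, abs_of_nonneg ht.1]
    exact mul_lt_of_lt_one_left (abs_pos.2 hr) ht.2
  · have h1 : Real.cosh (dy (t • x)) < Real.cosh (dy x) := by
      rw [Real.cosh_lt_cosh, map_smul, smul_eq_mul, abs_mul, abs_of_nonneg ht.1]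
      exact mul_lt_of_lt_one_left (abs_pos.2 hy) ht.2
    have h2 : Real.cos (dr x) ≤ Real.cos (dr (t • x)) := by
      rw [← Real.cos_abs (dr x), ← Real.cos_abs (dr (t • x))]
      apply Real.cos_le_cos_of_nonneg_of_le_pi (abs_nonneg _) (by linarith [Real.pi_pos])
      rw [map_smul, smul_eq_mul, abs_mul, abs_of_nonneg ht.1]
      exact mul_le_of_le_one_left (abs_nonneg _) ht.2.le
    rw [← h0]
    unfold levelFun
    have := mul_lt_mul_of_pos_left h1 hc
    linarith

theorem cos_pos_of_levelFun_nonpos {c : ℝ} (hc : 0 < c) {x : Space} (h : levelFun c x ≤ 0) :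
    0 < Real.cos (dr x) := by
  have := mul_pos hc (Real.cosh_pos (dy x))
  unfold levelFun at h
  linarith

/-- Points of the zero level are limits of points of the domain along the segment towards 0 in the
cover. -/
theorem frontier_level {c : ℝ} (hc : 0 < c) (hc1 : c < 1) :
    frontier {q | level c q < 0} = {q | level c q = 0} := by
  apply Subset.antisymm (frontier_lt_subset_eq (continuous_level c) continuous_const)
  intro q hq
  have hq' : level c q = 0 := hq
  rw [(isOpen_lt (continuous_level c) continuous_const).frontier_eq]
  refine ⟨?_, fun h => by have : level c q < 0 := h; linarith⟩
  obtain ⟨x, rfl, hx⟩ := exists_lift_mem_Icc q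
  rw [level_projM] at hq'
  have hx' := (abs_lt_of_cos_pos hx (cos_pos_of_levelFun_nonpos hc hq'.le)).le
  have h1 : Tendsto (fun t : ℝ => projM (t • x)) (𝓝[<] 1) (𝓝 (projM x)) := by
    have h2 : Continuous fun t : ℝ => projM (t • x) := continuous_projM.comp (by fun_prop)
    have h3 := h2.tendsto 1
    rw [one_smul] at h3
    exact h3.mono_left nhdsWithin_le_nhds
  refine mem_closure_of_tendsto h1 ?_
  filter_upwards [Ioo_mem_nhdsLT (zero_lt_one (α := ℝ))] with t ht
  exact levelFun_smul_lt hc hc1 ⟨ht.1.le, ht.2⟩ hx' hq'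

/-- The domain is the image of a subset of the covering space that is star-shaped about 0. -/
theorem isConnected_level {c : ℝ} (hc : 0 < c) (hc1 : c < 1) :
    IsConnected {q | level c q < 0} := by
  set D : Set Space := {x | |dr x| ≤ Real.pi / 2 ∧ levelFun c x < 0}
  have h0 : (0 : Space) ∈ D := by
    refine ⟨by simpa using Real.pi_div_two_pos.le, ?_⟩
    simp [levelFun, hc1]
  have hstar : StarConvex ℝ 0 D := by
    rw [starConvex_zero_iff]
    intro x hx t ht0 ht1
    refine ⟨?_, (levelFun_smul_le hc.le ⟨ht0, ht1⟩ hx.1).trans_lt hx.2⟩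
    rw [map_smul, smul_eq_mul, abs_mul, abs_of_nonneg ht0]
    exact (mul_le_of_le_one_left (abs_nonneg _) ht1).trans hx.1
  have himg : projM '' D = {q | level c q < 0} := by
    ext q
    constructor
    · rintro ⟨x, hx, rfl⟩
      exact hx.2
    · intro hq
      obtain ⟨x, rfl, hx⟩ := exists_lift_mem_Icc q
      have hq' : levelFun c x < 0 := hq
      exact ⟨x, ⟨(abs_lt_of_cos_pos hx (cos_pos_of_levelFun_nonpos hc hq'.le)).le, hq'⟩, rfl⟩
  rw [← himg]
  exact (hstar.isPathConnected h0).isConnected.image _ continuous_projM.continuousOn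

/-- From |y| ≤ sinh |y| < cosh y < 1/c the height is bounded, and the torus is compact. -/
theorem isCompact_closure_level {c : ℝ} (hc : 0 < c) :
    IsCompact (closure {q | level c q < 0}) := by
  have hK : IsCompact ((univ : Set Torus) ×ˢ Icc (-(1 / c)) (1 / c)) :=
    isCompact_univ.prod isCompact_Icc
  refine hK.of_isClosed_subset isClosed_closure (closure_minimal ?_ hK.isClosed)
  rintro ⟨p, y⟩ h
  refine ⟨mem_univ _, ?_⟩
  have h1 : level c (p, y) < 0 := h
  obtain ⟨x, rfl⟩ := proj_surjective p
  have h2 : c * Real.cosh y < 1 := by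
    have : c * Real.cosh y - Real.cos (x 0) < 0 := h1
    linarith [Real.cos_le_one (x 0)]
  have h3 : |y| ≤ Real.cosh y := by
    rw [← Real.cosh_abs]
    have h4 := Real.self_le_sinh_iff.2 (abs_nonneg y)
    exact h4.trans (Real.sinh_lt_cosh _).le
  have h5 : |y| ≤ 1 / c := by
    rw [le_div_iff₀ hc]; nlinarith
  exact abs_le.1 h5

/-- The constant `s = √(1 - c²)`. -/
def sinC (c : ℝ) : ℝ := Real.sqrt (1 - c ^ 2)

theorem sinC_pos {c : ℝ} (hc : 0 < c) (hc1 : c < 1) : 0 < sinC c :=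
  Real.sqrt_pos.2 (by nlinarith)

theorem sinC_sq {c : ℝ} (hc : 0 < c) (hc1 : c < 1) : sinC c ^ 2 = 1 - c ^ 2 :=
  Real.sq_sqrt (by nlinarith)

theorem sinC_lt_one {c : ℝ} (hc : 0 < c) (hc1 : c < 1) : sinC c < 1 := by
  have := sinC_sq hc hc1
  nlinarith [sinC_pos hc hc1]

theorem levelFun_eq_zero_iff {c : ℝ} {x : Space} :
    levelFun c x = 0 ↔ c * Real.cosh (dy x) = Real.cos (dr x) := sub_eq_zero

theorem levelFun_extChartAt {c : ℝ} {p : Torus × ℝ} (hp : level c p = 0) :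
    levelFun c (extChartAt J p p) = 0 := by
  rw [← level_projM, projM_extChartAt, hp]

/-- The bubble `cos r = c cosh y`. -/
def bubble (c : ℝ) (hc : 0 < c) (hc1 : c < 1) : SoapBubble (productMetric metric.inner) where
  domain := {q | level c q < 0}
  rho := level c
  meanCurv := 1 / sinC c
  isConnected := isConnected_level hc hc1
  isCompact_closure := isCompact_closure_level hc
  contMDiff_rho := contMDiff_level c
  domain_eq := rfl
  regular := by
    intro p hp h0
    rw [frontier_level hc hc1] at hp
    have hx := levelFun_extChartAt hp
    set x : Space := extChartAt J p p with hxdef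
    have hpx : projM x = p := projM_extChartAt p
    have h1 : MDifferentiableAt J 𝓘(ℝ, ℝ) (level c) (projM x) :=
      (contMDiff_level c).mdifferentiableAt (by simp)
    rw [hpx] at h1
    have h2 : HasFDerivAt (levelFun c) (0 : Space →L[ℝ] ℝ) x := by
      have h := h1.hasMFDerivAt
      rw [h0, ← hpx] at h
      exact hasMFDerivAt_iff_hasFDerivAt.1 (HasMFDerivAt.comp x h (hasMFDerivAt_projM x))
    have h3 := h2.unique (hasFDerivAt_levelFun c x)
    have h4 : 0 = Real.sin (dr x) := by simpa using DFunLike.congr_fun h3 vr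
    have h5 : 0 = c * Real.sinh (dy x) := by simpa using DFunLike.congr_fun h3 vy
    have h6 := gradSq_eq (sinC_sq hc hc1) (levelFun_eq_zero_iff.1 hx)
    rw [gradSq, ← h4, ← h5] at h6
    have := pow_pos (sinC_pos hc hc1) 2
    linarith
  meanCurv_eq := by
    intro p hp
    rw [frontier_level hc hc1] at hp
    have hx := levelFun_extChartAt hp
    rw [coordMetric_productMetric, coordFun_eq, level_comp_projM]
    exact traceShape_levelFun (sinC_pos hc hc1) (sinC_sq hc hc1) (levelFun_eq_zero_iff.1 hx)
      (cos_pos_of_levelFun_nonpos hc hx.le)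

/-! ### Riemannian measures -/

theorem map_withDensity_comp {α β : Type*} [MeasurableSpace α] [MeasurableSpace β] {μ : Measure α}
    {ν : Measure β} {q : α → β} (hq : MeasurePreserving q μ ν) {d : β → ENNReal}
    (hd : Measurable d) : (μ.withDensity (d ∘ q)).map q = ν.withDensity d := by
  ext A hA
  rw [Measure.map_apply hq.measurable hA, withDensity_apply _ (hq.measurable hA),
    withDensity_apply _ hA, ← hq.map_eq, setLIntegral_map hA hd hq.measurable]
  rfl

/-- An open set on which the map `q` is a measure preserving open embedding around a preimage
of `y`. -/
structure IsSheet {k : ℕ} {Y : Type*} [TopologicalSpace Y] [MeasurableSpace Y] (ν : Measure Y)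
    (q : EuclideanSpace ℝ (Fin k) → Y) (y : Y) (U : Set (EuclideanSpace ℝ (Fin k))) : Prop where
  isOpen : IsOpen U
  mem_image : y ∈ q '' U
  isOpenEmbedding : IsOpenEmbedding (U.domRestrict q)
  measurePreserving : MeasurePreserving q (volume.restrict U) ν

/-- The Riemannian measure of the image of an embedding `Ψ : Y → M`, where `Y` is covered by a
locally injective, measure preserving map `q`. -/
theorem isRiemannianMeasure_map {E : Type*} [NormedAddCommGroup E] [NormedSpace ℝ E]
    {H : Type*} [TopologicalSpace H] {I : ModelWithCorners ℝ E H}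
    {M : Type*} [TopologicalSpace M] [ChartedSpace H M] [IsManifold I ∞ M] [MeasurableSpace M]
    (g : MetricField I M) {k : ℕ} {Y : Type*} [TopologicalSpace Y] [MeasurableSpace Y]
    [BorelSpace Y] {ν : Measure Y} {q : EuclideanSpace ℝ (Fin k) → Y}
    (hq : ∀ y, ∃ U, IsSheet ν q y U) {Ψ : Y → M} (hΨ : IsEmbedding Ψ)
    (hΨm : MeasurableEmbedding Ψ) (hsmooth : ContMDiff (𝓡 k) I ∞ (Ψ ∘ q))
    (himm : ∀ x, Function.Injective (mfderiv (𝓡 k) I (Ψ ∘ q) x)) {d : Y → ℝ} (hd : Measurable d)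
    (hgram : ∀ x, Real.sqrt (gram g (Ψ ∘ q) x).det = d (q x)) :
    IsRiemannianMeasure g k (range Ψ)
      ((ν.withDensity fun y => ENNReal.ofReal (d y)).map Ψ) := by
  refine ⟨?_, ?_⟩
  · have h : Ψ ⁻¹' (range Ψ)ᶜ = ∅ := by ext y; simp
    rw [hΨm.map_apply, h, measure_empty]
  · rintro _ ⟨y, rfl⟩
    obtain ⟨U, hU⟩ := hq y
    have himage : IsOpen (q '' U) := by
      have := hU.isOpenEmbedding.isOpen_range
      rwa [range_domRestrict] at this
    refine ⟨U, Ψ ∘ q, ⟨hU.isOpen, hsmooth.contMDiffOn, fun x _ => himm x, ?_, ?_⟩, ?_, ?_⟩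
    · exact hΨ.comp hU.isOpenEmbedding.isEmbedding
    · obtain ⟨W, hW, hWU⟩ := hΨ.isInducing.isOpen_iff.1 himage
      refine ⟨W, hW, ?_⟩
      rw [image_comp, ← hWU, image_preimage_eq_range_inter]
    · rw [image_comp]
      exact mem_image_of_mem _ hU.mem_image
    · have hdm : Measurable fun y => ENNReal.ofReal (d y) := hd.ennreal_ofReal
      -- Since q pushes the volume of U to all of ν, a single sheet has full measure.
      have hnull : ν (q '' U)ᶜ = 0 := by
        rw [← hU.measurePreserving.measure_preimage himage.measurableSet.compl.nullMeasurableSet]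
        rw [Measure.restrict_apply
          (hU.measurePreserving.measurable himage.measurableSet.compl)]
        have h : q ⁻¹' (q '' U)ᶜ ∩ U = ∅ := by
          ext x
          simp only [mem_inter_iff, mem_preimage, mem_compl_iff, mem_image, not_exists, not_and,
            mem_empty_iff_false, iff_false]
          exact fun hx hxU => hx x hxU rfl
        rw [h, measure_empty]
      -- Hence restricting to the image of one sheet changes nothing, and the local formula becomes
      -- a global one.
      have hfull : ((ν.withDensity fun y => ENNReal.ofReal (d y)).map Ψ).restrict (Ψ ∘ q '' U) =
          (ν.withDensity fun y => ENNReal.ofReal (d y)).map Ψ := by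
        apply Measure.restrict_eq_self_of_ae_mem
        rw [ae_iff, hΨm.map_apply]
        refine withDensity_absolutelyContinuous _ _ (measure_mono_null ?_ hnull)
        rintro z hz ⟨x, hx, rfl⟩
        exact hz ⟨x, hx, rfl⟩
      have hden : (fun x => ENNReal.ofReal (Real.sqrt (gram g (Ψ ∘ q) x).det)) =
          (fun y => ENNReal.ofReal (d y)) ∘ q := by
        funext x
        rw [hgram x]
        rfl
      rw [hfull, hden, ← Measure.map_map hΨm.measurable hU.measurePreserving.measurable,
        map_withDensity_comp hU.measurePreserving hdm]

theorem measurePreserving_coords : MeasurePreserving coords volume volume :=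
  (volume_preserving_finTwoArrow ℝ).comp (PiLp.volume_preserving_ofLp (Fin 2))

theorem measurePreserving_coe_Ioo (T : ℝ) [hT : Fact (0 < T)] (a : ℝ) :
    MeasurePreserving ((↑) : ℝ → AddCircle T) (volume.restrict (Ioo a (a + T))) volume := by
  rw [Measure.restrict_congr_set Ioo_ae_eq_Ioc]
  exact AddCircle.measurePreserving_mk T a

/-- The open box is a fundamental domain up to a null set, as it has the full side lengths 2π and 1.
-/
theorem measurePreserving_proj (a : ℝ × ℝ) :
    MeasurePreserving proj (volume.restrict (box a).source) volume := by
  have h1 := (measurePreserving_coe_Ioo (2 * Real.pi) a.1).prod (measurePreserving_coe_Ioo 1 a.2)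
  rw [Measure.prod_restrict] at h1
  have h2 := measurePreserving_coords.restrict_preimage
    (s := Ioo a.1 (a.1 + 2 * Real.pi) ×ˢ Ioo a.2 (a.2 + 1))
    (measurableSet_Ioo.prod measurableSet_Ioo)
  have h3 : (box a).source =
      coords ⁻¹' (Ioo a.1 (a.1 + 2 * Real.pi) ×ˢ Ioo a.2 (a.2 + 1)) := by
    ext x
    rw [mem_box_source]
    rfl
  rw [h3]
  exact h1.comp h2

theorem isSheet_proj (p : Torus) : ∃ U, IsSheet (volume : Measure Torus) proj p U :=
  ⟨(box (corner p)).source, (box (corner p)).open_source, ⟨lift p, lift_mem_box p, proj_lift p⟩,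
    (box (corner p)).isOpenEmbedding_restrict, measurePreserving_proj _⟩

/-- The linear isomorphism `(z₀, z₁, z₂) ↦ ((z₀, z₁), z₂)`. -/
def assoc : EuclideanSpace ℝ (Fin 3) ≃L[ℝ] Space :=
  LinearEquiv.toContinuousLinearEquiv
    { toFun := fun z => (!₂[z 0, z 1], z 2)
      invFun := fun x => !₂[x.1 0, x.1 1, x.2]
      map_add' := fun z w => by
        refine Prod.ext ?_ rfl
        ext i; fin_cases i <;> simp
      map_smul' := fun t z => by
        refine Prod.ext ?_ rfl
        ext i; fin_cases i <;> simp
      left_inv := fun z => by ext i; fin_cases i <;> simp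
      right_inv := fun x => by
        refine Prod.ext ?_ rfl
        ext i; fin_cases i <;> simp }

theorem assoc_apply (z : EuclideanSpace ℝ (Fin 3)) : assoc z = (!₂[z 0, z 1], z 2) := rfl

theorem measurePreserving_assoc : MeasurePreserving assoc volume volume := by
  have h1 := (volume_preserving_piFinSuccAbove (fun _ : Fin 3 => ℝ) (Fin.last 2)).comp
    (PiLp.volume_preserving_ofLp (Fin 3))
  have h2 : MeasurePreserving (Prod.swap : ℝ × (Fin 2 → ℝ) → (Fin 2 → ℝ) × ℝ) volume volume :=
    Measure.measurePreserving_swap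
  have h3 : MeasurePreserving (Prod.map (WithLp.toLp 2) id : (Fin 2 → ℝ) × ℝ → Plane × ℝ)
      volume volume := (PiLp.volume_preserving_toLp (Fin 2)).prod (MeasurePreserving.id volume)
  have h4 := h3.comp (h2.comp h1)
  have h5 : ⇑assoc = Prod.map (WithLp.toLp 2) id ∘ Prod.swap ∘
      (MeasurableEquiv.piFinSuccAbove (fun _ : Fin 3 => ℝ) (Fin.last 2)) ∘ WithLp.ofLp := by
    funext z
    refine Prod.ext ?_ rfl
    ext i
    fin_cases i <;> rfl
  rw [h5]
  exact h4

theorem isSheet_projM (q : Torus × ℝ) :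
    ∃ U, IsSheet (volume : Measure (Torus × ℝ)) (projM ∘ assoc) q U := by
  set e := ((box (corner q.1)).prod (OpenPartialHomeomorph.refl ℝ)) with he
  set e' := assoc.toHomeomorph.toOpenPartialHomeomorph.trans e with he'
  refine ⟨e'.source, e'.open_source, ⟨assoc.symm (lift q.1, q.2), ?_, ?_⟩, ?_, ?_⟩
  · simp [he', he, lift_mem_box]
  · simp [projM, proj_lift]
  · exact e'.isOpenEmbedding_restrict
  · have h1 : MeasurePreserving projM (volume.restrict e.source) volume := by
      have h := (measurePreserving_proj (corner q.1)).prod (MeasurePreserving.id (volume : Measure ℝ))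
      have h3 : (volume.restrict e.source : Measure Space) =
          ((volume.restrict (box (corner q.1)).source).prod (volume : Measure ℝ)) := by
        rw [← Measure.restrict_univ (μ := (volume : Measure ℝ)), Measure.prod_restrict]
        rfl
      rw [h3]
      exact h
    have h2 := measurePreserving_assoc.restrict_preimage e.open_source.measurableSet
    have h3 : e'.source = assoc ⁻¹' e.source := by
      ext z; simp [he']
    rw [h3]
    exact h1.comp h2

/-- The volume density of the product metric. -/
def volDensity (q : Torus × ℝ) : ℝ := Real.sqrt (warpT q.1)

/-- The Riemannian volume of `Torus × ℝ`. -/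
def riemVol : Measure (Torus × ℝ) :=
  volume.withDensity fun q => ENNReal.ofReal (volDensity q)

theorem continuous_volDensity : Continuous volDensity :=
  Real.continuous_sqrt.comp (contMDiff_warpT.continuous.comp continuous_fst)

theorem mfderiv_projM_comp {k : ℕ} {f : EuclideanSpace ℝ (Fin k) → Space}
    {f' : EuclideanSpace ℝ (Fin k) →L[ℝ] Space} {x : EuclideanSpace ℝ (Fin k)}
    (hf : HasFDerivAt f f' x) : mfderiv (𝓡 k) J (projM ∘ f) x = f' := by
  have h := HasMFDerivAt.comp x (hasMFDerivAt_projM (f x)) hf.hasMFDerivAt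
  exact h.mfderiv.trans (ContinuousLinearMap.id_comp f')

theorem productMetric_projM (x : Space) (v w : Space) :
    productMetric metric.inner (projM x) v w = spaceMetric x v w := by
  have : planeForm (warp (dr x)) v.1 w.1 + v.2 * w.2 = spaceMetric x v w := by
    simp [spaceMetric, dr_apply, dt_apply, dy_apply]
    ring
  exact this

theorem gram_projM_comp {k : ℕ} {f : EuclideanSpace ℝ (Fin k) → Space}
    {f' : EuclideanSpace ℝ (Fin k) →L[ℝ] Space} {x : EuclideanSpace ℝ (Fin k)}
    (hf : HasFDerivAt f f' x) :
    gram (productMetric metric.inner) (projM ∘ f) x = Matrix.of fun i j =>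
      spaceMetric (f x) (f' (EuclideanSpace.single i 1)) (f' (EuclideanSpace.single j 1)) := by
  unfold gram
  rw [mfderiv_projM_comp hf]
  ext i j
  exact productMetric_projM (f x) _ _

theorem isRiemannianMeasure_riemVol :
    IsRiemannianMeasure (productMetric metric.inner) 3 univ riemVol := by
  have h := isRiemannianMeasure_map (productMetric metric.inner) isSheet_projM
    (Ψ := (id : Torus × ℝ → Torus × ℝ)) IsEmbedding.id MeasurableEmbedding.id ?_ ?_
    continuous_volDensity.measurable ?_
  · rwa [range_id, Measure.map_id] at h
  · exact contMDiff_projM.comp assoc.contDiff.contMDiff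
  · intro x
    rw [Function.id_comp, mfderiv_projM_comp assoc.hasFDerivAt]
    exact assoc.injective
  · intro x
    rw [Function.id_comp, gram_projM_comp assoc.hasFDerivAt, Matrix.det_fin_three]
    simp [spaceMetric, assoc_apply, dr_apply, dt_apply, dy_apply, volDensity, projM]

/-! ### Parametrization of the bubbles -/

/-- The cosine of the first coordinate `r` along the bubble, as a function of the angle of the
normal. -/
def cosR (c τ : ℝ) : ℝ := Real.sqrt (1 - (sinC c * Real.cos τ) ^ 2)

/-- The first coordinate along the bubble. -/
def curveR (c τ : ℝ) : ℝ := Real.arcsin (sinC c * Real.cos τ)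

/-- The height along the bubble. -/
def curveY (c τ : ℝ) : ℝ := Real.arsinh (sinC c * Real.sin τ / c)

section Curve

variable {c : ℝ}

theorem sq_sinC_cos_le (hc : 0 < c) (hc1 : c < 1) (τ : ℝ) :
    (sinC c * Real.cos τ) ^ 2 ≤ 1 - c ^ 2 := by
  rw [mul_pow, sinC_sq hc hc1]
  have := Real.cos_sq_le_one τ
  exact mul_le_of_le_one_right (by nlinarith) this

theorem cosR_sq (hc : 0 < c) (hc1 : c < 1) (τ : ℝ) :
    cosR c τ ^ 2 = 1 - (sinC c * Real.cos τ) ^ 2 := by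
  apply Real.sq_sqrt
  nlinarith [sq_sinC_cos_le hc hc1 τ]

/-- This is C² = c² cosh² y in terms of τ; together with `cosR_sq` it expresses both s² sin² τ and
s² cos² τ as polynomials in C. -/
theorem cosR_sq' (hc : 0 < c) (hc1 : c < 1) (τ : ℝ) :
    cosR c τ ^ 2 = c ^ 2 + (sinC c * Real.sin τ) ^ 2 := by
  rw [cosR_sq hc hc1, mul_pow, mul_pow, sinC_sq hc hc1, Real.sin_sq]
  ring

theorem le_cosR (hc : 0 < c) (hc1 : c < 1) (τ : ℝ) : c ≤ cosR c τ := by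
  apply Real.le_sqrt_of_sq_le
  linarith [sq_sinC_cos_le hc hc1 τ]

theorem cosR_pos (hc : 0 < c) (hc1 : c < 1) (τ : ℝ) : 0 < cosR c τ := hc.trans_le (le_cosR hc hc1 τ)

theorem sinC_cos_mem (hc : 0 < c) (hc1 : c < 1) (τ : ℝ) :
    sinC c * Real.cos τ ∈ Ioo (-1 : ℝ) 1 := by
  have := sq_sinC_cos_le hc hc1 τ
  exact abs_lt.1 (sq_lt_one_iff_abs_lt_one _ |>.1 (by nlinarith))

theorem sin_curveR (hc : 0 < c) (hc1 : c < 1) (τ : ℝ) :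
    Real.sin (curveR c τ) = sinC c * Real.cos τ :=
  Real.sin_arcsin (sinC_cos_mem hc hc1 τ).1.le (sinC_cos_mem hc hc1 τ).2.le

theorem cos_curveR (c τ : ℝ) : Real.cos (curveR c τ) = cosR c τ := Real.cos_arcsin _

theorem sinh_curveY (hc : 0 < c) (τ : ℝ) :
    c * Real.sinh (curveY c τ) = sinC c * Real.sin τ := by
  rw [curveY, Real.sinh_arsinh, mul_div_cancel₀ _ hc.ne']

theorem sqrt_curveY (hc : 0 < c) (hc1 : c < 1) (τ : ℝ) :
    Real.sqrt (1 + (sinC c * Real.sin τ / c) ^ 2) = cosR c τ / c := by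
  rw [Real.sqrt_eq_iff_mul_self_eq_of_pos (div_pos (cosR_pos hc hc1 τ) hc)]
  have := cosR_sq' hc hc1 τ
  field_simp
  linarith

theorem cosh_curveY (hc : 0 < c) (hc1 : c < 1) (τ : ℝ) :
    c * Real.cosh (curveY c τ) = cosR c τ := by
  rw [curveY, Real.cosh_arsinh, sqrt_curveY hc hc1, mul_div_cancel₀ _ hc.ne']

theorem hasDerivAt_curveR (hc : 0 < c) (hc1 : c < 1) (τ : ℝ) :
    HasDerivAt (curveR c) (-(sinC c * Real.sin τ) / cosR c τ) τ := by
  have hm := sinC_cos_mem hc hc1 τ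
  have h := (Real.hasDerivAt_arcsin hm.1.ne' hm.2.ne).comp τ
    ((Real.hasDerivAt_cos τ).const_mul (sinC c))
  refine h.congr_deriv ?_
  change 1 / cosR c τ * _ = _
  ring

theorem hasDerivAt_curveY (hc : 0 < c) (hc1 : c < 1) (τ : ℝ) :
    HasDerivAt (curveY c) (sinC c * Real.cos τ / cosR c τ) τ := by
  have h := (Real.hasDerivAt_arsinh (sinC c * Real.sin τ / c)).comp τ
    (((Real.hasDerivAt_sin τ).const_mul (sinC c)).div_const c)
  refine h.congr_deriv ?_
  rw [sqrt_curveY hc hc1]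
  have := (cosR_pos hc hc1 τ).ne'
  field_simp

theorem contDiff_curveR (hc : 0 < c) (hc1 : c < 1) : ContDiff ℝ ∞ (curveR c) := by
  rw [contDiff_iff_contDiffAt]
  intro τ
  have hm := sinC_cos_mem hc hc1 τ
  exact (Real.contDiffAt_arcsin hm.1.ne' hm.2.ne).comp τ
    (contDiff_const.mul Real.contDiff_cos).contDiffAt

theorem contDiff_curveY : ContDiff ℝ ∞ (curveY c) :=
  Real.contDiff_arsinh.comp ((contDiff_const.mul Real.contDiff_sin).div_const c)

/-- The parametrization of the bubble in coordinates. -/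
def param (c : ℝ) (x : Plane) : Space := (!₂[curveR c (x 0), x 1], curveY c (x 0))

theorem param_eq (c : ℝ) (x : Plane) :
    param c x = curveR c (x 0) • vr + x 1 • vt + curveY c (x 0) • vy := by
  apply space_ext
  · simp [param, dr_apply]; simp [← dr_apply]
  · simp [param, dt_apply]; simp [← dt_apply]
  · simp [param, dy_apply]; simp [← dy_apply]

@[simp] theorem dr_param (c : ℝ) (x : Plane) : dr (param c x) = curveR c (x 0) := by
  simp [param_eq]

@[simp] theorem dy_param (c : ℝ) (x : Plane) : dy (param c x) = curveY c (x 0) := by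
  simp [param_eq]

theorem contDiff_param (hc : 0 < c) (hc1 : c < 1) : ContDiff ℝ ∞ (param c) := by
  rw [funext (param_eq c)]
  have h0 : ContDiff ℝ ∞ fun x : Plane => x 0 := by fun_prop
  have h1 : ContDiff ℝ ∞ fun x : Plane => x 1 := by fun_prop
  exact ((((contDiff_curveR hc hc1).comp h0).smul contDiff_const).add
    (h1.smul contDiff_const)).add ((contDiff_curveY.comp h0).smul contDiff_const)

/-- The derivative of the parametrization. -/
def paramDeriv (c : ℝ) (x : Plane) : Plane →L[ℝ] Space :=
  (EuclideanSpace.proj (0 : Fin 2)).smulRight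
    ((sinC c / cosR c (x 0)) • tangentVec (Real.cos (x 0)) (Real.sin (x 0))) +
  (EuclideanSpace.proj (1 : Fin 2)).smulRight vt

theorem hasFDerivAt_param (hc : 0 < c) (hc1 : c < 1) (x : Plane) :
    HasFDerivAt (param c) (paramDeriv c x) x := by
  rw [funext (param_eq c)]
  have h0 : HasFDerivAt (fun x : Plane => x 0)
      (EuclideanSpace.proj (0 : Fin 2) : Plane →L[ℝ] ℝ) x :=
    (EuclideanSpace.proj (0 : Fin 2) : Plane →L[ℝ] ℝ).hasFDerivAt
  have h1 : HasFDerivAt (fun x : Plane => x 1)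
      (EuclideanSpace.proj (1 : Fin 2) : Plane →L[ℝ] ℝ) x :=
    (EuclideanSpace.proj (1 : Fin 2) : Plane →L[ℝ] ℝ).hasFDerivAt
  have hR := (hasDerivAt_curveR hc hc1 (x 0)).comp_hasFDerivAt x h0
  have hY := (hasDerivAt_curveY hc hc1 (x 0)).comp_hasFDerivAt x h0
  refine (((hR.smul_const vr).add (h1.smul_const vt)).add (hY.smul_const vy)).congr_fderiv ?_
  refine ContinuousLinearMap.ext fun v => ?_
  apply space_ext <;> simp [paramDeriv, tangentVec] <;> ring

theorem paramDeriv_injective (hc : 0 < c) (hc1 : c < 1) (x : Plane) :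
    Function.Injective (paramDeriv c x) := by
  rw [injective_iff_map_eq_zero]
  intro v hv
  have hs := (sinC_pos hc hc1).ne'
  have hC := (cosR_pos hc hc1 (x 0)).ne'
  have h0 : dr (paramDeriv c x v) = 0 := by rw [hv, map_zero]
  have h1 : dt (paramDeriv c x v) = 0 := by rw [hv, map_zero]
  have h2 : dy (paramDeriv c x v) = 0 := by rw [hv, map_zero]
  simp [paramDeriv, tangentVec, hs, hC] at h0 h1 h2
  have h3 : v 0 = 0 := by
    have := Real.sin_sq_add_cos_sq (x 0)
    by_contra hne
    simp [hne] at h0 h2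
    simp [h0, h2] at this
  ext i
  fin_cases i
  · exact h3
  · exact h1

/-- The curve has speed s/C and the circle in the θ direction has length φ = 1/(1 + C). -/
theorem gram_param (hc : 0 < c) (hc1 : c < 1) (x : Plane) :
    Real.sqrt (gram (productMetric metric.inner) (projM ∘ param c) x).det =
      sinC c / (cosR c (x 0) * (1 + cosR c (x 0))) := by
  have hC := cosR_pos hc hc1 (x 0)
  have hs := sinC_pos hc hc1
  rw [gram_projM_comp (hasFDerivAt_param hc hc1 x), Matrix.det_fin_two]
  have hw : warp (curveR c (x 0)) = ((1 + cosR c (x 0)) ^ 2)⁻¹ := by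
    rw [warp_eq (by rwa [cos_curveR]), cos_curveR]
  rw [Real.sqrt_eq_iff_mul_self_eq_of_pos (by positivity)]
  simp [spaceMetric, paramDeriv, tangentVec, hw]
  have := Real.sin_sq_add_cos_sq (x 0)
  field_simp
  linear_combination -this

end Curve

/-- The sine on the circle. -/
def sinT (p : Torus) : ℝ := Real.sin_periodic.lift p.1

@[simp] theorem sinT_proj (x : Plane) : sinT (proj x) = Real.sin (x 0) := rfl

theorem continuous_sinT : Continuous sinT := by
  have : Continuous (Real.sin_periodic.lift : AddCircle (2 * Real.pi) → ℝ) :=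
    continuous_coinduced_dom.mpr Real.continuous_sin
  exact this.comp continuous_fst

/-- The embedding of the torus onto the bubble. -/
def emb (c : ℝ) (p : Torus) : Torus × ℝ :=
  (((Real.arcsin (sinC c * cosT p) : ℝ), p.2), Real.arsinh (sinC c * sinT p / c))

theorem emb_proj (c : ℝ) (x : Plane) : emb c (proj x) = projM (param c x) := rfl

theorem emb_comp_proj (c : ℝ) : emb c ∘ proj = projM ∘ param c := rfl

theorem continuous_emb (c : ℝ) : Continuous (emb c) := by
  refine Continuous.prodMk (Continuous.prodMk ?_ continuous_snd) ?_
  · exact (AddCircle.continuous_mk' _).comp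
      (Real.continuous_arcsin.comp (continuous_const.mul continuous_cosT))
  · exact Real.continuous_arsinh.comp ((continuous_const.mul continuous_sinT).div_const c)

/-- The sine of r and the height recover cos τ and sin τ, hence τ modulo 2π. -/
theorem emb_injective {c : ℝ} (hc : 0 < c) (hc1 : c < 1) : Function.Injective (emb c) := by
  intro p q h
  obtain ⟨x, rfl⟩ := proj_surjective p
  obtain ⟨y, rfl⟩ := proj_surjective q
  rw [emb_proj, emb_proj] at h
  have hs := (sinC_pos hc hc1).ne'
  have h0 : ((curveR c (x 0) : ℝ) : Real.Angle) = (curveR c (y 0) : ℝ) :=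
    congrArg (fun z : Torus × ℝ => z.1.1) h
  have h1 : ((x 1 : ℝ) : AddCircle (1 : ℝ)) = (y 1 : ℝ) := congrArg (fun z : Torus × ℝ => z.1.2) h
  have h2 : curveY c (x 0) = curveY c (y 0) := congrArg (fun z : Torus × ℝ => z.2) h
  have h3 := congrArg Real.Angle.sin h0
  rw [Real.Angle.sin_coe, Real.Angle.sin_coe, sin_curveR hc hc1, sin_curveR hc hc1] at h3
  have h4 := sinh_curveY hc (x 0)
  rw [h2, sinh_curveY hc] at h4
  have h5 : ((x 0 : ℝ) : Real.Angle) = (y 0 : ℝ) :=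
    Real.Angle.cos_sin_inj (mul_left_cancel₀ hs h3) (mul_left_cancel₀ hs h4.symm)
  exact Prod.ext h5 h1

theorem isClosedEmbedding_emb {c : ℝ} (hc : 0 < c) (hc1 : c < 1) : IsClosedEmbedding (emb c) :=
  (continuous_emb c).isClosedEmbedding (emb_injective hc hc1)

theorem range_emb {c : ℝ} (hc : 0 < c) (hc1 : c < 1) : range (emb c) = {q | level c q = 0} := by
  have hs := sinC_pos hc hc1
  ext q
  constructor
  · rintro ⟨p, rfl⟩
    obtain ⟨x, rfl⟩ := proj_surjective p
    rw [emb_proj]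
    change levelFun c (param c x) = 0
    rw [levelFun_eq_zero_iff, dr_param, dy_param, cosh_curveY hc hc1, cos_curveR]
  · intro hq
    obtain ⟨x, rfl, hx⟩ := exists_lift_mem_Icc q
    have hq' : levelFun c x = 0 := hq
    have hcos := abs_lt.1 (abs_lt_of_cos_pos hx (cos_pos_of_levelFun_nonpos hc hq'.le))
    have h1 := sq_add_sq_eq_one hs (sinC_sq hc hc1) (levelFun_eq_zero_iff.1 hq')
    obtain ⟨τ, hτ0, hτ1⟩ : ∃ τ, Real.cos τ = Real.sin (dr x) / sinC c ∧
        Real.sin τ = c * Real.sinh (dy x) / sinC c := by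
      -- The normal of the curve is a unit vector, and τ is its argument.
      set z : ℂ := ⟨Real.sin (dr x) / sinC c, c * Real.sinh (dy x) / sinC c⟩ with hz
      have hn : ‖z‖ = 1 := by
        rw [Complex.norm_def, Complex.normSq_apply, Real.sqrt_eq_one]
        nlinarith
      have hz0 : z ≠ 0 := by rintro h; rw [h, norm_zero] at hn; norm_num at hn
      exact ⟨z.arg, by rw [Complex.cos_arg hz0, hn, div_one], by rw [Complex.sin_arg, hn, div_one]⟩
    refine ⟨proj !₂[τ, dt x], ?_⟩
    rw [emb_proj]
    congr 1
    apply space_ext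
    · rw [dr_param]
      simp only [curveR, Matrix.cons_val_zero]
      rw [hτ0, mul_div_cancel₀ _ hs.ne', Real.arcsin_sin hcos.1.le hcos.2.le]
    · simp [param_eq]
    · rw [dy_param]
      simp only [curveY, Matrix.cons_val_zero]
      rw [hτ1, mul_div_cancel₀ _ hs.ne', mul_div_cancel_left₀ _ hc.ne', Real.arsinh_sinh]

/-- The area density of the bubble. -/
def areaDensity (c : ℝ) (p : Torus) : ℝ :=
  sinC c / (Real.sqrt (1 - (sinC c * cosT p) ^ 2) * (1 + Real.sqrt (1 - (sinC c * cosT p) ^ 2)))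

theorem areaDensity_proj (c : ℝ) (x : Plane) :
    areaDensity c (proj x) = sinC c / (cosR c (x 0) * (1 + cosR c (x 0))) := rfl

theorem measurable_areaDensity (c : ℝ) : Measurable (areaDensity c) := by
  have := continuous_cosT.measurable
  unfold areaDensity
  fun_prop

/-- The area measure of the bubble. -/
def area (c : ℝ) : Measure (Torus × ℝ) :=
  ((volume : Measure Torus).withDensity fun p => ENNReal.ofReal (areaDensity c p)).map (emb c)

theorem isRiemannianMeasure_area {c : ℝ} (hc : 0 < c) (hc1 : c < 1) :
    IsRiemannianMeasure (productMetric metric.inner) 2 {q | level c q = 0} (area c) := by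
  rw [← range_emb hc hc1]
  refine isRiemannianMeasure_map (productMetric metric.inner) isSheet_proj
    (isClosedEmbedding_emb hc hc1).isEmbedding (isClosedEmbedding_emb hc hc1).measurableEmbedding
    ?_ ?_ (measurable_areaDensity c) ?_
  · rw [emb_comp_proj]
    exact contMDiff_projM.comp (contDiff_param hc hc1).contMDiff
  · intro x
    rw [emb_comp_proj, mfderiv_projM_comp (hasFDerivAt_param hc hc1 x)]
    exact paramDeriv_injective hc hc1 x
  · intro x
    rw [emb_comp_proj, gram_param hc hc1, areaDensity_proj]

/-! ### One-dimensional inequalities -/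

theorem eq_zero_of_integral_nonpos {a b : ℝ} (hab : a < b) {f : ℝ → ℝ} (hf : ContinuousOn f (Icc a b))
    (h0 : ∀ x ∈ Icc a b, 0 ≤ f x) (hi : ∫ x in a..b, f x ≤ 0) : ∀ x ∈ Icc a b, f x = 0 := by
  intro x hx
  by_contra hne
  have := intervalIntegral.integral_pos hab hf (fun y hy => h0 y (Ioc_subset_Icc_self hy))
    ⟨x, hx, lt_of_le_of_ne (h0 x hx) (Ne.symm hne)⟩
  linarith

/-- A Hardy type inequality: if `R` solves the Riccati equation `R' + R² / W = -V` on `(a, b)`, then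
`∫ V f² ≤ ∫ W f'²`. -/
theorem hardy_riccati {a b : ℝ} (hab : a ≤ b) {W V R R' f f' : ℝ → ℝ}
    (hf : ∀ x, HasDerivAt f (f' x) x) (hf' : Continuous f') (hW : Continuous W) (hV : Continuous V)
    (hWpos : ∀ x, 0 < W x) (hR : ∀ x ∈ Ioo a b, HasDerivAt R (R' x) x)
    (hRic : ∀ x ∈ Ioo a b, R' x + R x ^ 2 / W x = -V x)
    (hcont : ContinuousOn (fun x => R x * f x ^ 2) (Icc a b)) (hfa : f a = 0) (hfb : f b = 0) :
    0 ≤ ∫ x in a..b, (W x * f' x ^ 2 - V x * f x ^ 2) ∧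
      (∫ x in a..b, (W x * f' x ^ 2 - V x * f x ^ 2) ≤ 0 →
        ∀ x ∈ Ioo a b, W x * f' x = R x * f x) := by
  have hfc : Continuous f := continuous_iff_continuousAt.2 fun x => (hf x).continuousAt
  set φ : ℝ → ℝ := fun x => W x * f' x ^ 2 - V x * f x ^ 2 with hφ
  have hφc : Continuous φ := (hW.mul (hf'.pow 2)).sub (hV.mul (hfc.pow 2))
  set g : ℝ → ℝ := fun x => R x * f x ^ 2 with hg
  have hga : g a = 0 := by simp [hg, hfa]
  have hgb : g b = 0 := by simp [hg, hfb]
  have hgd : ∀ x ∈ Ioo a b, HasDerivAt g (R' x * f x ^ 2 + R x * (2 * f x * f' x)) x := by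
    intro x hx
    refine ((hR x hx).mul ((hf x).pow 2)).congr_deriv ?_
    simp
  have hle : ∀ x ∈ Ioo a b, φ x - (R' x * f x ^ 2 + R x * (2 * f x * f' x)) =
      (W x * f' x - R x * f x) ^ 2 / W x := by
    intro x hx
    have h1 := hRic x hx
    have h2 : V x = -(R' x + R x ^ 2 / W x) := by linarith
    have h3 := (hWpos x).ne'
    simp only [hφ]
    rw [h2]
    field_simp
    ring
  -- An inequality between g' and φ in the interior suffices here, so g' need not be integrable up
  -- to the endpoints, where R may blow up.
  have key : ∀ x ∈ Icc a b, ∀ y ∈ Icc a b, x ≤ y → g y - g x ≤ ∫ t in x..y, φ t := by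
    intro x hx y hy hxy
    refine intervalIntegral.sub_le_integral_of_hasDeriv_right_of_le hxy
      (hcont.mono (Icc_subset_Icc hx.1 hy.2))
      (fun t ht => (hgd t ⟨hx.1.trans_lt ht.1, ht.2.trans_le hy.2⟩).hasDerivWithinAt)
      hφc.continuousOn.integrableOn_Icc fun t ht => ?_
    have h1 := hle t ⟨hx.1.trans_lt ht.1, ht.2.trans_le hy.2⟩
    have h2 : 0 ≤ (W t * f' t - R t * f t) ^ 2 / W t := div_nonneg (sq_nonneg _) (hWpos t).le
    linarith
  refine ⟨?_, ?_⟩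
  · have := key a (left_mem_Icc.2 hab) b (right_mem_Icc.2 hab) hab
    linarith
  · intro h0 x hx
    have hII : ∀ y z, IntervalIntegrable φ volume y z := fun y z => hφc.intervalIntegrable y z
    -- In the equality case both halves of [a, b] are sharp, so g is a primitive of φ; comparing
    -- derivatives makes the square vanish.
    have hxy : ∀ y ∈ Icc a b, g y = ∫ t in a..y, φ t := by
      intro y hy
      have h1 := key a (left_mem_Icc.2 hab) y hy hy.1
      have h2 := key y hy b (right_mem_Icc.2 hab) hy.2
      have h3 := intervalIntegral.integral_add_adjacent_intervals (hII a y) (hII y b)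
      linarith
    have h1 : HasDerivAt g (φ x) x := by
      have h2 : HasDerivAt (fun y => ∫ t in a..y, φ t) (φ x) x :=
        intervalIntegral.integral_hasDerivAt_right (hII a x)
          hφc.stronglyMeasurable.stronglyMeasurableAtFilter hφc.continuousAt
      refine h2.congr_of_eventuallyEq ?_
      filter_upwards [Icc_mem_nhds hx.1 hx.2] with y hy
      exact hxy y hy
    have h3 := h1.unique (hgd x hx)
    have h4 := hle x hx
    rw [h3, sub_self] at h4
    have h5 := (div_eq_zero_iff.1 h4.symm).resolve_right (hWpos x).ne'
    have h6 := pow_eq_zero_iff (two_ne_zero) |>.1 h5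
    linarith

/-- The zero of the cosine is simple while f² vanishes to second order, so the limit is 0, which is
also the value given by division by zero. -/
theorem tendsto_sq_div_cos {f : ℝ → ℝ} {f'x x : ℝ} (hf : HasDerivAt f f'x x) (hfx : f x = 0)
    (hx : Real.cos x = 0) : ContinuousAt (fun t => f t ^ 2 / Real.cos t) x := by
  rw [continuousAt_iff_punctured_nhds]
  have hs : Real.sin x ≠ 0 := by
    intro h
    have := Real.sin_sq_add_cos_sq x
    simp [h, hx] at this
  have h1 := hasDerivAt_iff_tendsto_slope.1 hf
  have h2 := hasDerivAt_iff_tendsto_slope.1 (Real.hasDerivAt_cos x)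
  have h3 : Tendsto f (𝓝[≠] x) (𝓝 0) := by
    have := hf.continuousAt.tendsto.mono_left (nhdsWithin_le_nhds (s := {x}ᶜ))
    rwa [hfx] at this
  have h4 := h3.mul (h1.div h2 (neg_ne_zero.2 hs))
  rw [hfx, hx]
  simp only [div_zero, zero_mul] at h4 ⊢
  refine h4.congr' ?_
  filter_upwards [self_mem_nhdsWithin] with t ht
  have ht' : t - x ≠ 0 := sub_ne_zero.2 ht
  simp only [Pi.div_apply, slope_def_field, hfx, hx, sub_zero]
  rw [div_div_div_cancel_right₀ ht']
  ring

theorem cos_pos_of_mem {x : ℝ} (hx : x ∈ Ioo (-(Real.pi / 2)) (Real.pi / 2)) : 0 < Real.cos x :=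
  Real.cos_pos_of_mem_Ioo ⟨by linarith [hx.1], hx.2⟩

/-- `hardy_riccati` for `R = -k tan` on `(-π/2, π/2)`. -/
theorem hardy_tan {W V k k' f f' : ℝ → ℝ}
    (hf : ∀ x, HasDerivAt f (f' x) x) (hf' : Continuous f') (hW : Continuous W) (hV : Continuous V)
    (hWpos : ∀ x, 0 < W x) (hk : ∀ x, HasDerivAt k (k' x) x)
    (hRic : ∀ x ∈ Ioo (-(Real.pi / 2)) (Real.pi / 2),
      k x / Real.cos x ^ 2 + Real.sin x / Real.cos x * k' x
        - (Real.sin x / Real.cos x * k x) ^ 2 / W x = V x)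
    (hfa : f (-(Real.pi / 2)) = 0) (hfb : f (Real.pi / 2) = 0) :
    0 ≤ ∫ x in (-(Real.pi / 2))..(Real.pi / 2), (W x * f' x ^ 2 - V x * f x ^ 2) ∧
      (∫ x in (-(Real.pi / 2))..(Real.pi / 2), (W x * f' x ^ 2 - V x * f x ^ 2) ≤ 0 →
        ∀ x ∈ Ioo (-(Real.pi / 2)) (Real.pi / 2),
          W x * f' x = -(Real.sin x / Real.cos x * k x) * f x) := by
  have hfc : Continuous f := continuous_iff_continuousAt.2 fun x => (hf x).continuousAt
  have hkc : Continuous k := continuous_iff_continuousAt.2 fun x => (hk x).continuousAt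
  refine hardy_riccati (R := fun x => -(Real.sin x / Real.cos x * k x))
    (R' := fun x => -(k x / Real.cos x ^ 2 + Real.sin x / Real.cos x * k' x))
    (by linarith [Real.pi_pos]) hf hf' hW hV hWpos ?_ ?_ ?_ hfa hfb
  · intro x hx
    have hc := (cos_pos_of_mem hx).ne'
    have h := (((Real.hasDerivAt_sin x).div (Real.hasDerivAt_cos x) hc).mul (hk x)).neg
    refine h.congr_deriv ?_
    have := Real.sin_sq_add_cos_sq x
    simp only [Pi.div_apply]
    field_simp
    linear_combination (-k x) * this
  · intro x hx
    have := hRic x hx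
    rw [neg_sq]
    linarith
  · have h1 : (fun x => -(Real.sin x / Real.cos x * k x) * f x ^ 2) =
        fun x => -(Real.sin x * k x) * (f x ^ 2 / Real.cos x) := by
      funext x; ring
    rw [h1]
    intro x hx
    refine ContinuousAt.continuousWithinAt (ContinuousAt.mul ?_ ?_)
    · exact ((Real.continuous_sin.mul hkc).neg).continuousAt
    · by_cases hc : Real.cos x = 0
      · have hx0 : f x = 0 := by
          rcases eq_or_lt_of_le hx.1 with h | h
          · rw [← h]; exact hfa
          · rcases eq_or_lt_of_le hx.2 with h' | h'
            · rw [h']; exact hfb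
            · exact absurd hc (cos_pos_of_mem ⟨h, h'⟩).ne'
        exact tendsto_sq_div_cos (hf x) hx0 hc
      · exact (hfc.continuousAt.pow 2).div Real.continuous_cos.continuousAt hc

/-! ### The weighted Poincaré inequality on the generating curve -/

section Poincare

variable {c : ℝ}

/-- The weight of the Poincaré inequality. -/
def kap (c τ : ℝ) : ℝ := (1 + cosR c τ)⁻¹

theorem kap_pos (c τ : ℝ) : 0 < kap c τ :=
  inv_pos.2 (by have : 0 ≤ cosR c τ := Real.sqrt_nonneg _; linarith)

theorem continuous_cosR (c : ℝ) : Continuous (cosR c) := by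
  unfold cosR; fun_prop

theorem continuous_kap (c : ℝ) : Continuous (kap c) :=
  (continuous_const.add (continuous_cosR c)).inv₀ fun τ => by
    have : 0 ≤ cosR c τ := Real.sqrt_nonneg _
    exact (by linarith : 0 < 1 + cosR c τ).ne'

theorem hasDerivAt_cosR (hc : 0 < c) (hc1 : c < 1) (τ : ℝ) :
    HasDerivAt (cosR c) (sinC c ^ 2 * Real.sin τ * Real.cos τ / cosR c τ) τ := by
  have hC := cosR_pos hc hc1 τ
  have h1 := (((Real.hasDerivAt_cos τ).const_mul (sinC c)).pow 2).const_sub 1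
  have h2 : 1 - (sinC c * Real.cos τ) ^ 2 ≠ 0 := by
    rw [← cosR_sq hc hc1]; positivity
  have h := h1.sqrt h2
  refine h.congr_deriv ?_
  change _ / (2 * cosR c τ) = _
  simp
  field_simp

theorem cosR_pi_sub (c τ : ℝ) : cosR c (Real.pi - τ) = cosR c τ := by
  simp [cosR, Real.cos_pi_sub]

theorem kap_pi_sub (c τ : ℝ) : kap c (Real.pi - τ) = kap c τ := by
  simp [kap, cosR_pi_sub]

theorem sq_sinC_mul_sin_sq (hc : 0 < c) (hc1 : c < 1) (x : ℝ) :
    sinC c ^ 2 * Real.sin x ^ 2 = cosR c x ^ 2 - c ^ 2 := by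
  rw [cosR_sq' hc hc1]; ring

theorem sq_sinC_mul_cos_sq (hc : 0 < c) (hc1 : c < 1) (x : ℝ) :
    sinC c ^ 2 * Real.cos x ^ 2 = 1 - cosR c x ^ 2 := by
  rw [cosR_sq hc hc1]; ring

theorem cosR_lt_one (hc : 0 < c) (hc1 : c < 1) {x : ℝ} (hx : Real.cos x ≠ 0) : cosR c x < 1 := by
  have h1 := sq_sinC_mul_cos_sq hc hc1 x
  have h2 : 0 < sinC c ^ 2 * Real.cos x ^ 2 :=
    mul_pos (pow_pos (sinC_pos hc hc1) 2) (by positivity)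
  have h3 := cosR_pos hc hc1 x
  nlinarith

theorem tan_sq_eq (hc : 0 < c) (hc1 : c < 1) {x : ℝ} (hx : Real.cos x ≠ 0) :
    (Real.sin x / Real.cos x) ^ 2 = (cosR c x ^ 2 - c ^ 2) / (1 - cosR c x ^ 2) := by
  have hs := (sinC_pos hc hc1).ne'
  rw [← sq_sinC_mul_sin_sq hc hc1, ← sq_sinC_mul_cos_sq hc hc1]
  field_simp

theorem inv_cos_sq_eq (hc : 0 < c) (hc1 : c < 1) {x : ℝ} (hx : Real.cos x ≠ 0) :
    (Real.cos x ^ 2)⁻¹ = (1 - c ^ 2) / (1 - cosR c x ^ 2) := by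
  have hs := (sinC_pos hc hc1).ne'
  rw [← sinC_sq hc hc1, ← sq_sinC_mul_cos_sq hc hc1]
  field_simp

/-- The Riccati solution is W f'/f for f = cos τ/C, which is the radial component of the normal
divided by C. -/
theorem riccati_dirichlet (hc : 0 < c) (hc1 : c < 1) {x : ℝ} (hx : Real.cos x ≠ 0) :
    cosR c x / (1 + cosR c x) / Real.cos x ^ 2 + Real.sin x / Real.cos x *
      (sinC c ^ 2 * Real.sin x * Real.cos x / cosR c x / (1 + cosR c x) ^ 2)
      - (Real.sin x / Real.cos x * (cosR c x / (1 + cosR c x))) ^ 2 / (cosR c x ^ 3 * kap c x) =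
    (cosR c x + c ^ 2) * kap c x ^ 2 := by
  have hC := cosR_pos hc hc1 x
  have h1 := cosR_lt_one hc hc1 hx
  have h2 : cosR c x / (1 + cosR c x) / Real.cos x ^ 2 + Real.sin x / Real.cos x *
      (sinC c ^ 2 * Real.sin x * Real.cos x / cosR c x / (1 + cosR c x) ^ 2)
      - (Real.sin x / Real.cos x * (cosR c x / (1 + cosR c x))) ^ 2 / (cosR c x ^ 3 * kap c x) =
      cosR c x / (1 + cosR c x) * (Real.cos x ^ 2)⁻¹ +
        (sinC c ^ 2 * Real.sin x ^ 2) / (cosR c x * (1 + cosR c x) ^ 2) -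
        (Real.sin x / Real.cos x) ^ 2 / (cosR c x * (1 + cosR c x)) := by
    rw [kap]; field_simp
  rw [h2, tan_sq_eq hc hc1 hx, inv_cos_sq_eq hc hc1 hx, sq_sinC_mul_sin_sq hc hc1, kap]
  have h3 : 1 - cosR c x ^ 2 ≠ 0 := by nlinarith
  field_simp
  ring

/-- The Riccati solution is W F'/F for F = cos τ/(1 + C), the expected extremal for the primitive of
κe. -/
theorem riccati_neumann (hc : 0 < c) (hc1 : c < 1) {x : ℝ} (hx : Real.cos x ≠ 0) :
    (1 + cosR c x) / cosR c x / Real.cos x ^ 2 + Real.sin x / Real.cos x *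
      (-(sinC c ^ 2 * Real.sin x * Real.cos x / cosR c x ^ 3))
      - (Real.sin x / Real.cos x * ((1 + cosR c x) / cosR c x)) ^ 2 / (1 + cosR c x) =
    c ^ 2 * (1 + cosR c x) / cosR c x ^ 3 := by
  have hC := cosR_pos hc hc1 x
  have h1 := cosR_lt_one hc hc1 hx
  have h2 : (1 + cosR c x) / cosR c x / Real.cos x ^ 2 + Real.sin x / Real.cos x *
      (-(sinC c ^ 2 * Real.sin x * Real.cos x / cosR c x ^ 3))
      - (Real.sin x / Real.cos x * ((1 + cosR c x) / cosR c x)) ^ 2 / (1 + cosR c x) =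
      (1 + cosR c x) / cosR c x * (Real.cos x ^ 2)⁻¹ -
        (sinC c ^ 2 * Real.sin x ^ 2) / cosR c x ^ 3 -
        (Real.sin x / Real.cos x) ^ 2 * (1 + cosR c x) / cosR c x ^ 2 := by
    field_simp
    ring
  rw [h2, tan_sq_eq hc hc1 hx, inv_cos_sq_eq hc hc1 hx, sq_sinC_mul_sin_sq hc hc1]
  have h3 : 1 - cosR c x ^ 2 ≠ 0 := by nlinarith
  field_simp
  ring

/-- The potential obtained here is larger than the required c²κ, by s²Cκ²; this excess later
excludes a nonzero odd part in the equality case. -/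
theorem poincare_dirichlet (hc : 0 < c) (hc1 : c < 1) {f f' : ℝ → ℝ}
    (hf : ∀ x, HasDerivAt f (f' x) x) (hf' : Continuous f')
    (hfa : f (-(Real.pi / 2)) = 0) (hfb : f (Real.pi / 2) = 0) :
    0 ≤ ∫ x in (-(Real.pi / 2))..(Real.pi / 2), (cosR c x ^ 3 * kap c x * f' x ^ 2 -
      (cosR c x + c ^ 2) * kap c x ^ 2 * f x ^ 2) := by
  have hCc := continuous_cosR c
  have hkc := continuous_kap c
  refine (hardy_tan (W := fun x => cosR c x ^ 3 * kap c x)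
    (V := fun x => (cosR c x + c ^ 2) * kap c x ^ 2) (k := fun x => cosR c x / (1 + cosR c x))
    (k' := fun x => sinC c ^ 2 * Real.sin x * Real.cos x / cosR c x / (1 + cosR c x) ^ 2)
    hf hf' (by fun_prop) (by fun_prop) ?_ ?_ ?_ hfa hfb).1
  · intro x
    exact mul_pos (pow_pos (cosR_pos hc hc1 x) 3) (kap_pos c x)
  · intro x
    have hC := cosR_pos hc hc1 x
    have h := hasDerivAt_cosR hc hc1 x
    refine (h.div (h.const_add 1) (by positivity)).congr_deriv ?_
    field_simp
    ring
  · intro x hx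
    exact riccati_dirichlet hc hc1 (cos_pos_of_mem hx).ne'

/-- A duality argument: the primitive F of κe vanishes at both ends exactly because κe has integral
zero. A Hardy inequality for F then yields the inequality for e, and its equality case determines F
and hence e. -/
theorem poincare_neumann (hc : 0 < c) (hc1 : c < 1) {e e' : ℝ → ℝ}
    (he : ∀ x, HasDerivAt e (e' x) x) (he' : Continuous e')
    (hmean : ∫ x in (-(Real.pi / 2))..(Real.pi / 2), kap c x * e x = 0) :
    0 ≤ ∫ x in (-(Real.pi / 2))..(Real.pi / 2), (cosR c x ^ 3 * kap c x * e' x ^ 2 -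
      c ^ 2 * kap c x * e x ^ 2) ∧
    (∫ x in (-(Real.pi / 2))..(Real.pi / 2), (cosR c x ^ 3 * kap c x * e' x ^ 2 -
      c ^ 2 * kap c x * e x ^ 2) ≤ 0 → ∃ β : ℝ, ∀ x ∈ Icc (-(Real.pi / 2)) (Real.pi / 2),
        e x = β * Real.sin x / cosR c x) := by
  have hCc := continuous_cosR c
  have hkc := continuous_kap c
  have hec : Continuous e := continuous_iff_continuousAt.2 fun x => (he x).continuousAt
  have hpi := Real.pi_pos
  have hke : Continuous fun x => kap c x * e x := hkc.mul hec
  set F : ℝ → ℝ := fun x => ∫ t in (-(Real.pi / 2))..x, kap c t * e t with hF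
  have hFd : ∀ x, HasDerivAt F (kap c x * e x) x := fun x =>
    intervalIntegral.integral_hasDerivAt_right (hke.intervalIntegrable _ _)
      hke.stronglyMeasurable.stronglyMeasurableAtFilter hke.continuousAt
  have hFc : Continuous F := continuous_iff_continuousAt.2 fun x => (hFd x).continuousAt
  have hFa : F (-(Real.pi / 2)) = 0 := by simp [hF]
  have hFb : F (Real.pi / 2) = 0 := hmean
  have hCpos := cosR_pos hc hc1
  have hCne : ∀ x, cosR c x ≠ 0 := fun x => (hCpos x).ne'
  obtain ⟨hH1, hH2⟩ := hardy_tan (W := fun x => 1 + cosR c x)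
    (V := fun x => c ^ 2 * (1 + cosR c x) / cosR c x ^ 3)
    (k := fun x => (1 + cosR c x) / cosR c x)
    (k' := fun x => -(sinC c ^ 2 * Real.sin x * Real.cos x / cosR c x ^ 3))
    hFd hke (by fun_prop)
    (by refine Continuous.div (by fun_prop) (by fun_prop) fun x => pow_ne_zero 3 (hCne x))
    (fun x => by have := hCpos x; positivity)
    (fun x => by
      have hC := hCpos x
      have h := hasDerivAt_cosR hc hc1 x
      refine ((h.const_add 1).div h (hCne x)).congr_deriv ?_
      field_simp
      ring)
    (fun x hx => riccati_neumann hc hc1 (cos_pos_of_mem hx).ne')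
    hFa hFb
  -- integrate by parts
  have hibp : ∫ x in (-(Real.pi / 2))..(Real.pi / 2), kap c x * e x ^ 2 =
      -∫ x in (-(Real.pi / 2))..(Real.pi / 2), F x * e' x := by
    have h := intervalIntegral.integral_mul_deriv_eq_deriv_mul (u := F) (v := e)
      (u' := fun x => kap c x * e x) (v' := e') (a := -(Real.pi / 2)) (b := Real.pi / 2)
      (fun x _ => hFd x) (fun x _ => he x) (hke.intervalIntegrable _ _)
      (he'.intervalIntegrable _ _)
    rw [h, hFa, hFb]
    simp only [zero_mul, sub_zero, zero_sub, neg_neg]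
    refine intervalIntegral.integral_congr fun x _ => ?_
    ring
  set A : ℝ → ℝ := fun x => cosR c x ^ 3 * kap c x * e' x ^ 2 - c ^ 2 * kap c x * e x ^ 2 with hA
  set A1 : ℝ → ℝ := fun x => (1 + cosR c x) * (kap c x * e x) ^ 2
    - c ^ 2 * (1 + cosR c x) / cosR c x ^ 3 * F x ^ 2 with hA1
  set A2 : ℝ → ℝ := fun x => cosR c x ^ 3 * kap c x *
    (e' x + c ^ 2 * (1 + cosR c x) / cosR c x ^ 3 * F x) ^ 2 with hA2
  have hVc : Continuous fun x => c ^ 2 * (1 + cosR c x) / cosR c x ^ 3 :=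
    Continuous.div (by fun_prop) (by fun_prop) fun x => pow_ne_zero 3 (hCne x)
  have hA1c : Continuous A1 := by fun_prop
  have hA2c : Continuous A2 := by fun_prop
  have hA1i := hA1c.intervalIntegrable (μ := volume) (-(Real.pi / 2)) (Real.pi / 2)
  have hA2i := hA2c.intervalIntegrable (μ := volume) (-(Real.pi / 2)) (Real.pi / 2)
  have hFe : IntervalIntegrable (fun x => F x * e' x) volume (-(Real.pi / 2)) (Real.pi / 2) :=
    (hFc.mul he').intervalIntegrable _ _
  have hke2 : IntervalIntegrable (fun x => kap c x * e x ^ 2) volume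
    (-(Real.pi / 2)) (Real.pi / 2) := (hkc.mul (hec.pow 2)).intervalIntegrable _ _
  -- As κ(1 + C) = 1, expanding the square in `A2` leaves only the terms -2c²(κe² + F e'), whose
  -- integral is zero by `hibp`.
  have hsum : ∫ x in (-(Real.pi / 2))..(Real.pi / 2), A x =
      c ^ 2 * (∫ x in (-(Real.pi / 2))..(Real.pi / 2), A1 x) +
        ∫ x in (-(Real.pi / 2))..(Real.pi / 2), A2 x := by
    have h1 : ∀ x, A x = (c ^ 2 * A1 x + A2 x) +
        (-(2 * c ^ 2) * (kap c x * e x ^ 2) - (2 * c ^ 2) * (F x * e' x)) := by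
      intro x
      have hC := hCpos x
      simp only [hA, hA1, hA2, kap]
      field_simp
      ring
    simp_rw [h1]
    rw [intervalIntegral.integral_add ((hA1i.const_mul _).add hA2i)
      ((hke2.const_mul _).sub (hFe.const_mul _)),
      intervalIntegral.integral_add (hA1i.const_mul _) hA2i,
      intervalIntegral.integral_sub (hke2.const_mul _) (hFe.const_mul _),
      intervalIntegral.integral_const_mul, intervalIntegral.integral_const_mul,
      intervalIntegral.integral_const_mul, hibp]
    ring
  have hA2nn : 0 ≤ ∫ x in (-(Real.pi / 2))..(Real.pi / 2), A2 x :=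
    intervalIntegral.integral_nonneg (by linarith) fun x _ => by
      have := hCpos x; have := kap_pos c x; positivity
  refine ⟨?_, ?_⟩
  · rw [hsum]
    have := mul_nonneg (sq_nonneg c) hH1
    linarith
  · intro h0
    rw [hsum] at h0
    have hA10 : ∫ x in (-(Real.pi / 2))..(Real.pi / 2), A1 x ≤ 0 := by
      by_contra! h
      have := mul_pos (pow_pos hc 2) h
      linarith
    have hFe' := hH2 hA10
    -- Equality in the Hardy inequality is a first order linear equation for F, so F is a multiple
    -- of cos τ/(1 + C).
    have hconst : ∀ x ∈ Ioo (-(Real.pi / 2)) (Real.pi / 2),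
        F x * (1 + cosR c x) / Real.cos x = F 0 * (1 + cosR c 0) / Real.cos 0 := by
      have hd : ∀ x ∈ Ioo (-(Real.pi / 2)) (Real.pi / 2),
          HasDerivAt (fun x => F x * (1 + cosR c x) / Real.cos x) 0 x := by
        intro x hx
        have hcos := (cos_pos_of_mem hx).ne'
        have hC := hCpos x
        have h := ((hFd x).mul ((hasDerivAt_cosR hc hc1 x).const_add 1)).div
          (Real.hasDerivAt_cos x) hcos
        refine h.congr_deriv ?_
        have h1 := hFe' x hx
        have h2 := sq_sinC_mul_cos_sq hc hc1 x
        have h3 : kap c x * e x * (1 + cosR c x) =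
            -(Real.sin x / Real.cos x * ((1 + cosR c x) / cosR c x)) * F x := by
          rw [← h1]; ring
        simp only [Pi.mul_apply]
        rw [h3]
        field_simp
        linear_combination (F x * Real.sin x) * h2
      intro x hx
      refine isOpen_Ioo.is_const_of_deriv_eq_zero isPreconnected_Ioo
        (fun x hx => (hd x hx).differentiableAt.differentiableWithinAt)
        (fun x hx => (hd x hx).deriv) hx ⟨by linarith, by linarith⟩
    set b := F 0 * (1 + cosR c 0) / Real.cos 0
    refine ⟨-b, ?_⟩
    have hopen : EqOn e (fun x => -b * Real.sin x / cosR c x)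
        (Ioo (-(Real.pi / 2)) (Real.pi / 2)) := by
      intro x hx
      have hcos := (cos_pos_of_mem hx).ne'
      have hC := hCpos x
      have h1 := hFe' x hx
      have h2 := hconst x hx
      simp only
      rw [← h2]
      rw [kap] at h1
      field_simp at h1 ⊢
      linarith
    have hrhs : Continuous fun x => -b * Real.sin x / cosR c x :=
      Continuous.div (by fun_prop) hCc hCne
    -- The equality case says nothing at the endpoints, where the Riccati solution is singular; they
    -- follow by continuity.
    refine hopen.of_subset_closure hec.continuousOn hrhs.continuousOn Ioo_subset_Icc_self ?_
    rw [closure_Ioo (by linarith)]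
end Poincare

/-- The substitution x ↦ π - x folds the half [π/2, 3π/2] onto [-π/2, π/2]; in the application it is
the reflection r ↦ -r. -/
theorem integral_circle_eq {f : ℝ → ℝ} (hf : Continuous f) :
    ∫ x in (-(Real.pi / 2))..(-(Real.pi / 2) + 2 * Real.pi), f x =
      ∫ x in (-(Real.pi / 2))..(Real.pi / 2), (f x + f (Real.pi - x)) := by
  have h1 : IntervalIntegrable (fun x => f (Real.pi - x)) volume (-(Real.pi / 2)) (Real.pi / 2) :=
    (hf.comp (continuous_const.sub continuous_id)).intervalIntegrable _ _
  rw [intervalIntegral.integral_add (hf.intervalIntegrable _ _) h1,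
    intervalIntegral.integral_comp_sub_left,
    ← intervalIntegral.integral_add_adjacent_intervals (hf.intervalIntegrable _ (Real.pi / 2))
      (hf.intervalIntegrable _ _)]
  congr 2 <;> ring

section Poincare

variable {c : ℝ}

/-- The weights are invariant under τ ↦ π - τ, so even and odd parts decouple. The even part
inherits the vanishing mean, and the odd part vanishes at the two fixed points ±π/2. -/
theorem poincare_circle (hc : 0 < c) (hc1 : c < 1) {η η' : ℝ → ℝ}
    (hη : ∀ x, HasDerivAt η (η' x) x) (hη' : Continuous η')
    (hper : η (-(Real.pi / 2) + 2 * Real.pi) = η (-(Real.pi / 2)))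
    (hmean : ∫ x in (-(Real.pi / 2))..(-(Real.pi / 2) + 2 * Real.pi), kap c x * η x = 0) :
    0 ≤ ∫ x in (-(Real.pi / 2))..(-(Real.pi / 2) + 2 * Real.pi),
      (cosR c x ^ 3 * kap c x * η' x ^ 2 - c ^ 2 * kap c x * η x ^ 2) ∧
    (∫ x in (-(Real.pi / 2))..(-(Real.pi / 2) + 2 * Real.pi),
      (cosR c x ^ 3 * kap c x * η' x ^ 2 - c ^ 2 * kap c x * η x ^ 2) ≤ 0 →
      ∃ β : ℝ, ∀ x ∈ Icc (-(Real.pi / 2)) (-(Real.pi / 2) + 2 * Real.pi),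
        η x = β * Real.sin x / cosR c x) := by
  have hCc := continuous_cosR c
  have hkc := continuous_kap c
  have hpi := Real.pi_pos
  have hηc : Continuous η := continuous_iff_continuousAt.2 fun x => (hη x).continuousAt
  have hηr : ∀ x, HasDerivAt (fun x => η (Real.pi - x)) (-η' (Real.pi - x)) x := fun x => by
    have h := (hη (Real.pi - x)).comp x ((hasDerivAt_id x).const_sub Real.pi)
    refine h.congr_deriv ?_
    simp
  set e : ℝ → ℝ := fun x => (η x + η (Real.pi - x)) / 2 with he
  set e' : ℝ → ℝ := fun x => (η' x - η' (Real.pi - x)) / 2 with he'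
  set o : ℝ → ℝ := fun x => (η x - η (Real.pi - x)) / 2 with ho
  set o' : ℝ → ℝ := fun x => (η' x + η' (Real.pi - x)) / 2 with ho'
  have hed : ∀ x, HasDerivAt e (e' x) x := fun x =>
    (((hη x).add (hηr x)).div_const 2).congr_deriv (by simp only [he']; ring)
  have hod : ∀ x, HasDerivAt o (o' x) x := fun x =>
    (((hη x).sub (hηr x)).div_const 2).congr_deriv (by simp only [ho']; ring)
  have hec' : Continuous e' := by fun_prop
  have hoc' : Continuous o' := by fun_prop
  have hec : Continuous e := by fun_prop
  have hoc : Continuous o := by fun_prop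
  have hob : o (Real.pi / 2) = 0 := by
    simp only [ho]; rw [show Real.pi - Real.pi / 2 = Real.pi / 2 by ring]; simp
  have hoa : o (-(Real.pi / 2)) = 0 := by
    simp only [ho]
    rw [show Real.pi - -(Real.pi / 2) = -(Real.pi / 2) + 2 * Real.pi by ring, hper]; simp
  have hem : ∫ x in (-(Real.pi / 2))..(Real.pi / 2), kap c x * e x = 0 := by
    rw [integral_circle_eq (by fun_prop)] at hmean
    have h1 : ∀ x, kap c x * e x =
        (1 / 2) * (kap c x * η x + kap c (Real.pi - x) * η (Real.pi - x)) := by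
      intro x; simp only [he, kap_pi_sub]; ring
    simp_rw [h1]
    rw [intervalIntegral.integral_const_mul, hmean, mul_zero]
  obtain ⟨hE1, hE2⟩ := poincare_neumann hc hc1 hed hec' hem
  have hO := poincare_dirichlet hc hc1 hod hoc' hoa hob
  set A : ℝ → ℝ := fun x => cosR c x ^ 3 * kap c x * e' x ^ 2 - c ^ 2 * kap c x * e x ^ 2 with hA
  set B : ℝ → ℝ := fun x => cosR c x ^ 3 * kap c x * o' x ^ 2 -
      (cosR c x + c ^ 2) * kap c x ^ 2 * o x ^ 2 with hB
  -- The surplus of the Dirichlet inequality: (C + c²)κ² - c²κ = s²Cκ².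
  set D : ℝ → ℝ := fun x => sinC c ^ 2 * cosR c x * kap c x ^ 2 * o x ^ 2 with hD
  have hAc : Continuous A := by fun_prop
  have hBc : Continuous B := by fun_prop
  have hDc : Continuous D := by fun_prop
  have hsum : ∫ x in (-(Real.pi / 2))..(-(Real.pi / 2) + 2 * Real.pi),
      (cosR c x ^ 3 * kap c x * η' x ^ 2 - c ^ 2 * kap c x * η x ^ 2) =
      2 * ((∫ x in (-(Real.pi / 2))..(Real.pi / 2), A x) +
        (∫ x in (-(Real.pi / 2))..(Real.pi / 2), B x) +
        ∫ x in (-(Real.pi / 2))..(Real.pi / 2), D x) := by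
    have hABi : IntervalIntegrable (fun x => A x + B x) volume (-(Real.pi / 2)) (Real.pi / 2) :=
      (hAc.add hBc).intervalIntegrable _ _
    rw [integral_circle_eq (by fun_prop),
      ← intervalIntegral.integral_add (hAc.intervalIntegrable _ _) (hBc.intervalIntegrable _ _),
      ← intervalIntegral.integral_add hABi (hDc.intervalIntegrable _ _), ← intervalIntegral.integral_const_mul]
    refine intervalIntegral.integral_congr fun x _ => ?_
    have hC := cosR_pos hc hc1 x
    simp only [hA, hB, hD, cosR_pi_sub, sinC_sq hc hc1, he, he', ho, ho', kap]
    field_simp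
    ring
  have hDnn : 0 ≤ ∫ x in (-(Real.pi / 2))..(Real.pi / 2), D x :=
    intervalIntegral.integral_nonneg (by linarith) fun x _ => by
      have := cosR_pos hc hc1 x; positivity
  refine ⟨by rw [hsum]; linarith, fun h0 => ?_⟩
  rw [hsum] at h0
  obtain ⟨β, hβ⟩ := hE2 (by linarith)
  have hD0 := eq_zero_of_integral_nonpos (by linarith) hDc.continuousOn
    (fun x _ => by have := cosR_pos hc hc1 x; positivity)
    (by linarith : ∫ x in (-(Real.pi / 2))..(Real.pi / 2), D x ≤ 0)
  have ho0 : ∀ x ∈ Icc (-(Real.pi / 2)) (Real.pi / 2), o x = 0 := by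
    intro x hx
    have h1 := hD0 x hx
    have h2 := cosR_pos hc hc1 x
    have h3 := kap_pos c x
    have h4 := sinC_pos hc hc1
    simp only [hD] at h1
    have h5 : 0 < sinC c ^ 2 * cosR c x * kap c x ^ 2 := by positivity
    have := (mul_eq_zero.1 h1).resolve_left h5.ne'
    exact pow_eq_zero_iff (two_ne_zero) |>.1 this
  refine ⟨β, fun x hx => ?_⟩
  rcases le_total x (Real.pi / 2) with h | h
  · have h1 := hβ x ⟨hx.1, h⟩
    have h2 := ho0 x ⟨hx.1, h⟩
    rw [← h1]
    simp only [he, ho] at h2 ⊢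
    linarith
  · have hm : Real.pi - x ∈ Icc (-(Real.pi / 2)) (Real.pi / 2) :=
      ⟨by linarith [hx.2], by linarith⟩
    have h1 := hβ _ hm
    have h2 := ho0 _ hm
    rw [Real.sin_pi_sub, cosR_pi_sub] at h1
    rw [← h1]
    simp only [he, ho, sub_sub_cancel] at h2 ⊢
    linarith

/-- The weighted Cauchy-Schwarz inequality. -/
theorem sq_integral_mul_le {a b : ℝ} (hab : a ≤ b) {k f : ℝ → ℝ} (hk : Continuous k)
    (hf : Continuous f) (hk0 : ∀ x, 0 ≤ k x) :
    (∫ x in a..b, k x * f x) ^ 2 ≤ (∫ x in a..b, k x) * ∫ x in a..b, k x * f x ^ 2 := by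
  set K := ∫ x in a..b, k x
  set m := ∫ x in a..b, k x * f x
  set q := ∫ x in a..b, k x * f x ^ 2
  have hi1 : IntervalIntegrable (fun x => k x * f x ^ 2) volume a b :=
    (hk.mul (hf.pow 2)).intervalIntegrable _ _
  have hi2 : IntervalIntegrable (fun x => k x * f x) volume a b :=
    (hk.mul hf).intervalIntegrable _ _
  have hi3 : IntervalIntegrable k volume a b := hk.intervalIntegrable _ _
  -- The quadratic polynomial t ↦ ∫ k (f - t)² is nonnegative, so its discriminant is not positive.
  have h : ∀ t : ℝ, 0 ≤ K * (t * t) + (-2 * m) * t + q := by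
    intro t
    have h1 : 0 ≤ ∫ x in a..b, k x * (f x - t) ^ 2 :=
      intervalIntegral.integral_nonneg hab fun x _ => mul_nonneg (hk0 x) (sq_nonneg _)
    have h2 : ∀ x, k x * (f x - t) ^ 2 = k x * f x ^ 2 - (2 * t) * (k x * f x) + t ^ 2 * k x := by
      intro x; ring
    simp_rw [h2] at h1
    rw [intervalIntegral.integral_add (hi1.sub (hi2.const_mul _)) (hi3.const_mul _),
      intervalIntegral.integral_sub hi1 (hi2.const_mul _), intervalIntegral.integral_const_mul,
      intervalIntegral.integral_const_mul] at h1
    change 0 ≤ q - 2 * t * m + t ^ 2 * K at h1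
    linarith
  have := discrim_le_zero h
  rw [discrim] at this
  linarith

/-- The total weight of the generating curve. -/
def totalKap (c : ℝ) : ℝ := ∫ x in (-(Real.pi / 2))..(-(Real.pi / 2) + 2 * Real.pi), kap c x

theorem totalKap_pos (c : ℝ) : 0 < totalKap c :=
  intervalIntegral.integral_pos (by linarith [Real.pi_pos]) (continuous_kap c).continuousOn
    (fun x _ => (kap_pos c x).le) ⟨-(Real.pi / 2), left_mem_Icc.2 (by linarith [Real.pi_pos]),
      kap_pos c _⟩

/-- `poincare_circle` without the normalization of the mean. -/
theorem poincare_circle_var (hc : 0 < c) (hc1 : c < 1) {η η' : ℝ → ℝ}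
    (hη : ∀ x, HasDerivAt η (η' x) x) (hη' : Continuous η')
    (hper : η (-(Real.pi / 2) + 2 * Real.pi) = η (-(Real.pi / 2))) :
    -(c ^ 2 / totalKap c *
        (∫ x in (-(Real.pi / 2))..(-(Real.pi / 2) + 2 * Real.pi), kap c x * η x) ^ 2) ≤
      ∫ x in (-(Real.pi / 2))..(-(Real.pi / 2) + 2 * Real.pi),
        (cosR c x ^ 3 * kap c x * η' x ^ 2 - c ^ 2 * kap c x * η x ^ 2) := by
  have hCc := continuous_cosR c
  have hkc := continuous_kap c
  have hηc : Continuous η := continuous_iff_continuousAt.2 fun x => (hη x).continuousAt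
  have hK := totalKap_pos c
  set a := -(Real.pi / 2)
  set b := -(Real.pi / 2) + 2 * Real.pi
  set M := ∫ x in a..b, kap c x * η x with hM
  -- Subtracting the weighted mean leaves the derivative unchanged.
  set t := M / totalKap c with ht
  have hi1 : IntervalIntegrable (fun x => kap c x * η x) volume a b :=
    (hkc.mul hηc).intervalIntegrable _ _
  have hi2 : IntervalIntegrable (kap c) volume a b := hkc.intervalIntegrable _ _
  have h1 := (poincare_circle hc hc1 (η := fun x => η x - t) (η' := η')
    (fun x => (hη x).sub_const t) hη' (by change η b - t = η a - t; rw [hper]) (by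
      simp_rw [mul_sub]
      rw [intervalIntegral.integral_sub hi1 (hi2.mul_const t), intervalIntegral.integral_mul_const]
      change M - totalKap c * t = 0
      rw [ht]; field_simp; ring)).1
  have h2 : ∀ x, cosR c x ^ 3 * kap c x * η' x ^ 2 - c ^ 2 * kap c x * (η x - t) ^ 2 =
      (cosR c x ^ 3 * kap c x * η' x ^ 2 - c ^ 2 * kap c x * η x ^ 2) +
        ((2 * c ^ 2 * t) * (kap c x * η x) - (c ^ 2 * t ^ 2) * kap c x) := by
    intro x; ring
  simp_rw [h2] at h1
  rw [intervalIntegral.integral_add (Continuous.intervalIntegrable (by fun_prop) _ _)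
    ((hi1.const_mul _).sub (hi2.const_mul _)),
    intervalIntegral.integral_sub (hi1.const_mul _) (hi2.const_mul _),
    intervalIntegral.integral_const_mul, intervalIntegral.integral_const_mul] at h1
  change 0 ≤ _ + (2 * c ^ 2 * t * M - c ^ 2 * t ^ 2 * totalKap c) at h1
  have h3 : 2 * c ^ 2 * t * M - c ^ 2 * t ^ 2 * totalKap c = c ^ 2 / totalKap c * M ^ 2 := by
    rw [ht]; field_simp; ring
  rw [h3] at h1
  linarith

/-- The part of the index form without derivatives along the circles. -/
def curveForm (c : ℝ) (w w' : ℝ → ℝ) : ℝ :=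
  ∫ x in (-(Real.pi / 2))..(-(Real.pi / 2) + 2 * Real.pi),
    (cosR c x * kap c x * w' x ^ 2 +
      (1 - cosR c x - cosR c x ^ 2) * kap c x / cosR c x * w x ^ 2)

/-- The substitution w = Cη works because C satisfies (CκC')' = (1 - C - C²)κ + c²κ/C. After an
integration by parts, the potential is replaced by the constant multiple -c² of the weight κ. -/
theorem curveForm_eq (hc : 0 < c) (hc1 : c < 1) {w w' : ℝ → ℝ}
    (hw : ∀ x, HasDerivAt w (w' x) x) (hw' : Continuous w') :
    curveForm c w w' = ∫ x in (-(Real.pi / 2))..(-(Real.pi / 2) + 2 * Real.pi),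
      (cosR c x ^ 3 * kap c x * (w' x / cosR c x -
        w x * (sinC c ^ 2 * Real.sin x * Real.cos x / cosR c x) / cosR c x ^ 2) ^ 2 -
        c ^ 2 * kap c x * (w x / cosR c x) ^ 2) := by
  have hCc := continuous_cosR c
  have hkc := continuous_kap c
  have hwc : Continuous w := continuous_iff_continuousAt.2 fun x => (hw x).continuousAt
  have hCpos := cosR_pos hc hc1
  have hCne : ∀ x, cosR c x ≠ 0 := fun x => (hCpos x).ne'
  -- The boundary term κC' w² of the substitution; it vanishes at both ends of the interval, where
  -- cos τ = 0.
  set b : ℝ → ℝ := fun x => sinC c ^ 2 * Real.sin x * Real.cos x / (cosR c x * (1 + cosR c x)) *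
    w x ^ 2 with hb
  set f1 : ℝ → ℝ := fun x => cosR c x * kap c x * w' x ^ 2 +
      (1 - cosR c x - cosR c x ^ 2) * kap c x / cosR c x * w x ^ 2 with hf1
  set f2 : ℝ → ℝ := fun x => cosR c x ^ 3 * kap c x * (w' x / cosR c x -
        w x * (sinC c ^ 2 * Real.sin x * Real.cos x / cosR c x) / cosR c x ^ 2) ^ 2 -
        c ^ 2 * kap c x * (w x / cosR c x) ^ 2 with hf2
  have hf1c : Continuous f1 := by
    have : Continuous fun x => (1 - cosR c x - cosR c x ^ 2) * kap c x / cosR c x :=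
      Continuous.div (by fun_prop) hCc hCne
    fun_prop
  have hf2c : Continuous f2 := by
    have h1 : Continuous fun x => w x / cosR c x := hwc.div hCc hCne
    have h2 : Continuous fun x => w' x / cosR c x := hw'.div hCc hCne
    have h3 : Continuous fun x => sinC c ^ 2 * Real.sin x * Real.cos x / cosR c x :=
      Continuous.div (by fun_prop) hCc hCne
    have h4 : Continuous fun x =>
        w x * (sinC c ^ 2 * Real.sin x * Real.cos x / cosR c x) / cosR c x ^ 2 :=
      Continuous.div (by fun_prop) (by fun_prop) fun x => pow_ne_zero 2 (hCne x)
    fun_prop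
  have hbd : ∀ x, HasDerivAt b (f1 x - f2 x) x := by
    intro x
    have hC := hCpos x
    have hCd := hasDerivAt_cosR hc hc1 x
    have h1 := ((((Real.hasDerivAt_sin x).const_mul (sinC c ^ 2)).mul
      (Real.hasDerivAt_cos x)).div (hCd.mul (hCd.const_add 1)) (by
        have : 0 < cosR c x * (1 + cosR c x) := by positivity
        exact this.ne')).mul ((hw x).pow 2)
    refine h1.congr_deriv ?_
    have hS := sq_sinC_mul_sin_sq hc hc1 x
    have hK := sq_sinC_mul_cos_sq hc hc1 x
    have hs := sinC_sq hc hc1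
    have e1 : f1 x - f2 x = 2 * (sinC c ^ 2 * Real.sin x * Real.cos x) /
        (cosR c x * (1 + cosR c x)) * w x * w' x +
        ((1 - cosR c x - cosR c x ^ 2) / (cosR c x * (1 + cosR c x)) -
        (sinC c ^ 2 * Real.sin x ^ 2) * (sinC c ^ 2 * Real.cos x ^ 2) /
          (cosR c x ^ 3 * (1 + cosR c x)) + c ^ 2 / (cosR c x ^ 2 * (1 + cosR c x))) * w x ^ 2 := by
      simp only [hf1, hf2, kap]
      field_simp
      ring
    rw [e1]
    have e2 : ((sinC c ^ 2 * Real.cos x * Real.cos x + sinC c ^ 2 * Real.sin x * -Real.sin x) *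
        (cosR c x * (1 + cosR c x)) - sinC c ^ 2 * Real.sin x * Real.cos x *
        (sinC c ^ 2 * Real.sin x * Real.cos x / cosR c x * (1 + cosR c x) + cosR c x *
          (sinC c ^ 2 * Real.sin x * Real.cos x / cosR c x))) / (cosR c x * (1 + cosR c x)) ^ 2 =
        (sinC c ^ 2 * Real.cos x ^ 2 - sinC c ^ 2 * Real.sin x ^ 2) / (cosR c x * (1 + cosR c x)) -
        (sinC c ^ 2 * Real.sin x ^ 2) * (sinC c ^ 2 * Real.cos x ^ 2) * (1 + 2 * cosR c x) /
          (cosR c x ^ 3 * (1 + cosR c x) ^ 2) := by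
      field_simp
      ring
    have e3 : (sinC c ^ 2 * Real.cos x ^ 2 - sinC c ^ 2 * Real.sin x ^ 2) /
          (cosR c x * (1 + cosR c x)) -
        (sinC c ^ 2 * Real.sin x ^ 2) * (sinC c ^ 2 * Real.cos x ^ 2) * (1 + 2 * cosR c x) /
          (cosR c x ^ 3 * (1 + cosR c x) ^ 2) =
        (1 - cosR c x - cosR c x ^ 2) / (cosR c x * (1 + cosR c x)) -
        (sinC c ^ 2 * Real.sin x ^ 2) * (sinC c ^ 2 * Real.cos x ^ 2) /
          (cosR c x ^ 3 * (1 + cosR c x)) + c ^ 2 / (cosR c x ^ 2 * (1 + cosR c x)) := by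
      rw [hS, hK]
      field_simp
      ring
    rw [← e3, ← e2]
    simp only [Pi.mul_apply, Pi.pow_apply, Pi.div_apply]
    field_simp
    ring
  have h := intervalIntegral.integral_eq_sub_of_hasDerivAt
    (a := -(Real.pi / 2)) (b := -(Real.pi / 2) + 2 * Real.pi) (fun x _ => hbd x)
    ((hf1c.sub hf2c).intervalIntegrable _ _)
  have hb0 : b (-(Real.pi / 2)) = 0 := by simp [hb]
  have hb1 : b (-(Real.pi / 2) + 2 * Real.pi) = 0 := by
    simp [hb, Real.cos_add_two_pi]
  rw [intervalIntegral.integral_sub (hf1c.intervalIntegrable _ _) (hf2c.intervalIntegrable _ _),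
    hb0, hb1, sub_zero, sub_eq_zero] at h
  exact h
end Poincare

/-! ### Functions of two variables: the dependence on the angle θ. -/

theorem intervalIntegral_swap_of_continuous {f : ℝ → ℝ → ℝ}
    (hf : Continuous (Function.uncurry f)) {a b a' b' : ℝ} :
    ∫ x in a..b, ∫ y in a'..b', f x y = ∫ y in a'..b', ∫ x in a..b, f x y := by
  refine intervalIntegral_intervalIntegral_swap ?_
  exact (hf.continuousOn.integrableOn_compact (isCompact_uIcc.prod isCompact_uIcc)).mono_set
    (prod_mono uIoc_subset_uIcc uIoc_subset_uIcc)

theorem continuous_intervalIntegral {f : ℝ → ℝ → ℝ}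
    (hf : Continuous fun z : ℝ × ℝ => f z.1 z.2) (a b : ℝ) :
    Continuous fun x => ∫ y in a..b, f x y :=
  intervalIntegral.continuous_parametric_intervalIntegral_of_continuous' hf a b

/-- A nonnegative continuous function with nonpositive double integral vanishes. -/
theorem eq_zero_of_double_integral_nonpos {a b a' b' : ℝ} (hab : a < b) (hab' : a' < b')
    {f : ℝ → ℝ → ℝ} (hf : Continuous fun z : ℝ × ℝ => f z.1 z.2)
    (h0 : ∀ x y, 0 ≤ f x y) (hi : ∫ x in a..b, ∫ y in a'..b', f x y ≤ 0) :
    ∀ x ∈ Icc a b, ∀ y ∈ Icc a' b', f x y = 0 := by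
  intro x hx
  have h1 := eq_zero_of_integral_nonpos hab (continuous_intervalIntegral hf a' b').continuousOn
    (fun x _ => intervalIntegral.integral_nonneg hab'.le fun y _ => h0 x y) hi x hx
  exact eq_zero_of_integral_nonpos hab' (Continuous.continuousOn
    (hf.comp (continuous_const.prodMk continuous_id))) (fun y _ => h0 x y) h1.le

/-- Cauchy–Schwarz for the integral of f' between the two points; the bound has constant 1 because
the θ-circle has length 1. -/
theorem sq_sub_le_integral_sq {f f' : ℝ → ℝ} (hf : ∀ x, HasDerivAt f (f' x) x)
    (hf' : Continuous f') {x y : ℝ} (hx : x ∈ Icc (0 : ℝ) 1) (hy : y ∈ Icc (0 : ℝ) 1) :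
    (f x - f y) ^ 2 ≤ ∫ t in (0 : ℝ)..1, f' t ^ 2 := by
  wlog hyx : y ≤ x generalizing x y
  · have := this hy hx (le_of_not_ge hyx)
    rwa [← neg_sq, neg_sub]
  rw [← intervalIntegral.integral_eq_sub_of_hasDerivAt (fun t _ => hf t)
    (hf'.intervalIntegrable _ _)]
  have h1 := sq_integral_mul_le hyx (continuous_const (y := (1 : ℝ))) hf' fun _ => zero_le_one
  simp only [one_mul, intervalIntegral.integral_const, smul_eq_mul, mul_one] at h1
  have h2 : ∫ t in y..x, f' t ^ 2 ≤ ∫ t in (0 : ℝ)..1, f' t ^ 2 :=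
    intervalIntegral.integral_mono_interval hy.1 hyx hx.2
      (Eventually.of_forall fun t => sq_nonneg (f' t))
      ((hf'.pow 2).intervalIntegrable _ _)
  have h3 : 0 ≤ ∫ t in y..x, f' t ^ 2 :=
    intervalIntegral.integral_nonneg hyx fun t _ => sq_nonneg (f' t)
  nlinarith [hx.2, hy.1]

section

variable {c : ℝ} {U Uτ Uθ : ℝ → ℝ → ℝ}

/-- The average over a circle of the variation of the weighted mean in the other direction. -/
theorem sq_mean_le (hc : 0 < c) (hc1 : c < 1)
    (hU : Continuous fun z : ℝ × ℝ => U z.1 z.2) (hUθc : Continuous fun z : ℝ × ℝ => Uθ z.1 z.2)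
    (hUθ : ∀ τ θ, HasDerivAt (fun θ => U τ θ) (Uθ τ θ) θ)
    (hmean : ∫ θ in (0 : ℝ)..1, ∫ τ in (-(Real.pi / 2))..(-(Real.pi / 2) + 2 * Real.pi),
      kap c τ * (U τ θ / cosR c τ) = 0) {θ : ℝ} (hθ : θ ∈ Icc (0 : ℝ) 1) :
    (∫ τ in (-(Real.pi / 2))..(-(Real.pi / 2) + 2 * Real.pi), kap c τ * (U τ θ / cosR c τ)) ^ 2 ≤
      totalKap c * ∫ θ in (0 : ℝ)..1, ∫ τ in (-(Real.pi / 2))..(-(Real.pi / 2) + 2 * Real.pi),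
        kap c τ / cosR c τ ^ 2 * Uθ τ θ ^ 2 := by
  have hCc := continuous_cosR c
  have hkc := continuous_kap c
  have hCne : ∀ x, cosR c x ≠ 0 := fun x => (cosR_pos hc hc1 x).ne'
  have hab : -(Real.pi / 2) < -(Real.pi / 2) + 2 * Real.pi := by linarith [Real.pi_pos]
  set a := -(Real.pi / 2)
  set b := -(Real.pi / 2) + 2 * Real.pi
  have hUs : ∀ θ, Continuous fun τ => U τ θ := fun θ =>
    hU.comp (continuous_id.prodMk continuous_const)
  have hUθs : ∀ τ, Continuous fun θ => Uθ τ θ := fun τ =>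
    hUθc.comp (continuous_const.prodMk continuous_id)
  have hkC2 : Continuous fun τ => kap c τ / cosR c τ ^ 2 :=
    hkc.div (hCc.pow 2) fun x => pow_ne_zero 2 (hCne x)
  have hmc : ∀ θ, Continuous fun τ => kap c τ * (U τ θ / cosR c τ) := fun θ =>
    hkc.mul ((hUs θ).div hCc hCne)
  set M : ℝ → ℝ := fun θ => ∫ τ in a..b, kap c τ * (U τ θ / cosR c τ) with hM
  have hMc : Continuous M := by
    apply continuous_intervalIntegral
    exact (hkc.comp continuous_snd).mul (Continuous.div (hU.comp continuous_swap)
      (hCc.comp continuous_snd) fun z => hCne z.2)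
  have hc2 : Continuous fun z : ℝ × ℝ => kap c z.1 / cosR c z.1 ^ 2 * Uθ z.1 z.2 ^ 2 :=
    (hkC2.comp continuous_fst).mul (hUθc.pow 2)
  have hswap : ∫ θ in (0 : ℝ)..1, ∫ τ in a..b, kap c τ / cosR c τ ^ 2 * Uθ τ θ ^ 2 =
      ∫ τ in a..b, kap c τ / cosR c τ ^ 2 * ∫ θ in (0 : ℝ)..1, Uθ τ θ ^ 2 := by
    rw [← intervalIntegral_swap_of_continuous
      (f := fun τ θ => kap c τ / cosR c τ ^ 2 * Uθ τ θ ^ 2) hc2]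
    simp_rw [intervalIntegral.integral_const_mul]
  have hIc : Continuous fun τ => ∫ θ in (0 : ℝ)..1, Uθ τ θ ^ 2 :=
    continuous_intervalIntegral (hUθc.pow 2) _ _
  set K := ∫ θ in (0 : ℝ)..1, ∫ τ in a..b, kap c τ / cosR c τ ^ 2 * Uθ τ θ ^ 2 with hK
  have hdiff : ∀ φ ∈ Icc (0 : ℝ) 1, (M θ - M φ) ^ 2 ≤ totalKap c * K := by
    intro φ hφ
    have h1 : M θ - M φ = ∫ τ in a..b, kap c τ * ((U τ θ - U τ φ) / cosR c τ) := by
      simp only [hM]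
      rw [← intervalIntegral.integral_sub ((hmc θ).intervalIntegrable _ _)
        ((hmc φ).intervalIntegrable _ _)]
      refine intervalIntegral.integral_congr fun τ _ => ?_
      ring
    have hdc : Continuous fun τ => (U τ θ - U τ φ) / cosR c τ :=
      ((hUs θ).sub (hUs φ)).div hCc hCne
    rw [h1]
    refine (sq_integral_mul_le hab.le hkc hdc fun x => (kap_pos c x).le).trans ?_
    refine mul_le_mul_of_nonneg_left ?_ (totalKap_pos c).le
    rw [hswap]
    refine intervalIntegral.integral_mono_on hab.le ((hkc.mul (hdc.pow 2)).intervalIntegrable _ _)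
      ((hkC2.mul hIc).intervalIntegrable _ _) fun τ _ => ?_
    rw [div_pow, mul_div_assoc', div_mul_eq_mul_div]
    refine div_le_div_of_nonneg_right ?_ (sq_nonneg _)
    exact mul_le_mul_of_nonneg_left (sq_sub_le_integral_sq (hUθ τ) (hUθs τ) hθ hφ) (kap_pos c τ).le
  -- Since M has average zero over φ, M(θ) is the average of M(θ) - M(φ).
  have h2 := sq_integral_mul_le (zero_le_one' ℝ) (f := fun φ => M θ - M φ)
    (continuous_const (y := (1 : ℝ))) (continuous_const.sub hMc) fun _ => zero_le_one
  simp only [one_mul] at h2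
  rw [intervalIntegral.integral_sub (continuous_const.intervalIntegrable _ _)
    (hMc.intervalIntegrable _ _), hmean] at h2
  simp only [intervalIntegral.integral_const, sub_zero, one_smul, one_mul] at h2
  refine h2.trans ?_
  have h3 : ∫ φ in (0 : ℝ)..1, (M θ - M φ) ^ 2 ≤ ∫ _ in (0 : ℝ)..1, totalKap c * K :=
    intervalIntegral.integral_mono_on zero_le_one
      (((continuous_const.sub hMc).pow 2).intervalIntegrable _ _)
      (continuous_const.intervalIntegrable _ _) hdiff
  simpa using h3

/-- The claim amounts to c² < s²(1 + C)²C. It follows from s² ≥ 3/4, C ≥ c and c² < (3/4)c; this is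
where c must be bounded away from 1. -/
theorem sq_lt_sinC_sq_mul (hc : 0 < c) (hc2 : c ≤ 1 / 2) (x : ℝ) :
    c ^ 2 * (kap c x / cosR c x ^ 2) < sinC c ^ 2 * (1 + cosR c x) / cosR c x := by
  have hc1 : c < 1 := by linarith
  have hC := cosR_pos hc hc1 x
  have hC1 := le_cosR hc hc1 x
  rw [sinC_sq hc hc1, kap, div_eq_mul_inv (1 + cosR c x)⁻¹, ← mul_inv, ← div_eq_mul_inv,
    div_lt_div_iff₀ (by positivity) hC]
  have h1 : c ^ 2 * 1 < (1 - c ^ 2) * (1 + cosR c x) ^ 2 * cosR c x := by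
    have h2 : (3 : ℝ) / 4 ≤ 1 - c ^ 2 := by nlinarith
    have h3 : 1 ≤ (1 + cosR c x) ^ 2 := by nlinarith
    have h4 : (3 : ℝ) / 4 * 1 * c ≤ (1 - c ^ 2) * (1 + cosR c x) ^ 2 * cosR c x := by gcongr
    nlinarith
  nlinarith

/-- The integrand of the index form, in the parametrization of the bubble. -/
def indexDensity (c τ u uτ uθ : ℝ) : ℝ :=
  cosR c τ * kap c τ * uτ ^ 2 + (1 - cosR c τ - cosR c τ ^ 2) * kap c τ / cosR c τ * u ^ 2 +
    sinC c ^ 2 * (1 + cosR c τ) / cosR c τ * uθ ^ 2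

/-- The one-dimensional inequality on each curve θ = const loses only a multiple of the squared
mean, and the u_θ² term more than pays for it. Nonpositivity first kills u_θ, then puts the
remaining curve in the equality case of `poincare_circle`. -/
theorem eq_mul_sin_of_integral_nonpos (hc : 0 < c) (hc2 : c ≤ 1 / 2)
    (hU : Continuous fun z : ℝ × ℝ => U z.1 z.2) (hUτc : Continuous fun z : ℝ × ℝ => Uτ z.1 z.2)
    (hUθc : Continuous fun z : ℝ × ℝ => Uθ z.1 z.2)
    (hUτ : ∀ τ θ, HasDerivAt (fun τ => U τ θ) (Uτ τ θ) τ)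
    (hUθ : ∀ τ θ, HasDerivAt (fun θ => U τ θ) (Uθ τ θ) θ)
    (hper : ∀ θ, U (-(Real.pi / 2) + 2 * Real.pi) θ = U (-(Real.pi / 2)) θ)
    (hmean : ∫ θ in (0 : ℝ)..1, ∫ τ in (-(Real.pi / 2))..(-(Real.pi / 2) + 2 * Real.pi),
      kap c τ * (U τ θ / cosR c τ) = 0)
    (hQ : ∫ θ in (0 : ℝ)..1, ∫ τ in (-(Real.pi / 2))..(-(Real.pi / 2) + 2 * Real.pi),
      indexDensity c τ (U τ θ) (Uτ τ θ) (Uθ τ θ) ≤ 0) :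
    ∃ β : ℝ, ∀ τ ∈ Icc (-(Real.pi / 2)) (-(Real.pi / 2) + 2 * Real.pi), ∀ θ ∈ Icc (0 : ℝ) 1,
      U τ θ = β * Real.sin τ := by
  have hc1 : c < 1 := by linarith
  have hCc := continuous_cosR c
  have hkc := continuous_kap c
  have hCne : ∀ x, cosR c x ≠ 0 := fun x => (cosR_pos hc hc1 x).ne'
  have hB := totalKap_pos c
  have hM := fun θ hθ => sq_mean_le hc hc1 hU hUθc hUθ hmean (θ := θ) hθ
  have hab : -(Real.pi / 2) < -(Real.pi / 2) + 2 * Real.pi := by linarith [Real.pi_pos]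
  have hUs : ∀ θ, Continuous fun τ => U τ θ := fun θ =>
    hU.comp (continuous_id.prodMk continuous_const)
  have hUτs : ∀ θ, Continuous fun τ => Uτ τ θ := fun θ =>
    hUτc.comp (continuous_id.prodMk continuous_const)
  have hη : ∀ θ τ, HasDerivAt (fun τ => U τ θ / cosR c τ) (Uτ τ θ / cosR c τ -
      U τ θ * (sinC c ^ 2 * Real.sin τ * Real.cos τ / cosR c τ) / cosR c τ ^ 2) τ := fun θ τ => by
    refine ((hUτ τ θ).div (hasDerivAt_cosR hc hc1 τ) (hCne τ)).congr_deriv ?_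
    have := hCne τ
    field_simp
  have hη' : ∀ θ, Continuous fun τ => Uτ τ θ / cosR c τ -
      U τ θ * (sinC c ^ 2 * Real.sin τ * Real.cos τ / cosR c τ) / cosR c τ ^ 2 := fun θ => by
    refine ((hUτs θ).div hCc hCne).sub (Continuous.div ((hUs θ).mul
      (Continuous.div (by fun_prop) hCc hCne)) (by fun_prop) fun x => pow_ne_zero 2 (hCne x))
  have hηper : ∀ θ, U (-(Real.pi / 2) + 2 * Real.pi) θ / cosR c (-(Real.pi / 2) + 2 * Real.pi) =
      U (-(Real.pi / 2)) θ / cosR c (-(Real.pi / 2)) := fun θ => by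
    rw [hper]; simp [cosR, Real.cos_add_two_pi]
  have hvar := fun θ => poincare_circle_var hc hc1 (hη θ) (hη' θ) (hηper θ)
  have hcf := fun θ => curveForm_eq hc hc1 (fun τ => hUτ τ θ) (hUτs θ)
  simp_rw [← hcf] at hvar
  have hpc := poincare_circle hc hc1 (hη 0) (hη' 0) (hηper 0)
  rw [← hcf] at hpc
  set a := -(Real.pi / 2)
  set b := -(Real.pi / 2) + 2 * Real.pi
  set K := ∫ θ in (0 : ℝ)..1, ∫ τ in a..b, kap c τ / cosR c τ ^ 2 * Uθ τ θ ^ 2 with hK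
  have hkC : Continuous fun τ => kap c τ / cosR c τ ^ 2 :=
    hkc.div (hCc.pow 2) fun x => pow_ne_zero 2 (hCne x)
  have hw : Continuous fun τ => sinC c ^ 2 * (1 + cosR c τ) / cosR c τ :=
    Continuous.div (by fun_prop) hCc hCne
  have hp : Continuous fun τ => (1 - cosR c τ - cosR c τ ^ 2) * kap c τ / cosR c τ :=
    Continuous.div (by fun_prop) hCc hCne
  have hUsw : Continuous fun z : ℝ × ℝ => U z.2 z.1 := hU.comp continuous_swap
  have hUτsw : Continuous fun z : ℝ × ℝ => Uτ z.2 z.1 := hUτc.comp continuous_swap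
  have hUθsw : Continuous fun z : ℝ × ℝ => Uθ z.2 z.1 := hUθc.comp continuous_swap
  set F : ℝ → ℝ := fun θ => curveForm c (fun τ => U τ θ) (fun τ => Uτ τ θ) with hF
  set N : ℝ → ℝ := fun θ => ∫ τ in a..b, sinC c ^ 2 * (1 + cosR c τ) / cosR c τ * Uθ τ θ ^ 2 with hN
  set L : ℝ → ℝ := fun θ => ∫ τ in a..b, kap c τ / cosR c τ ^ 2 * Uθ τ θ ^ 2 with hL
  have hc1' : Continuous fun z : ℝ × ℝ => cosR c z.2 * kap c z.2 * Uτ z.2 z.1 ^ 2 +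
      (1 - cosR c z.2 - cosR c z.2 ^ 2) * kap c z.2 / cosR c z.2 * U z.2 z.1 ^ 2 :=
    (((hCc.comp continuous_snd).mul (hkc.comp continuous_snd)).mul (hUτsw.pow 2)).add
      ((hp.comp continuous_snd).mul (hUsw.pow 2))
  have hc2' : Continuous fun z : ℝ × ℝ =>
      sinC c ^ 2 * (1 + cosR c z.2) / cosR c z.2 * Uθ z.2 z.1 ^ 2 :=
    (hw.comp continuous_snd).mul (hUθsw.pow 2)
  have hc3' : Continuous fun z : ℝ × ℝ => kap c z.2 / cosR c z.2 ^ 2 * Uθ z.2 z.1 ^ 2 :=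
    (hkC.comp continuous_snd).mul (hUθsw.pow 2)
  have hFc : Continuous F := continuous_intervalIntegral hc1' a b
  have hNc : Continuous N := continuous_intervalIntegral hc2' a b
  have hLc : Continuous L := continuous_intervalIntegral hc3' a b
  have hsplit : ∫ θ in (0 : ℝ)..1, (F θ + N θ) ≤ 0 := by
    refine le_of_eq_of_le (intervalIntegral.integral_congr fun θ _ => ?_) hQ
    simp only [hF, hN, curveForm, indexDensity]
    rw [← intervalIntegral.integral_add]
    · exact (hc1'.comp (continuous_const.prodMk continuous_id)).intervalIntegrable _ _
    · exact (hc2'.comp (continuous_const.prodMk continuous_id)).intervalIntegrable _ _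
  -- The total weight cancels between the loss in `hvar` and the bound on the mean in `hM`, leaving
  -- a bound that does not depend on θ.
  have hlow : ∀ θ ∈ Icc (0 : ℝ) 1, -(c ^ 2 * K) ≤ F θ := by
    intro θ hθ
    have h1 := hvar θ
    have h2 := hM θ hθ
    refine le_trans ?_ h1
    rw [neg_le_neg_iff, div_mul_eq_mul_div, div_le_iff₀ hB]
    nlinarith [sq_nonneg c]
  -- Adding the two bounds leaves an integral of u_θ² with a strictly positive coefficient.
  have hgap : ∫ θ in (0 : ℝ)..1, ∫ τ in a..b, (sinC c ^ 2 * (1 + cosR c τ) / cosR c τ -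
      c ^ 2 * (kap c τ / cosR c τ ^ 2)) * Uθ τ θ ^ 2 ≤ 0 := by
    have h1 : ∀ θ, ∫ τ in a..b, (sinC c ^ 2 * (1 + cosR c τ) / cosR c τ -
        c ^ 2 * (kap c τ / cosR c τ ^ 2)) * Uθ τ θ ^ 2 = N θ - c ^ 2 * L θ := fun θ => by
      simp only [hN, hL]
      rw [← intervalIntegral.integral_const_mul, ← intervalIntegral.integral_sub]
      · refine intervalIntegral.integral_congr fun τ _ => ?_
        ring
      · exact (hc2'.comp (continuous_const.prodMk continuous_id)).intervalIntegrable _ _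
      · exact (continuous_const.mul
          (hc3'.comp (continuous_const.prodMk continuous_id))).intervalIntegrable _ _
    have h3 : IntervalIntegrable (fun θ => c ^ 2 * L θ) volume 0 1 :=
      (continuous_const.mul hLc).intervalIntegrable _ _
    simp_rw [h1]
    rw [intervalIntegral.integral_sub (hNc.intervalIntegrable _ _) h3, intervalIntegral.integral_const_mul]
    rw [intervalIntegral.integral_add (hFc.intervalIntegrable _ _)
      (hNc.intervalIntegrable _ _)] at hsplit
    have h2 : ∫ _ in (0 : ℝ)..1, -(c ^ 2 * K) ≤ ∫ θ in (0 : ℝ)..1, F θ :=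
      intervalIntegral.integral_mono_on zero_le_one (continuous_const.intervalIntegrable _ _)
        (hFc.intervalIntegrable _ _) hlow
    simp only [intervalIntegral.integral_const, sub_zero, one_smul] at h2
    change _ - c ^ 2 * K ≤ 0
    linarith
  have hUθ0 : ∀ θ ∈ Icc (0 : ℝ) 1, ∀ τ ∈ Icc a b, Uθ τ θ = 0 := by
    intro θ hθ τ hτ
    have h1 := eq_zero_of_double_integral_nonpos (zero_lt_one' ℝ) hab
      (f := fun θ τ => (sinC c ^ 2 * (1 + cosR c τ) / cosR c τ -
        c ^ 2 * (kap c τ / cosR c τ ^ 2)) * Uθ τ θ ^ 2)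
      (((hw.comp continuous_snd).sub (continuous_const.mul (hkC.comp continuous_snd))).mul
        (hUθsw.pow 2))
      (fun θ τ => mul_nonneg (sub_nonneg.2 (sq_lt_sinC_sq_mul hc hc2 τ).le) (sq_nonneg _))
      hgap θ hθ τ hτ
    have h2 := (mul_eq_zero.1 h1).resolve_left (sub_pos.2 (sq_lt_sinC_sq_mul hc hc2 τ)).ne'
    exact (pow_eq_zero_iff two_ne_zero).1 h2
  have hint0 : ∀ θ ∈ Icc (0 : ℝ) 1, ∀ k : ℝ → ℝ, ∫ τ in a..b, k τ * Uθ τ θ ^ 2 = 0 := by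
    intro θ hθ k
    rw [← intervalIntegral.integral_zero (a := a) (b := b) (μ := volume)]
    refine intervalIntegral.integral_congr fun τ hτ => ?_
    rw [uIcc_of_le hab.le] at hτ
    simp [hUθ0 θ hθ τ hτ]
  have hK0 : K = 0 := by
    refine (intervalIntegral.integral_congr (g := fun _ => (0 : ℝ)) fun θ hθ => ?_).trans
      intervalIntegral.integral_zero
    rw [uIcc_of_le zero_le_one] at hθ
    exact hint0 θ hθ _
  -- With u_θ = 0 the form F is nonnegative and has nonpositive integral, so it vanishes at every θ;
  -- the curve θ = 0 is enough.
  have hF0 : F 0 = 0 := by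
    refine eq_zero_of_integral_nonpos zero_lt_one hFc.continuousOn (fun θ hθ => ?_) ?_ 0
      (left_mem_Icc.2 zero_le_one)
    · have := hlow θ hθ
      rwa [hK0, mul_zero, neg_zero] at this
    · refine le_of_eq_of_le (intervalIntegral.integral_congr fun θ hθ => ?_) hsplit
      rw [uIcc_of_le zero_le_one] at hθ
      simp only [hN]
      rw [hint0 θ hθ, add_zero]
  have hM0 : ∫ τ in a..b, kap c τ * (U τ 0 / cosR c τ) = 0 := by
    have := hM 0 (left_mem_Icc.2 zero_le_one)
    rw [hK0, mul_zero] at this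
    exact (pow_eq_zero_iff two_ne_zero).1 (le_antisymm this (sq_nonneg _))
  obtain ⟨β, hβ⟩ := (hpc hM0).2 hF0.le
  refine ⟨β, fun τ hτ θ hθ => ?_⟩
  have h1 : U τ θ - U τ 0 = 0 := by
    rw [← intervalIntegral.integral_eq_sub_of_hasDerivAt (fun t _ => hUθ τ t)
      ((hUθc.comp (continuous_const.prodMk continuous_id)).intervalIntegrable _ _)]
    refine (intervalIntegral.integral_congr (g := fun _ => (0 : ℝ)) fun φ hφ => ?_).trans
      intervalIntegral.integral_zero
    rw [uIcc_of_le hθ.1] at hφ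
    exact hUθ0 φ ⟨hφ.1, hφ.2.trans hθ.2⟩ τ hτ
  have h2 := hβ τ hτ
  rw [div_left_inj' (hCne τ)] at h2
  linarith

end

/-! ### Integration over the bubbles -/

theorem isOpenQuotientMap_coe_prod : IsOpenQuotientMap
    (Prod.map (fun t : ℝ => (t : AddCircle (2 * Real.pi))) (fun t : ℝ => (t : AddCircle (1 : ℝ)))) :=
  QuotientAddGroup.isOpenQuotientMap_mk.prodMap QuotientAddGroup.isOpenQuotientMap_mk

/-- The τ-interval starts at -π/2 so that the reflection τ ↦ π - τ exchanges its two halves. -/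
theorem integral_torus {G : Torus → ℝ} {f : ℝ → ℝ → ℝ} (hf : Continuous fun z : ℝ × ℝ => f z.1 z.2)
    (hG : ∀ τ θ : ℝ, G ((τ : AddCircle (2 * Real.pi)), (θ : AddCircle (1 : ℝ))) = f τ θ) :
    ∫ p, G p = ∫ θ in (0 : ℝ)..1, ∫ τ in (-(Real.pi / 2))..(-(Real.pi / 2) + 2 * Real.pi), f τ θ := by
  have hc : Continuous G := by
    rw [isOpenQuotientMap_coe_prod.isQuotientMap.continuous_iff]
    exact hf.congr fun z => (hG z.1 z.2).symm
  have hi : Integrable G ((volume : Measure (AddCircle (2 * Real.pi))).prod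
      (volume : Measure (AddCircle (1 : ℝ)))) :=
    hc.integrable_of_hasCompactSupport (HasCompactSupport.of_compactSpace G)
  rw [Measure.volume_eq_prod, integral_prod_symm G hi,
    ← AddCircle.intervalIntegral_preimage 1 0]
  rw [zero_add]
  refine intervalIntegral.integral_congr fun θ _ => ?_
  rw [← AddCircle.intervalIntegral_preimage (2 * Real.pi) (-(Real.pi / 2))]
  exact intervalIntegral.integral_congr fun τ _ => hG τ θ

theorem areaDensity_nonneg (c : ℝ) (p : Torus) : 0 ≤ areaDensity c p :=
  div_nonneg (Real.sqrt_nonneg _) (by positivity)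

theorem integral_area {c : ℝ} (hc : 0 < c) (hc1 : c < 1) (F : Torus × ℝ → ℝ) :
    ∫ q, F q ∂area c = ∫ p : Torus, areaDensity c p * F (emb c p) := by
  rw [area, (isClosedEmbedding_emb hc hc1).measurableEmbedding.integral_map,
    integral_withDensity_eq_integral_toReal_smul (measurable_areaDensity c).ennreal_ofReal
      (Eventually.of_forall fun _ => ENNReal.ofReal_lt_top)]
  refine integral_congr_ae (Eventually.of_forall fun p => ?_)
  dsimp only
  rw [ENNReal.toReal_ofReal (areaDensity_nonneg c p), smul_eq_mul]

/-! ### Vertical Killing fields -/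

/-- The vertical vector field. -/
def vertical (β : ℝ) (p : Torus × ℝ) : TangentSpace J p := (β • vy : Space)

theorem contMDiff_vertical (β : ℝ) :
    ContMDiff J J.tangent ∞ (fun p => (⟨p, vertical β p⟩ : TangentBundle J (Torus × ℝ))) := by
  apply contMDiff_of_comp_projM
  have h1 : ContMDiff 𝓘(ℝ, Space).tangent J.tangent ∞ (tangentMap 𝓘(ℝ, Space) J projM) :=
    contMDiff_projM.contMDiff_tangentMap (by simp)
  have h2 : ContMDiff 𝓘(ℝ, Space) 𝓘(ℝ, Space).tangent ∞
      (fun x : Space => (⟨x, (β • vy : Space)⟩ : TangentBundle 𝓘(ℝ, Space) Space)) := fun x =>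
    contMDiffAt_vectorSpace_iff_contDiffAt.2 contDiffAt_const
  refine (h1.comp h2).congr fun x => ?_
  have h3 := (hasMFDerivAt_projM x).mfderiv
  simp only [Function.comp_apply, tangentMap, h3]
  rfl

theorem coordField_vertical (β : ℝ) (p : Torus × ℝ) {x : Space} (hx : x ∈ (extChartAt J p).target) :
    coordField (vertical β) p x = β • vy := by
  unfold coordField
  rw [extChartAt_symm_eq_projM, mfderiv_extChartAt_proj p hx]
  rfl

/-- The metric coefficients depend on r only, and the field is constant in every chart. -/
theorem isKilling_vertical (β : ℝ) : IsKilling (productMetric metric.inner) (vertical β) := by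
  refine ⟨contMDiff_vertical β, fun p v w => ?_⟩
  have hx := mem_extChartAt_target (I := J) p
  have h1 : coordField (vertical β) p =ᶠ[𝓝 (extChartAt J p p)] fun _ => (β • vy : Space) := by
    filter_upwards [(isOpen_extChartAt_target p).mem_nhds hx] with x hx
    exact coordField_vertical β p hx
  have h2 : fderiv ℝ (coordField (vertical β) p) (extChartAt J p p) = 0 := by
    rw [h1.fderiv_eq]; exact fderiv_const_apply _
  have h3 := hasFDerivAt_warped (G := spaceMetric) (B := sqForm dr + sqForm dy) (α₀ := dr)
    (α₁ := dt) (fun _ => rfl) (differentiable_warp (dr (extChartAt J p p))).hasDerivAt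
  rw [lieDerivMetric, coordMetric_productMetric, h2, coordField_vertical β p hx, h3.fderiv]
  simp

/-! ### Stability -/

theorem plane_eq_sum (a b : ℝ) : (!₂[a, b] : Plane) =
    a • EuclideanSpace.single 0 1 + b • EuclideanSpace.single 1 1 := by
  ext i
  fin_cases i <;> simp

/-- The differential of `u`, as a form on the coordinate space. -/
def differential (u : Torus × ℝ → ℝ) (p : Torus × ℝ) : Space →L[ℝ] ℝ := mfderiv J 𝓘(ℝ, ℝ) u p

theorem hasFDerivAt_comp_projM {u : Torus × ℝ → ℝ} (hu : ContMDiff J 𝓘(ℝ, ℝ) ∞ u) (x : Space) :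
    HasFDerivAt (u ∘ projM) (differential u (projM x)) x := by
  have h1 : MDifferentiableAt J 𝓘(ℝ, ℝ) u (projM x) := hu.mdifferentiableAt (by simp)
  exact hasMFDerivAt_iff_hasFDerivAt.1 (HasMFDerivAt.comp x h1.hasMFDerivAt (hasMFDerivAt_projM x))

section

variable {c : ℝ}

theorem sin_dr_of_projM_eq {x y : Space} (h : projM x = projM y) :
    Real.sin (dr x) = Real.sin (dr y) :=
  congrArg (fun q : Torus × ℝ => sinT q.1) h

theorem cos_dr_of_projM_eq {x y : Space} (h : projM x = projM y) :
    Real.cos (dr x) = Real.cos (dr y) :=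
  congrArg (fun q : Torus × ℝ => cosT q.1) h

theorem dy_of_projM_eq {x y : Space} (h : projM x = projM y) : dy x = dy y :=
  congrArg (fun q : Torus × ℝ => q.2) h

theorem levelFun_param (hc : 0 < c) (hc1 : c < 1) (z : Plane) : levelFun c (param c z) = 0 := by
  rw [levelFun_eq_zero_iff, dr_param, dy_param, cosh_curveY hc hc1, cos_curveR]

/-- The integrand of the index form. -/
theorem index_integrand_eq (hc : 0 < c) (hc1 : c < 1) {u : Torus × ℝ → ℝ}
    (hu : ContMDiff J 𝓘(ℝ, ℝ) ∞ u) (z : Plane) {p : Torus × ℝ} (hp : p = projM (param c z)) :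
    tangentialGradSq (coordMetric (productMetric metric.inner) p)
      (coordFun J (bubble c hc hc1).rho p) (coordFun J u p) (extChartAt J p p) +
      (bubble c hc hc1).potential p * u p ^ 2 =
    differential u p (tangentVec (Real.cos (z 0)) (Real.sin (z 0))) ^ 2 +
      (1 + cosR c (z 0)) ^ 2 * differential u p vt ^ 2 +
      (1 - cosR c (z 0) - cosR c (z 0) ^ 2) / sinC c ^ 2 * u p ^ 2 := by
  have hs := sinC_pos hc hc1
  have hx : projM (extChartAt J p p) = projM (param c z) := (projM_extChartAt p).trans hp
  have hl : levelFun c (extChartAt J p p) = 0 := by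
    rw [← level_projM, hx, level_projM, levelFun_param hc hc1]
  have hl' := levelFun_eq_zero_iff.1 hl
  have hr := cos_pos_of_levelFun_nonpos hc hl.le
  have hcos := cos_dr_of_projM_eq hx
  have hsin := sin_dr_of_projM_eq hx
  have hdy := dy_of_projM_eq hx
  rw [dr_param, cos_curveR] at hcos
  rw [dr_param, sin_curveR hc hc1] at hsin
  rw [dy_param] at hdy
  have h1 := tangentialGradSq_levelFun hs (sinC_sq hc hc1) hl' hr (u ∘ projM)
  have h2 := potential_levelFun hs (sinC_sq hc hc1) hl' hr
  have h3 : fderiv ℝ (u ∘ projM) (extChartAt J p p) = differential u p := by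
    rw [(hasFDerivAt_comp_projM hu _).fderiv, projM_extChartAt]
  rw [h3, hsin, hcos, hdy, sinh_curveY hc, mul_div_cancel_left₀ _ hs.ne',
    mul_div_cancel_left₀ _ hs.ne'] at h1
  rw [hcos] at h2
  unfold SoapBubble.potential SoapBubble.normalAt
  rw [coordMetric_productMetric, coordFun_eq, coordFun_eq]
  change tangentialGradSq spaceMetric (levelFun c) (u ∘ projM) _ + (-ricci spaceMetric _
    (normal spaceMetric (levelFun c) _) (normal spaceMetric (levelFun c) _) -
      normSqShape spaceMetric (levelFun c) _) * _ = _
  rw [h1, h2]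

theorem normal_vertical_eq (hc : 0 < c) (hc1 : c < 1) (β : ℝ) (z : Plane) {p : Torus × ℝ}
    (hp : p = projM (param c z)) :
    coordMetric (productMetric metric.inner) p (extChartAt J p p) ((bubble c hc hc1).normalAt p)
      (coordField (vertical β) p (extChartAt J p p)) = β * Real.sin (z 0) := by
  have hs := sinC_pos hc hc1
  have hx : projM (extChartAt J p p) = projM (param c z) := (projM_extChartAt p).trans hp
  have hl : levelFun c (extChartAt J p p) = 0 := by
    rw [← level_projM, hx, level_projM, levelFun_param hc hc1]
  have hdy := dy_of_projM_eq hx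
  rw [dy_param] at hdy
  have h1 := normal_eq hs (sinC_sq hc hc1) (levelFun_eq_zero_iff.1 hl)
  unfold SoapBubble.normalAt
  rw [coordField_vertical β p (mem_extChartAt_target p), coordMetric_productMetric, coordFun_eq]
  change spaceMetric _ (normal spaceMetric (levelFun c) _) (β • vy) = _
  rw [h1, hdy, sinh_curveY hc, mul_div_cancel_left₀ _ hs.ne']
  simp [spaceMetric, mul_comm]

/-- By contraposition: a mean-zero u with nonpositive index form is pulled back to the (τ, θ)-plane,
found to be β sin τ, and recognized as the normal component of a vertical Killing field. -/
theorem isStable_bubble (hc : 0 < c) (hc1 : c < 1) (hc2 : c ≤ 1 / 2) :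
    (bubble c hc hc1).IsStable 2 := by
  have hsurf : (bubble c hc hc1).surface = {q | level c q = 0} := frontier_level hc hc1
  refine ⟨area c, by rw [hsurf]; exact isRiemannianMeasure_area hc hc1, fun u hu hmean hk => ?_⟩
  by_contra hQ
  rw [not_lt] at hQ
  apply hk
  have hs := sinC_pos hc hc1
  have hCc := continuous_cosR c
  have hkc := continuous_kap c
  have hCpos := cosR_pos hc hc1
  have hCne : ∀ x, cosR c x ≠ 0 := fun x => (hCpos x).ne'
  set w : Space → ℝ := u ∘ projM with hw
  have hwd : ContDiff ℝ ∞ w := (hu.comp contMDiff_projM).contDiff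
  have hwf : ∀ x, HasFDerivAt w (fderiv ℝ w x) x := fun x =>
    (hwd.differentiable (by simp) x).hasFDerivAt
  have hwc : Continuous (fderiv ℝ w) := hwd.continuous_fderiv (by simp)
  set φ : ℝ × ℝ → Space := fun z => param c !₂[z.1, z.2] with hφ
  have hpl : Continuous fun z : ℝ × ℝ => (!₂[z.1, z.2] : Plane) := by fun_prop
  have hφc : Continuous φ := (contDiff_param hc hc1).continuous.comp hpl
  have htv : Continuous fun z : ℝ × ℝ => tangentVec (Real.cos z.1) (Real.sin z.1) := by
    unfold tangentVec; fun_prop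
  set U : ℝ → ℝ → ℝ := fun τ θ => w (φ (τ, θ)) with hU
  set Uτ : ℝ → ℝ → ℝ := fun τ θ => sinC c / cosR c τ *
    fderiv ℝ w (φ (τ, θ)) (tangentVec (Real.cos τ) (Real.sin τ)) with hUτ
  set Uθ : ℝ → ℝ → ℝ := fun τ θ => fderiv ℝ w (φ (τ, θ)) vt with hUθ
  have hUc : Continuous fun z : ℝ × ℝ => U z.1 z.2 := hwd.continuous.comp hφc
  have hUτc : Continuous fun z : ℝ × ℝ => Uτ z.1 z.2 :=
    (continuous_const.div (hCc.comp continuous_fst) fun z => hCne z.1).mul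
      ((hwc.comp hφc).clm_apply htv)
  have hUθc : Continuous fun z : ℝ × ℝ => Uθ z.1 z.2 :=
    (hwc.comp hφc).clm_apply continuous_const
  have hUτd : ∀ τ θ, HasDerivAt (fun τ => U τ θ) (Uτ τ θ) τ := by
    intro τ θ
    have h1 : HasDerivAt (fun τ : ℝ => (!₂[τ, θ] : Plane)) (EuclideanSpace.single 0 1) τ := by
      rw [funext fun τ => plane_eq_sum τ θ]
      simpa using ((hasDerivAt_id τ).smul_const (EuclideanSpace.single 0 1 : Plane)).add_const
        (θ • (EuclideanSpace.single 1 1 : Plane))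
    have h2 := (hwf _).comp_hasDerivAt τ ((hasFDerivAt_param hc hc1 _).comp_hasDerivAt τ h1)
    refine h2.congr_deriv ?_
    simp [hUτ, paramDeriv, hφ]
  have hUθd : ∀ τ θ, HasDerivAt (fun θ => U τ θ) (Uθ τ θ) θ := by
    intro τ θ
    have h1 : HasDerivAt (fun θ : ℝ => (!₂[τ, θ] : Plane)) (EuclideanSpace.single 1 1) θ := by
      rw [funext fun θ => plane_eq_sum τ θ]
      simpa using ((hasDerivAt_id θ).smul_const (EuclideanSpace.single 1 1 : Plane)).const_add
        (τ • (EuclideanSpace.single 0 1 : Plane))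
    have h2 := (hwf _).comp_hasDerivAt θ ((hasFDerivAt_param hc hc1 _).comp_hasDerivAt θ h1)
    refine h2.congr_deriv ?_
    simp [hUθ, paramDeriv, hφ]
  have hper : ∀ θ, U (-(Real.pi / 2) + 2 * Real.pi) θ = U (-(Real.pi / 2)) θ := by
    intro θ
    simp [hU, hφ, param, curveR, curveY, Real.cos_add_two_pi, Real.sin_add_two_pi]
  have hemb : ∀ τ θ : ℝ, emb c ((τ : AddCircle (2 * Real.pi)), (θ : AddCircle (1 : ℝ))) =
      projM (φ (τ, θ)) := fun τ θ => emb_proj c !₂[τ, θ]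
  have hdens : ∀ τ θ : ℝ, areaDensity c ((τ : AddCircle (2 * Real.pi)), (θ : AddCircle (1 : ℝ))) =
      sinC c / (cosR c τ * (1 + cosR c τ)) := fun τ θ => areaDensity_proj c !₂[τ, θ]
  have hM : ∫ θ in (0 : ℝ)..1, ∫ τ in (-(Real.pi / 2))..(-(Real.pi / 2) + 2 * Real.pi),
      kap c τ * (U τ θ / cosR c τ) = 0 := by
    have hcont : Continuous fun z : ℝ × ℝ => kap c z.1 * (U z.1 z.2 / cosR c z.1) :=
      (hkc.comp continuous_fst).mul (hUc.div (hCc.comp continuous_fst) fun z => hCne z.1)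
    rw [integral_area hc hc1, integral_torus
      (f := fun τ θ => sinC c * (kap c τ * (U τ θ / cosR c τ))) (continuous_const.mul hcont)
      (fun τ θ => by
        have := hCpos τ
        rw [hemb, hdens, kap]
        change _ * U τ θ = _
        field_simp)] at hmean
    simp_rw [intervalIntegral.integral_const_mul] at hmean
    exact (mul_eq_zero.1 hmean).resolve_left hs.ne'
  -- The product of the area density sκ/C and the geometric integrand is s⁻¹ times `indexDensity`,
  -- because ∂_τ is s/C times the unit tangent.
  have hI : ∫ θ in (0 : ℝ)..1, ∫ τ in (-(Real.pi / 2))..(-(Real.pi / 2) + 2 * Real.pi),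
      indexDensity c τ (U τ θ) (Uτ τ θ) (Uθ τ θ) ≤ 0 := by
    have hcont : Continuous fun z : ℝ × ℝ =>
        indexDensity c z.1 (U z.1 z.2) (Uτ z.1 z.2) (Uθ z.1 z.2) := by
      have hC1 : Continuous fun z : ℝ × ℝ => cosR c z.1 := hCc.comp continuous_fst
      have hk1 : Continuous fun z : ℝ × ℝ => kap c z.1 := hkc.comp continuous_fst
      have hw1 : Continuous fun z : ℝ × ℝ => sinC c ^ 2 * (1 + cosR c z.1) / cosR c z.1 :=
        Continuous.div (by fun_prop) hC1 fun z => hCne z.1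
      have hp1 : Continuous fun z : ℝ × ℝ =>
          (1 - cosR c z.1 - cosR c z.1 ^ 2) * kap c z.1 / cosR c z.1 :=
        Continuous.div (by fun_prop) hC1 fun z => hCne z.1
      unfold indexDensity
      exact (((hC1.mul hk1).mul (hUτc.pow 2)).add (hp1.mul (hUc.pow 2))).add (hw1.mul (hUθc.pow 2))
    rw [SoapBubble.indexForm, integral_area hc hc1, integral_torus
      (f := fun τ θ => (sinC c)⁻¹ * indexDensity c τ (U τ θ) (Uτ τ θ) (Uθ τ θ))
      (continuous_const.mul hcont) (fun τ θ => by
        have := hCpos τ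
        rw [index_integrand_eq hc hc1 hu !₂[τ, θ] (hemb τ θ), hemb, hdens]
        have h1 : fderiv ℝ w (φ (τ, θ)) = differential u (projM (φ (τ, θ))) :=
          (hasFDerivAt_comp_projM hu _).fderiv
        have h2 : u (projM (φ (τ, θ))) = U τ θ := rfl
        simp only [hUτ, hUθ, indexDensity, h1, h2, kap, Matrix.cons_val_zero]
        field_simp
        ring)] at hQ
    simp_rw [intervalIntegral.integral_const_mul] at hQ
    exact nonpos_of_mul_nonpos_right hQ (inv_pos.2 hs)
  obtain ⟨β, hβ⟩ := eq_mul_sin_of_integral_nonpos hc hc2 hUc hUτc hUθc hUτd hUθd hper hM hI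
  refine ⟨vertical β, isKilling_vertical β, fun p hp => ?_⟩
  rw [hsurf, ← range_emb hc hc1] at hp
  obtain ⟨⟨a, b⟩, rfl⟩ := hp
  have ha : a ∈ (fun t : ℝ => (t : AddCircle (2 * Real.pi))) ''
      Icc (-(Real.pi / 2)) (-(Real.pi / 2) + 2 * Real.pi) := by
    rw [AddCircle.coe_image_Icc_eq]; trivial
  have hb : b ∈ (fun t : ℝ => (t : AddCircle (1 : ℝ))) '' Icc 0 (0 + 1) := by
    rw [AddCircle.coe_image_Icc_eq]; trivial
  obtain ⟨τ, hτ, rfl⟩ := ha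
  obtain ⟨θ, hθ, rfl⟩ := hb
  rw [zero_add] at hθ
  dsimp only
  rw [normal_vertical_eq hc hc1 β !₂[τ, θ] (hemb τ θ), hemb]
  exact hβ τ hτ θ hθ

end

/-! ### The enclosed volume -/

/-- The volume enclosed by the bubbles. -/
def enclosed (c : ℝ) : ENNReal := riemVol {q | level c q < 0}

theorem measurableSet_level (c : ℝ) : MeasurableSet {q | level c q < 0} :=
  (isOpen_lt (continuous_level c) continuous_const).measurableSet

theorem level_lt_zero_iff {c : ℝ} {q : Torus × ℝ} :
    level c q < 0 ↔ c < cosT q.1 / Real.cosh q.2 := by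
  rw [level, sub_neg, lt_div_iff₀ (Real.cosh_pos _)]

theorem level_subset {c c' : ℝ} (h : c ≤ c') : {q | level c' q < 0} ⊆ {q | level c q < 0} :=
  fun _ hq => level_lt_zero_iff.2 (h.trans_lt (level_lt_zero_iff.1 hq))

theorem enclosed_anti {c c' : ℝ} (h : c ≤ c') : enclosed c' ≤ enclosed c :=
  measure_mono (level_subset h)

instance : IsLocallyFiniteMeasure riemVol :=
  IsLocallyFiniteMeasure.withDensity_ofReal continuous_volDensity

theorem enclosed_lt_top {c : ℝ} (hc : 0 < c) : enclosed c < ⊤ :=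
  (measure_mono subset_closure).trans_lt (isCompact_closure_level hc).measure_lt_top

theorem cosT_le_one (p : Torus) : cosT p ≤ 1 := by
  obtain ⟨x, rfl⟩ := proj_surjective p
  exact Real.cos_le_one _

theorem enclosed_one : enclosed 1 = 0 := by
  have : {q | level 1 q < 0} = ∅ := by
    ext q
    simp only [level, one_mul, mem_ofPred_eq, mem_empty_iff_false, iff_false, not_lt, sub_nonneg]
    exact (cosT_le_one _).trans (Real.one_le_cosh _)
  rw [enclosed, this, measure_empty]

/-- Above each point of the torus, the level set contains at most two heights ±y₀. -/
theorem ae_level_ne {c : ℝ} (hc : 0 < c) : ∀ᵐ q ∂riemVol, level c q ≠ 0 := by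
  refine (withDensity_absolutelyContinuous _ _).ae_le ?_
  change ∀ᵐ q, level c q ≠ 0
  rw [ae_iff, Measure.volume_eq_prod]
  simp only [not_not]
  rw [Measure.measure_prod_null (isClosed_eq (continuous_level c) continuous_const).measurableSet]
  refine Eventually.of_forall fun p => ?_
  refine Set.Countable.measure_zero ?_ _
  by_cases h : ∃ y₀, level c (p, y₀) = 0
  · obtain ⟨y₀, h0⟩ := h
    refine ((countable_singleton (-y₀)).insert y₀).mono fun y hy => ?_
    have hy' : level c (p, y) = 0 := hy
    simp only [level] at h0 hy'
    have h1 : Real.cosh y = Real.cosh y₀ := mul_left_cancel₀ hc.ne' (by linarith)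
    have h2 : |y| = |y₀| := le_antisymm (Real.cosh_le_cosh.1 h1.le) (Real.cosh_le_cosh.1 h1.ge)
    exact abs_eq_abs.1 h2
  · push Not at h
    refine countable_empty.mono fun y hy => (h y hy).elim

/-- Dominated convergence: for c' > c/2 all domains lie in the one for c/2, of finite volume, and
their indicators converge off the null set where `level c` vanishes. -/
theorem continuousAt_enclosed {c : ℝ} (hc : 0 < c) : ContinuousAt enclosed c := by
  refine tendsto_measure_of_ae_tendsto_indicator (𝓝 c) (measurableSet_level c)
    (fun c => measurableSet_level c) (measurableSet_level (c / 2))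
    (enclosed_lt_top (half_pos hc)).ne ?_ ?_
  · filter_upwards [lt_mem_nhds (half_lt_self hc)] with c' hc'
    exact level_subset hc'.le
  · filter_upwards [ae_level_ne hc] with q hq
    have hne : cosT q.1 / Real.cosh q.2 ≠ c := by
      intro h
      apply hq
      rw [level, ← h]
      have := (Real.cosh_pos q.2).ne'
      field_simp
      ring
    simp only [level_lt_zero_iff]
    rcases lt_or_gt_of_ne hne with h | h
    · filter_upwards [lt_mem_nhds h] with c' hc'
      exact iff_of_false hc'.le.not_gt h.le.not_gt
    · filter_upwards [gt_mem_nhds h] with c' hc'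
      exact iff_of_true hc' h

theorem exists_le_volDensity : ∃ d : ℝ, 0 < d ∧ ∀ q, d ≤ volDensity q := by
  have hc : Continuous fun p : Torus => Real.sqrt (warpT p) :=
    Real.continuous_sqrt.comp contMDiff_warpT.continuous
  obtain ⟨p, -, hp⟩ := isCompact_univ.exists_isMinOn (univ_nonempty (α := Torus)) hc.continuousOn
  exact ⟨Real.sqrt (warpT p), Real.sqrt_pos.2 (warpT_pos p), fun q => hp (mem_univ q.1)⟩

theorem exists_le_enclosed {v : ℝ} (hv : 0 < v) :
    ∃ c, 0 < c ∧ c ≤ 1 ∧ ENNReal.ofReal v ≤ enclosed c := by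
  obtain ⟨d, hd, hdle⟩ := exists_le_volDensity
  set A : Set Torus := {p | 1 / 2 < cosT p} with hA
  have hAo : IsOpen A := isOpen_lt continuous_const continuous_cosT
  have hApos : 0 < volume A := hAo.measure_pos _ ⟨proj 0, by simp [hA]; norm_num⟩
  have hAfin : volume A ≠ ⊤ := measure_ne_top _ _
  set m := (volume A).toReal with hm
  have hmpos : 0 < m := ENNReal.toReal_pos hApos.ne' hAfin
  -- With density at least d, the slab A × [0, N] has volume at least d·m·N = v. For c = 1/(2 cosh
  -- N) the slab is enclosed, since c cosh y ≤ 1/2 < cos r there.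
  set N := v / (d * m) with hN
  have hNpos : 0 < N := by positivity
  refine ⟨1 / (2 * Real.cosh N), by positivity, ?_, ?_⟩
  · rw [div_le_one (by positivity)]
    linarith [Real.one_le_cosh N]
  have hsub : A ×ˢ Icc 0 N ⊆ {q | level (1 / (2 * Real.cosh N)) q < 0} := by
    rintro ⟨p, y⟩ ⟨hp, hy⟩
    have h1 : Real.cosh y ≤ Real.cosh N := by
      rw [Real.cosh_le_cosh, abs_of_nonneg hy.1, abs_of_pos hNpos]; exact hy.2
    have h2 : 1 / (2 * Real.cosh N) * Real.cosh y ≤ 1 / 2 := by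
      have := Real.cosh_pos N
      rw [div_mul_eq_mul_div, div_le_div_iff₀ (by positivity) (by norm_num)]
      linarith
    have hp' : 1 / 2 < cosT p := hp
    simp only [mem_ofPred_eq, level]
    linarith
  refine le_trans ?_ (measure_mono hsub)
  rw [riemVol, withDensity_apply _ (hAo.measurableSet.prod measurableSet_Icc)]
  have h3 : ∫⁻ _ in A ×ˢ Icc 0 N, ENNReal.ofReal d ≤
      ∫⁻ q in A ×ˢ Icc 0 N, ENNReal.ofReal (volDensity q) :=
    lintegral_mono fun q => ENNReal.ofReal_le_ofReal (hdle q)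
  refine le_trans (le_of_eq ?_) h3
  rw [setLIntegral_const, Measure.volume_eq_prod, Measure.prod_prod, Real.volume_Icc,
    ← ENNReal.ofReal_toReal hAfin, ← ENNReal.ofReal_mul ENNReal.toReal_nonneg,
    ← ENNReal.ofReal_mul hd.le]
  congr 1
  change v = d * (m * (N - 0))
  rw [hN]
  field_simp
  ring

/-- Every volume is enclosed by one of the bubbles. -/
theorem exists_enclosed_eq {v : ℝ} (hv : 0 < v) :
    ∃ c, 0 < c ∧ c < 1 ∧ enclosed c = ENNReal.ofReal v := by
  obtain ⟨c₀, h0, h1, hle⟩ := exists_le_enclosed hv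
  have hcont : ContinuousOn enclosed (Icc c₀ 1) := fun c hc =>
    (continuousAt_enclosed (h0.trans_le hc.1)).continuousWithinAt
  obtain ⟨c, hc, hcv⟩ := intermediate_value_Icc' h1 hcont
    (⟨by rw [enclosed_one]; exact zero_le, hle⟩ : ENNReal.ofReal v ∈ Icc (enclosed 1) (enclosed c₀))
  refine ⟨c, h0.trans_le hc.1, lt_of_le_of_ne hc.2 ?_, hcv⟩
  rintro rfl
  rw [enclosed_one] at hcv
  exact (ENNReal.ofReal_pos.2 hv).ne hcv

/-- Monotonicity would give v ≤ `enclosed (1 / 2)` if c > 1/2; the summand 1 makes the contradiction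
strict and the threshold volume positive. -/
theorem le_half_of_enclosed_eq {c v : ℝ} (h : enclosed c = ENNReal.ofReal v)
    (hv : (enclosed (1 / 2)).toReal + 1 ≤ v) : c ≤ 1 / 2 := by
  by_contra! hc
  have h1 := enclosed_anti hc.le
  have hfin := (enclosed_lt_top (c := 1 / 2) (by norm_num)).ne
  rw [h, ENNReal.ofReal_le_iff_le_toReal hfin] at h1
  linarith

/-- The bubbles do not meet the circle `r = π`. -/
theorem fst_image_surface_ne {c : ℝ} (hc : 0 < c) (hc1 : c < 1) :
    Prod.fst '' (bubble c hc hc1).surface ≠ univ := by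
  intro h
  have hmem : proj (EuclideanSpace.single 0 Real.pi) ∈ Prod.fst '' (bubble c hc hc1).surface := by
    rw [h]; trivial
  obtain ⟨q, hq, hq1⟩ := hmem
  have h1 : q ∈ {q | level c q = 0} := by rw [← frontier_level hc hc1]; exact hq
  have h2 : level c q = 0 := h1
  rw [level, hq1, cosT_proj] at h2
  have := mul_pos hc (Real.cosh_pos q.2)
  simp at h2
  linarith

end TorusBubble

end

theorem theorem1p4 :
    ∃ (X : Type) (_ : TopologicalSpace X) (_ : T2Space X) (_ : CompactSpace X)
      (_ : ConnectedSpace X) (_ : MeasurableSpace X) (_ : BorelSpace X)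
      (_ : ChartedSpace (EuclideanSpace ℝ (Fin 2)) X) (_ : IsManifold (𝓡 2) ∞ X)
      (g : Bundle.ContMDiffRiemannianMetric (𝓡 2) ∞ (EuclideanSpace ℝ (Fin 2))
        (fun p : X => TangentSpace (𝓡 2) p)),
      (∃ p : X, SoapBubbles.gaussCurvature g.inner p < 0) ∧
      ∃ S : Set.Ioi (0 : ℝ) → SoapBubbles.SoapBubble (SoapBubbles.productMetric g.inner),
        (∀ v, (S v).Encloses 3 v) ∧
        (∃ h : ℝ, 0 < h ∧ ∀ v, h ≤ (S v).meanCurv) ∧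
        (∀ v, Prod.fst '' (S v).surface ≠ Set.univ) ∧
        (∃ v₀ : ℝ, 0 < v₀ ∧ ∀ v : Set.Ioi (0 : ℝ), v₀ ≤ (v : ℝ) → (S v).IsStable 2) := by
  open TorusBubble in
  have hex := fun v : Set.Ioi (0 : ℝ) => exists_enclosed_eq v.2
  choose c hc hc1 hcv using hex
  refine ⟨Torus, inferInstance, inferInstance, inferInstance, inferInstance, inferInstance,
    inferInstance, inferInstance, inferInstance, metric, gaussCurvature_metric_neg,
    fun v => bubble (c v) (hc v) (hc1 v), fun v => ⟨riemVol, isRiemannianMeasure_riemVol, hcv v⟩,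
    ⟨1, one_pos, fun v => ?_⟩, fun v => fst_image_surface_ne (hc v) (hc1 v),
    (enclosed (1 / 2)).toReal + 1, by positivity, fun v hv =>
      isStable_bubble (hc v) (hc1 v) (le_half_of_enclosed_eq (hcv v) hv)⟩
  -- Each mean curvature is 1/s with s < 1, so h = 1 works.
  exact (one_le_div (sinC_pos (hc v) (hc1 v))).2 (sinC_lt_one (hc v) (hc1 v)).le
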